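/- Let $E$ be a finite extension of $\mathbb{Q}_p$ with residue field of cardinality $q$, let $n\ge 2$, and let $\Bbbk$ be an algebraically closed field of characteristic $\ell\neq p$ with $q\neq 1$ in $\Bbbk$; fix a square root $q^{1/2}\in\Bbbk$. Let $\mathcal{H}$ be the Iwahori--Matsumoto Hecke algebra of $\mathrm{GL}_n(E)$ over $\Bbbk$, i.e. the $\Bbbk$-algebra generated by $T_1,\dots,T_{n-1},X_1^{\pm1},\dots,X_n^{\pm1}$ with relations $(T_i-q)(T_i+1)=0$, $T_iT_j=T_jT_i$ for $|i-j|>1$, $T_iT_{i+1}T_i=T_{i+1}T_iT_{i+1}$, $X_iX_i^{-1}=1=X_i^{-1}X_i$, $X_iX_j=X_jX_i$, $T_iX_j=X_jT_i$ for $j\ne i,i+1$, and $T_iX_iT_i=qX_{i+1}$. Let $\mathrm{W}=\mathfrak{S}_n\ltimes\mathfrak{X}$ be the extended affine Weyl group, where $\mathfrak{X}$ is the group of Laurent monomials in $X_1,\dots,X_n$, with $\mathbb{I}=\{s_1,\dots,s_{n-1}\}$ the simple transpositions, $\tau=s_{n-1}\cdots s_1X_1$ and $s_0=\tau s_1\tau^{-1}$.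 For $w\in \mathrm{W}$ with reduced expression $w=s_{i_1}\cdots s_{i_r}\tau^j$ ($0\le i_a\le n-1$, $j\in\mathbb{Z}$) put $T_w=T_{s_{i_1}}\cdots T_{s_{i_r}}T_\tau^j\in\mathcal{H}$, where $T_{s_i}=T_i$ for $i\ge1$, $T_\tau=q^{-(n-1)/2}T_{n-1}\cdots T_1X_1$ and $T_{s_0}=T_\tau T_1T_\tau^{-1}=q^{n-1}X_1^{-1}X_n(T_{n-1}\cdots T_2T_1T_2\cdots T_{n-1})^{-1}$. For $J\subseteq\mathbb{I}$ let $\mathrm{W}_J=\langle J\rangle$ and $\mathbf{v}_J=\sum_{w\in \mathrm{W}_J}T_w$. The affine Schur algebra is $\mathcal{S}=\mathrm{End}_{\mathcal{H}}\bigl(\bigoplus_{J\subseteq\mathbb{I}}\mathbf{v}_J\mathcal{H}\bigr)$ (endomorphisms of right $\mathcal{H}$-modules). For $K,J\subseteq\mathbb{I}$ and $w\in \mathrm{W}$ let $\mathbf{b}^w_{K,J}\in\mathcal{S}$ be the homomorphism $\mathbf{v}_J\mathcal{H}\to\mathbf{v}_K\mathcal{H}$ with $\mathbf{b}^w_{K,J}(\mathbf{v}_J)=\sum_{u\in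 \mathrm{W}_Kw\mathrm{W}_J}T_u$, extended by zero to the other summands. A monomial $X_1^{a_1}\cdots X_n^{a_n}$ is called $J$-dominant if $a_i\ge a_j$ whenever $i\le j$ and $i,j$ lie in the same $\mathrm{W}_J$-orbit. Then: (1) The $\Bbbk$-algebra $\mathcal{S}$ is generated by the elements $\mathbf{b}^1_{K_2,K_1}$ for $K_1,K_2\subseteq\mathbb{I}$ (the splits and merges) together with the elements $\mathbf{b}^p_{J,J}$ for $J\subseteq\mathbb{I}$ and $p$ a $J$-dominant monomial. (2) For $J\subseteq\mathbb{I}$ and $p$ a $J$-dominant monomial, let $g_p\in\mathcal{H}$ be the sum of all monomials in the $\mathrm{W}_J$-orbit of $p$, and consider the endomorphism of $\mathbf{v}_J\mathcal{H}$ given by left multiplication with $g_p$, extended by zero to the other summands. The $\Bbbk$-span of all these endomorphisms, over all $J$ and $p$, is a commutative subalgebra $\mathcal{Q}$ of $\mathcal{S}$ (the sum over $J$ of the multiplications by $\mathrm{W}_J$-invariant Laurent polynomials), and $\mathcal{S}$ is generated by $\mathcal{Q}$ together with the splits and merges $\mathbf{b}^1_{K_2,K_1}$. -/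

import Mathlib

open scoped ValuativeRel DirectSum

noncomputable section

namespace AffineSchur

/-! Throughout, `n = m + 1`. The index set of the simple reflections `s_1, …, s_{n-1}` is `Fin m`
(the index `i : Fin m` stands for `s_{i+1}`), that of the variables `X_1, …, X_n` is
`Fin (m + 1)`. -/

section Weyl

variable (m : ℕ)

/-- The lattice `𝔛` of Laurent monomials `X_1^{a_1} ⋯ X_n^{a_n}`, written multiplicatively. -/
abbrev MonLattice : Type := Multiplicative (Fin (m + 1) → ℤ)

/-- The action of the symmetric group on Laurent monomials by permuting the variables,
`σ (X_i) = X_{σ i}`. -/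
def permAct : Equiv.Perm (Fin (m + 1)) →* MulAut (MonLattice m) where
  toFun σ :=
    { toFun := fun a => Multiplicative.ofAdd fun i => Multiplicative.toAdd a (σ⁻¹ i)
      invFun := fun a => Multiplicative.ofAdd fun i => Multiplicative.toAdd a (σ i)
      left_inv := fun a => by
        apply Multiplicative.toAdd.injective; funext i; simp
      right_inv := fun a => by
        apply Multiplicative.toAdd.injective; funext i; simp
      map_mul' := fun a b => rfl }
  map_one' := by ext a; rfl
  map_mul' σ τ := by ext a; rfl

/-- The extended affine Weyl group `W = 𝔖 ⋉ 𝔛` of `GL_n`, `n = m + 1`. -/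
abbrev Weyl : Type := MonLattice m ⋊[permAct m] Equiv.Perm (Fin (m + 1))

variable {m}

/-- The simple reflections `s_1, …, s_{n-1}` as permutations. -/
def simplePerm (i : Fin m) : Equiv.Perm (Fin (m + 1)) := Equiv.swap i.castSucc i.succ

/-- The inclusion of the symmetric group in `W`. -/
def perm (σ : Equiv.Perm (Fin (m + 1))) : Weyl m := SemidirectProduct.inr σ

/-- The Laurent monomial with exponent vector `a`, as an element of `W`. -/
def transl (a : Fin (m + 1) → ℤ) : Weyl m := SemidirectProduct.inl (Multiplicative.ofAdd a)

variable (m) in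
/-- `τ = s_{n-1} ⋯ s_1 X_1`. -/
def tau : Weyl m :=
  (List.ofFn fun i : Fin m => perm (simplePerm i)).reverse.prod * transl (Pi.single 0 1)

variable (m) in
/-- `s_0 = s_{n-1} ⋯ s_2 s_1 s_2 ⋯ s_{n-1} X_1 X_n⁻¹`. -/
def simpleZero : Weyl m :=
  (List.ofFn fun i : Fin m => perm (simplePerm i)).reverse.prod
    * (List.ofFn fun i : Fin m => perm (simplePerm i)).tail.prod
    * transl (Pi.single 0 1 - Pi.single (Fin.last m) 1)

/-- The affine simple reflections `s_0, s_1, …, s_{n-1}` in `W`. -/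
def affSimple : Fin (m + 1) → Weyl m := Fin.cons (simpleZero m) fun i => perm (simplePerm i)

/-- The element `s_{i_1} ⋯ s_{i_r} τ^j` of `W` attached to a word `i_1 … i_r` and `j ∈ ℤ`. -/
def wordW (e : List (Fin (m + 1)) × ℤ) : Weyl m := (e.1.map affSimple).prod * tau m ^ e.2

/-- The length of `w = x τ^j`: the least `r` such that `x` is a product of `r` of the reflections
`s_0, …, s_{n-1}`. -/
def length (w : Weyl m) : ℕ := sInf {r | ∃ e, wordW e = w ∧ e.1.length = r}

/-- The word `e` is a reduced expression of `w`. -/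
def IsReduced (w : Weyl m) (e : List (Fin (m + 1)) × ℤ) : Prop :=
  wordW e = w ∧ e.1.length = length w

/-- The parabolic subgroup `W_J` of the symmetric group. -/
def parabolic (J : Finset (Fin m)) : Subgroup (Equiv.Perm (Fin (m + 1))) :=
  Subgroup.closure (simplePerm '' (J : Set (Fin m)))

open scoped Classical in
/-- The elements of `W_J`, as a finite set. -/
def parabolicFinset (J : Finset (Fin m)) : Finset (Equiv.Perm (Fin (m + 1))) :=
  Finset.univ.filter fun σ => σ ∈ parabolic J

open scoped Classical in
/-- The double coset `W_K w W_J` in `W`, as a finite set. -/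
def dblCoset (K J : Finset (Fin m)) (w : Weyl m) : Finset (Weyl m) :=
  (parabolicFinset K ×ˢ parabolicFinset J).image fun x => perm x.1 * w * perm x.2

/-- The monomial with exponent vector `a` is `J`-dominant: `a_i ≥ a_j` whenever `i ≤ j` and the
indices `i` and `j` (that is, `X_i` and `X_j`) are conjugate under `W_J`. -/
def IsDominant (J : Finset (Fin m)) (a : Fin (m + 1) → ℤ) : Prop :=
  ∀ i j, i ≤ j → (∃ σ ∈ parabolic J, σ i = j) → a j ≤ a i

open scoped Classical in
/-- The exponent vectors of the monomials in the `W_J`-orbit of a monomial. -/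
def orbitFinset (J : Finset (Fin m)) (a : Fin (m + 1) → ℤ) : Finset (Fin (m + 1) → ℤ) :=
  (parabolicFinset J).image fun σ i => a (σ⁻¹ i)

end Weyl

section Hecke

/-- Generators of the Hecke algebra in its Bernstein presentation. -/
inductive Gen (m : ℕ) : Type
  | T (i : Fin m) : Gen m
  | X (i : Fin (m + 1)) : Gen m
  | Xinv (i : Fin (m + 1)) : Gen m

variable {k : Type*} [Field k]

variable (k) in
/-- A generator, as an element of the free algebra. -/
def gen {m : ℕ} (g : Gen m) : FreeAlgebra k (Gen m) := FreeAlgebra.ι k g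

open Gen in
/-- The defining relations of the Hecke algebra (Bernstein presentation). -/
inductive Rel (q : k) (m : ℕ) : FreeAlgebra k (Gen m) → FreeAlgebra k (Gen m) → Prop
  | quadratic (i : Fin m) :
      Rel q m ((gen k (T i) - algebraMap k _ q) * (gen k (T i) + 1)) 0
  | far (i j : Fin m) (h : (i : ℕ) + 1 < j) :
      Rel q m (gen k (T i) * gen k (T j)) (gen k (T j) * gen k (T i))
  | braid (i j : Fin m) (h : (i : ℕ) + 1 = j) :
      Rel q m (gen k (T i) * gen k (T j) * gen k (T i)) (gen k (T j) * gen k (T i) * gen k (T j))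
  | mul_inv (i : Fin (m + 1)) : Rel q m (gen k (X i) * gen k (Xinv i)) 1
  | inv_mul (i : Fin (m + 1)) : Rel q m (gen k (Xinv i) * gen k (X i)) 1
  | comm (i j : Fin (m + 1)) :
      Rel q m (gen k (X i) * gen k (X j)) (gen k (X j) * gen k (X i))
  | commTX (i : Fin m) (j : Fin (m + 1)) (h₁ : j ≠ i.castSucc) (h₂ : j ≠ i.succ) :
      Rel q m (gen k (T i) * gen k (X j)) (gen k (X j) * gen k (T i))
  | bernstein (i : Fin m) :
      Rel q m (gen k (T i) * gen k (X i.castSucc) * gen k (T i)) (q • gen k (X i.succ))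

/-- The Iwahori–Matsumoto Hecke algebra of `GL_n`, `n = m + 1`, with parameter `q`. -/
abbrev Hecke (q : k) (m : ℕ) : Type _ := RingQuot (Rel q m)

variable (q : k) {m : ℕ}

/-- The class of a generator in the Hecke algebra. -/
def hGen (g : Gen m) : Hecke q m := RingQuot.mkAlgHom k (Rel q m) (gen k g)

/-- `T_i`. -/
def hT (i : Fin m) : Hecke q m := hGen q (.T i)

/-- `T_i⁻¹ = q⁻¹ T_i + (q⁻¹ - 1)`. -/
def hTinv (i : Fin m) : Hecke q m := q⁻¹ • hT q i + algebraMap k _ (q⁻¹ - 1)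

/-- The variable `X_i`, as a unit of the Hecke algebra. -/
def hX (i : Fin (m + 1)) : (Hecke q m)ˣ where
  val := hGen q (.X i)
  inv := hGen q (.Xinv i)
  val_inv := by
    have h := RingQuot.mkAlgHom_rel k (Rel.mul_inv (q := q) i)
    simpa only [hGen, map_mul, map_one] using h
  inv_val := by
    have h := RingQuot.mkAlgHom_rel k (Rel.inv_mul (q := q) i)
    simpa only [hGen, map_mul, map_one] using h

/-- The Laurent monomial `X_1^{a_1} ⋯ X_n^{a_n}` in the Hecke algebra. -/
def hMon (a : Fin (m + 1) → ℤ) : Hecke q m :=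
  ((List.ofFn fun i => hX q i ^ a i).prod : (Hecke q m)ˣ)

/-- `T_{s_0} = q^{n-1} X_1⁻¹ X_n (T_{n-1} ⋯ T_2 T_1 T_2 ⋯ T_{n-1})⁻¹`. -/
def hTzero : Hecke q m :=
  q ^ m • ((((hX q 0)⁻¹ * hX q (Fin.last m) : (Hecke q m)ˣ) : Hecke q m)
    * ((List.ofFn (hTinv q (m := m))).reverse.prod * (List.ofFn (hTinv q (m := m))).tail.prod))

/-- `T_{s_0}, T_{s_1}, …, T_{s_{n-1}}`. -/
def hAff : Fin (m + 1) → Hecke q m := Fin.cons (hTzero q) (hT q)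

variable (r : k)

/-- `T_τ = q^{-(n-1)/2} T_{n-1} ⋯ T_1 X_1`, where `r` is the chosen square root of `q`. -/
def hTau : Hecke q m :=
  r⁻¹ ^ m • ((List.ofFn (hT q (m := m))).reverse.prod * (hX q (0 : Fin (m + 1)) : Hecke q m))

/-- `T_τ⁻¹ = q^{(n-1)/2} X_1⁻¹ T_1⁻¹ ⋯ T_{n-1}⁻¹`. -/
def hTauInv : Hecke q m :=
  r ^ m • ((((hX q 0)⁻¹ : (Hecke q m)ˣ) : Hecke q m) * (List.ofFn (hTinv q (m := m))).prod)

/-- The integral powers of `T_τ`. -/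
def hTauPow : ℤ → Hecke q m
  | .ofNat j => hTau q r ^ j
  | .negSucc j => hTauInv q r ^ (j + 1)

/-- The product `T_{s_{i_1}} ⋯ T_{s_{i_l}} T_τ^j`. -/
def wordH (e : List (Fin (m + 1)) × ℤ) : Hecke q m := (e.1.map (hAff q)).prod * hTauPow q r e.2

/-- The Iwahori–Matsumoto basis element `T_w`, `w ∈ W`: the product of the generators along a
reduced expression of `w`. (Every `w` has a reduced expression, and by the braid relations the
product does not depend on which one is chosen.) -/
def hTw (w : Weyl m) : Hecke q m := wordH q r (Classical.epsilon (IsReduced w))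

/-- `v_J = ∑_{w ∈ W_J} T_w`. -/
def v (J : Finset (Fin m)) : Hecke q m := ∑ σ ∈ parabolicFinset J, hTw q r (perm σ)

/-- The right ideal `v_J H`. -/
abbrev vIdeal (J : Finset (Fin m)) : Submodule (Hecke q m)ᵐᵒᵖ (Hecke q m) :=
  Submodule.span (Hecke q m)ᵐᵒᵖ {v q r J}

/-- The generator `v_J` of `v_J H`. -/
def vGen (J : Finset (Fin m)) : vIdeal q r J := ⟨v q r J, Submodule.mem_span_singleton_self _⟩

variable (m) in
/-- The right `H`-module `⨁_J v_J H`, over all subsets `J` of the set of simple reflections. -/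
abbrev permModule : Type _ := ⨁ J : Finset (Fin m), vIdeal q r J

variable (m) in
/-- The affine Schur algebra `S = End_H (⨁_J v_J H)`, with composition as product. -/
abbrev Schur : Type _ := Module.End (Hecke q m)ᵐᵒᵖ (permModule q m r)

/-- The endomorphism `φ` is the homomorphism `v_J H → v_K H` with `v_J ↦ y`, extended by zero to
the other summands. -/
def IsHomTo (K J : Finset (Fin m)) (y : Hecke q m) (φ : Schur q m r) : Prop :=
  (∀ L, L ≠ J → ∀ x : vIdeal q r L,
      φ (DirectSum.lof (Hecke q m)ᵐᵒᵖ _ (fun L => vIdeal q r L) L x) = 0) ∧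
    ∃ z : vIdeal q r K, (z : Hecke q m) = y ∧
      φ (DirectSum.lof (Hecke q m)ᵐᵒᵖ _ (fun L => vIdeal q r L) J (vGen q r J)) =
        DirectSum.lof (Hecke q m)ᵐᵒᵖ _ (fun L => vIdeal q r L) K z

/-- `φ` is the element `b^w_{K,J} : v_J ↦ ∑_{u ∈ W_K w W_J} T_u` of the Schur algebra. -/
def IsB (K J : Finset (Fin m)) (w : Weyl m) (φ : Schur q m r) : Prop :=
  IsHomTo q r K J (∑ u ∈ dblCoset K J w, hTw q r u) φ

variable (m) in
/-- The set of all `b^1_{K,J}` (splits and merges). -/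
def splitsMerges : Set (Schur q m r) := {φ | ∃ K J, IsB q r K J 1 φ}

variable (m) in
/-- The set of all `b^p_{J,J}` with `p` a `J`-dominant monomial. -/
def dominantB : Set (Schur q m r) :=
  {φ | ∃ (J : Finset (Fin m)) (a : Fin (m + 1) → ℤ), IsDominant J a ∧ IsB q r J J (transl a) φ}

variable (m) in
/-- The set of the endomorphisms of the summands `v_J H` that are given by left multiplication
with the sum of all monomials in the `W_J`-orbit of a `J`-dominant monomial. -/
def orbitMuls : Set (Schur q m r) :=
  {φ | ∃ (J : Finset (Fin m)) (a : Fin (m + 1) → ℤ), IsDominant J a ∧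
    IsHomTo q r J J ((∑ b ∈ orbitFinset J a, hMon q b) * v q r J) φ}

end Hecke

end AffineSchur

end

noncomputable section

namespace AffineSchur

/-! ### The symmetric group: inversions, blocks, parabolic subgroups and minimal coset
representatives. -/

section Combinatorics

variable {m : ℕ}

/-! An endomorphism is the sum of its matrix entries `v_J H → v_K H`, so it suffices to reach every
such homomorphism (`eq_top_of_mem`). It is determined by the image `z` of `v_J`, and `z` satisfies
`z T_j = q z` for `j ∈ J` and `T_i z = q z` for `i ∈ K`. The algebra acts on rational functions by
Demazure–Lusztig operators. This action is triangular with respect to the permutation automorphisms,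
and these are linearly independent, so the products `T_w X^a` are independent
(`rightSum_univ_eq_zero`). The condition on the right then gives `z = ∑ T_d f_d v_J`, over the
minimal representatives `d` of the cosets of `W_J` in `𝔖_n`, with Laurent polynomials `f_d`
(`exists_homSum`). The condition on the left makes `f` constant along left multiplication by `W_K`,
and makes `f_σ` invariant under each reflection of `J` that `σ` carries to a reflection of `K`
(`homSum_invariance`). So `z` is determined by the `f_σ` at minimal double coset representatives.
Each double coset contributes a composite: split, multiply by `f_σ`, apply `T_σ`, merge. Subtracting
these one at a time (`mem_homSum`) leaves two families to produce: the maps `T_σ` between matching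
Levi types, and multiplication by invariant Laurent polynomials.

The maps `T_σ` come from splits and merges alone (`mem_TT`), by induction on length. A general `σ`
factors into shorter matching permutations. When `σ` exchanges two adjacent blocks, the merge
followed by the split is `T_σ` plus terms from strictly shorter double coset representatives.

For statement (2), orbit sums of dominant monomials span the invariants (`mem_span_orbitSum`), so
nothing more is needed. For statement (1), let `a` be `J`-dominant, and let `L` be the set of
reflections of `J` fixing `a`. Splitting to `L`, multiplying by `X^a` and merging back gives the
orbit sum of `a` plus terms of smaller Euclidean norm (`exists_relSum_mul_mono`). Hence the
invariants follow once multiplication by `X^a` on `v_L H` is available for every `a` constant on the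
`L`-blocks (`mem_of_monomials`).

Such monomials are products of powers of `X_1 ⋯ X_b`, where `b` is the end of a block. The
translation by `X_1 ⋯ X_b` is a permutation times `τ^b`, so the image of `v_L` under its `b^p_{L,L}`
can be computed, and it differs from multiplication by the monomial only by an invertible factor in
the finite Hecke algebra. That factor is already in the algebra of splits and merges
(`mem_firstExp`). Reading off the basis elements needs `T_{σ τ^j} = T_σ T_τ^j` for an arbitrary
reduced expression. This is obtained without braid moves, from the function `semiLength`, which
bounds word length from below (`Tw_perm_mul_tau`). -/

theorem perm_apply_inv (σ : Equiv.Perm (Fin (m + 1))) (x : Fin (m + 1)) : σ (σ⁻¹ x) = x :=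
  Equiv.apply_symm_apply σ x

theorem perm_inv_apply (σ : Equiv.Perm (Fin (m + 1))) (x : Fin (m + 1)) : σ⁻¹ (σ x) = x :=
  Equiv.symm_apply_apply σ x

theorem simplePerm_castSucc (i : Fin m) : simplePerm i i.castSucc = i.succ :=
  Equiv.swap_apply_left _ _

theorem simplePerm_succ (i : Fin m) : simplePerm i i.succ = i.castSucc :=
  Equiv.swap_apply_right _ _

theorem simplePerm_of_ne (i : Fin m) {j : Fin (m + 1)} (h₁ : j ≠ i.castSucc) (h₂ : j ≠ i.succ) :
    simplePerm i j = j :=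
  Equiv.swap_apply_of_ne_of_ne h₁ h₂

@[simp]
theorem simplePerm_mul_self (i : Fin m) : simplePerm i * simplePerm i = 1 :=
  Equiv.swap_mul_self _ _

@[simp]
theorem simplePerm_simplePerm (i : Fin m) (j : Fin (m + 1)) :
    simplePerm i (simplePerm i j) = j :=
  congrFun (congrArg DFunLike.coe (simplePerm_mul_self i)) j

@[simp]
theorem simplePerm_inv (i : Fin m) : (simplePerm i)⁻¹ = simplePerm i :=
  Equiv.swap_inv _ _

@[simp]
theorem mul_simplePerm_cancel (σ : Equiv.Perm (Fin (m + 1))) (i : Fin m) :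
    σ * simplePerm i * simplePerm i = σ := by
  rw [mul_assoc, simplePerm_mul_self, mul_one]

@[simp]
theorem simplePerm_mul_cancel (σ : Equiv.Perm (Fin (m + 1))) (i : Fin m) :
    simplePerm i * (simplePerm i * σ) = σ := by
  rw [← mul_assoc, simplePerm_mul_self, one_mul]

theorem simplePerm_val (i : Fin m) (j : Fin (m + 1)) :
    (simplePerm i j : ℕ) = if (j : ℕ) = i then (i : ℕ) + 1 else if (j : ℕ) = i + 1 then (i : ℕ)
      else j := by
  rw [simplePerm, Equiv.swap_apply_def]
  simp only [Fin.ext_iff, Fin.val_castSucc, Fin.val_succ]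
  split_ifs <;> simp

theorem simplePerm_lt (i : Fin m) {a b : Fin (m + 1)} (h : a < b)
    (hne : ¬ (a = i.castSucc ∧ b = i.succ)) : simplePerm i a < simplePerm i b := by
  simp only [Fin.lt_def, Fin.ext_iff, Fin.val_castSucc, Fin.val_succ, simplePerm_val] at *
  split_ifs <;> omega

/-- The inversions of a permutation. -/
def inversions (σ : Equiv.Perm (Fin (m + 1))) : Finset (Fin (m + 1) × Fin (m + 1)) :=
  Finset.univ.filter fun x => x.1 < x.2 ∧ σ x.2 < σ x.1

theorem mem_inversions {σ : Equiv.Perm (Fin (m + 1))} {a b : Fin (m + 1)} :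
    (a, b) ∈ inversions σ ↔ a < b ∧ σ b < σ a := by
  simp [inversions]

/-- The number of inversions of a permutation, that is, its Coxeter length. -/
def invCount (σ : Equiv.Perm (Fin (m + 1))) : ℕ := (inversions σ).card

@[simp]
theorem invCount_one : invCount (1 : Equiv.Perm (Fin (m + 1))) = 0 := by
  rw [invCount, Finset.card_eq_zero, Finset.eq_empty_iff_forall_notMem]
  rintro ⟨a, b⟩ h
  rw [mem_inversions] at h
  exact lt_asymm h.1 h.2

theorem invCount_inv (σ : Equiv.Perm (Fin (m + 1))) : invCount σ⁻¹ = invCount σ := by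
  refine Finset.card_bij (fun x _ => (σ⁻¹ x.2, σ⁻¹ x.1)) ?_ ?_ ?_
  · rintro ⟨a, b⟩ h
    rw [mem_inversions] at h
    simp only [mem_inversions, perm_apply_inv]
    exact ⟨h.2, h.1⟩
  · rintro ⟨a, b⟩ _ ⟨c, d⟩ _ h
    simpa [and_comm] using h
  · rintro ⟨a, b⟩ h
    rw [mem_inversions] at h
    exact ⟨(σ b, σ a), by simpa [mem_inversions] using ⟨h.2, h.1⟩, by simp⟩

/-- The reflection `s_i` preserves the order of every pair of positions except `(i, i+1)`. Hence the
inversions of `σ s_i` are those of `σ` transported by `s_i`, together with that one new pair. -/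
theorem invCount_mul_of_lt {σ : Equiv.Perm (Fin (m + 1))} {i : Fin m}
    (h : σ i.castSucc < σ i.succ) : invCount (σ * simplePerm i) = invCount σ + 1 := by
  have key : inversions (σ * simplePerm i) = insert (i.castSucc, i.succ)
      ((inversions σ).map ((simplePerm i).prodCongr (simplePerm i)).toEmbedding) := by
    ext ⟨a, b⟩
    rw [mem_inversions, Finset.mem_insert, Finset.mem_map]
    constructor
    · rintro ⟨hab, h2⟩
      by_cases hne : a = i.castSucc ∧ b = i.succ
      · left; rw [hne.1, hne.2]
      · right
        refine ⟨(simplePerm i a, simplePerm i b), mem_inversions.2 ⟨simplePerm_lt i hab hne, h2⟩, ?_⟩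
        simp
    · rintro (h1 | ⟨⟨c, d⟩, hcd, h1⟩)
      · simp only [Prod.mk.injEq] at h1
        obtain ⟨rfl, rfl⟩ := h1
        refine ⟨Fin.castSucc_lt_succ, ?_⟩
        simpa [simplePerm_castSucc, simplePerm_succ] using h
      · simp only [Equiv.toEmbedding_apply, Equiv.prodCongr_apply, Prod.map_apply,
          Prod.mk.injEq] at h1
        obtain ⟨rfl, rfl⟩ := h1
        rw [mem_inversions] at hcd
        refine ⟨simplePerm_lt i hcd.1 ?_, by simpa using hcd.2⟩
        rintro ⟨rfl, rfl⟩
        exact lt_asymm h hcd.2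
  rw [invCount, key, Finset.card_insert_of_notMem, Finset.card_map, invCount]
  rw [Finset.mem_map]
  rintro ⟨⟨c, d⟩, hcd, h1⟩
  simp only [Equiv.toEmbedding_apply, Equiv.prodCongr_apply, Prod.map_apply, Prod.mk.injEq] at h1
  have hc : c = i.succ := by rw [← simplePerm_castSucc, ← h1.1, simplePerm_simplePerm]
  have hd : d = i.castSucc := by rw [← simplePerm_succ, ← h1.2, simplePerm_simplePerm]
  rw [mem_inversions, hc, hd] at hcd
  exact lt_asymm hcd.1 Fin.castSucc_lt_succ

theorem invCount_mul_of_gt {σ : Equiv.Perm (Fin (m + 1))} {i : Fin m}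
    (h : σ i.succ < σ i.castSucc) : invCount (σ * simplePerm i) + 1 = invCount σ := by
  have := invCount_mul_of_lt (σ := σ * simplePerm i) (i := i)
    (by simpa [simplePerm_castSucc, simplePerm_succ] using h)
  rw [← this, mul_simplePerm_cancel]

theorem lt_or_gt_simple (σ : Equiv.Perm (Fin (m + 1))) (i : Fin m) :
    σ i.castSucc < σ i.succ ∨ σ i.succ < σ i.castSucc :=
  lt_or_gt_of_ne fun h => Fin.castSucc_lt_succ.ne (σ.injective h)

theorem lt_iff_invCount_mul {σ : Equiv.Perm (Fin (m + 1))} {i : Fin m} :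
    σ i.castSucc < σ i.succ ↔ invCount σ < invCount (σ * simplePerm i) := by
  rcases lt_or_gt_simple σ i with h | h
  · have := invCount_mul_of_lt h; simp only [h, true_iff]; omega
  · have := invCount_mul_of_gt h; simp only [h.not_gt, false_iff]; omega

theorem invCount_simple_mul (σ : Equiv.Perm (Fin (m + 1))) (i : Fin m) :
    invCount (simplePerm i * σ) = invCount (σ⁻¹ * simplePerm i) := by
  rw [← invCount_inv, mul_inv_rev, simplePerm_inv]

theorem invCount_simple_mul_of_lt {σ : Equiv.Perm (Fin (m + 1))} {i : Fin m}
    (h : σ⁻¹ i.castSucc < σ⁻¹ i.succ) : invCount (simplePerm i * σ) = invCount σ + 1 := by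
  rw [invCount_simple_mul, invCount_mul_of_lt h, invCount_inv]

theorem invCount_simple_mul_of_gt {σ : Equiv.Perm (Fin (m + 1))} {i : Fin m}
    (h : σ⁻¹ i.succ < σ⁻¹ i.castSucc) : invCount (simplePerm i * σ) + 1 = invCount σ := by
  rw [invCount_simple_mul, invCount_mul_of_gt h, invCount_inv]

theorem invCount_mul_simple_le (σ : Equiv.Perm (Fin (m + 1))) (i : Fin m) :
    invCount (σ * simplePerm i) ≤ invCount σ + 1 := by
  rcases lt_or_gt_simple σ i with h | h
  · exact (invCount_mul_of_lt h).le
  · have := invCount_mul_of_gt h; omega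

theorem eq_one_of_forall_lt {σ : Equiv.Perm (Fin (m + 1))}
    (h : ∀ i : Fin m, σ i.castSucc < σ i.succ) : σ = 1 := by
  have hm : StrictMono σ := Fin.strictMono_iff_lt_succ.2 h
  ext x
  exact congrArg Fin.val (DFunLike.congr_fun
    (Subsingleton.elim (hm.orderIsoOfSurjective _ σ.surjective) (OrderIso.refl _)) x)

theorem exists_descent {σ : Equiv.Perm (Fin (m + 1))} (h : σ ≠ 1) :
    ∃ i : Fin m, σ i.succ < σ i.castSucc := by
  by_contra! hc
  exact h (eq_one_of_forall_lt fun i =>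
    lt_of_le_of_ne (hc i) fun h => Fin.castSucc_lt_succ.ne (σ.injective h))

/-- Induction on the length, with right multiplication by simple reflections. -/
theorem perm_induction {motive : Equiv.Perm (Fin (m + 1)) → Prop} (one : motive 1)
    (mul : ∀ σ (i : Fin m), σ i.castSucc < σ i.succ → motive σ → motive (σ * simplePerm i))
    (σ : Equiv.Perm (Fin (m + 1))) : motive σ := by
  induction h : invCount σ using Nat.strong_induction_on generalizing σ with
  | _ l ih =>
    by_cases h1 : σ = 1
    · rw [h1]; exact one
    · obtain ⟨i, hi⟩ := exists_descent h1
      have h2 := invCount_mul_of_gt hi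
      have := mul (σ * simplePerm i) i (by simpa [simplePerm_castSucc, simplePerm_succ] using hi)
        (ih _ (by omega) _ rfl)
      simpa using this

theorem invCount_eq_zero {σ : Equiv.Perm (Fin (m + 1))} : invCount σ = 0 ↔ σ = 1 := by
  constructor
  · intro h
    by_contra h1
    obtain ⟨i, hi⟩ := exists_descent h1
    have := invCount_mul_of_gt hi
    omega
  · rintro rfl; simp

/-- The inversion set decides the order of any two values, so two permutations with the same
inversions differ by an order automorphism of a finite chain. This turns an inclusion of inversion
sets into a strict inequality of lengths. -/
theorem eq_of_inversions_eq {σ τ : Equiv.Perm (Fin (m + 1))} (h : inversions σ = inversions τ) :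
    σ = τ := by
  have key : ∀ a b, σ a < σ b → τ a < τ b := by
    intro a b hab
    rcases lt_trichotomy a b with h1 | h1 | h1
    · by_contra h2
      have h3 : τ b < τ a := lt_of_le_of_ne (not_lt.1 h2) fun h => h1.ne' (τ.injective h)
      have := mem_inversions.1 (h ▸ mem_inversions.2 ⟨h1, h3⟩ : (a, b) ∈ inversions σ)
      exact lt_asymm this.2 hab
    · subst h1; exact absurd hab (lt_irrefl _)
    · exact (mem_inversions.1 (h ▸ mem_inversions.2 ⟨h1, hab⟩ : (b, a) ∈ inversions τ)).2
  have : τ * σ⁻¹ = 1 := eq_one_of_forall_lt fun i => key _ _ (by simp)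
  exact (mul_inv_eq_one.1 this).symm

/-- `σ` is increasing on the `J`-blocks, that is, of minimal length in `σ W_J`. -/
def IncOn (J : Finset (Fin m)) (σ : Equiv.Perm (Fin (m + 1))) : Prop :=
  ∀ i ∈ J, σ i.castSucc < σ i.succ

/-- The number of the block of `j` in the partition given by `J`. -/
def block (J : Finset (Fin m)) (j : Fin (m + 1)) : ℕ :=
  (Finset.univ.filter fun i : Fin m => i ∉ J ∧ i.castSucc < j).card

theorem block_mono (J : Finset (Fin m)) : Monotone (block J) := fun _ _ h =>
  Finset.card_le_card fun _ hi => by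
    simp only [Finset.mem_filter, Finset.mem_univ, true_and] at hi ⊢
    exact ⟨hi.1, hi.2.trans_le h⟩

theorem block_eq_iff {J : Finset (Fin m)} {a b : Fin (m + 1)} (h : a ≤ b) :
    block J a = block J b ↔ ∀ i : Fin m, a ≤ i.castSucc → i.castSucc < b → i ∈ J := by
  have hsub : (Finset.univ.filter fun i : Fin m => i ∉ J ∧ i.castSucc < a) ⊆
      (Finset.univ.filter fun i : Fin m => i ∉ J ∧ i.castSucc < b) := fun _ hi => by
    simp only [Finset.mem_filter, Finset.mem_univ, true_and] at hi ⊢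
    exact ⟨hi.1, hi.2.trans_le h⟩
  constructor
  · intro hab i h1 h2
    by_contra hi
    have := Finset.eq_of_subset_of_card_le hsub hab.ge
    have hm : i ∈ (Finset.univ.filter fun i : Fin m => i ∉ J ∧ i.castSucc < b) := by
      simp [hi, h2]
    rw [← this] at hm
    simp only [Finset.mem_filter] at hm
    exact absurd hm.2.2 (not_lt.2 h1)
  · intro hi
    refine congrArg Finset.card (Finset.Subset.antisymm hsub fun i h => ?_)
    simp only [Finset.mem_filter, Finset.mem_univ, true_and] at h ⊢
    refine ⟨h.1, ?_⟩
    by_contra h3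
    exact h.1 (hi i (not_lt.1 h3) h.2)

theorem block_simple_iff {J : Finset (Fin m)} {i : Fin m} :
    block J i.castSucc = block J i.succ ↔ i ∈ J := by
  rw [block_eq_iff Fin.castSucc_lt_succ.le]
  constructor
  · intro h; exact h i le_rfl Fin.castSucc_lt_succ
  · intro h j h1 h2
    have : j = i := by
      simp only [Fin.le_def, Fin.lt_def, Fin.val_castSucc, Fin.val_succ, Fin.ext_iff] at *
      omega
    rwa [this]

theorem simplePerm_mem_parabolic {J : Finset (Fin m)} {i : Fin m} (h : i ∈ J) :
    simplePerm i ∈ parabolic J :=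
  Subgroup.subset_closure ⟨i, h, rfl⟩

/-- `W_J` is the stabiliser of the blocks. For the converse, induct on length: since block numbers
are monotone, a block-preserving permutation can only have a descent between two neighbours of the
same block. -/
theorem mem_parabolic {J : Finset (Fin m)} {σ : Equiv.Perm (Fin (m + 1))} :
    σ ∈ parabolic J ↔ ∀ x, block J (σ x) = block J x := by
  constructor
  · intro h
    induction h using Subgroup.closure_induction with
    | mem σ h =>
      obtain ⟨i, hi, rfl⟩ := h
      have hb := block_simple_iff.2 (Finset.mem_coe.1 hi)
      intro x
      by_cases h1 : x = i.castSucc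
      · rw [h1, simplePerm_castSucc, hb]
      by_cases h2 : x = i.succ
      · rw [h2, simplePerm_succ, hb]
      rw [simplePerm_of_ne i h1 h2]
    | one => intro x; rfl
    | mul σ τ _ _ h1 h2 => intro x; rw [Equiv.Perm.mul_apply, h1, h2]
    | inv σ _ h => intro x; rw [← h, perm_apply_inv]
  · induction σ using perm_induction with
    | one => intro _; exact one_mem _
    | mul σ i hi ih =>
      intro h
      have hb : block J i.castSucc = block J i.succ := by
        refine le_antisymm (block_mono J Fin.castSucc_lt_succ.le) ?_
        have h1 := h i.castSucc
        have h2 := h i.succ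
        rw [Equiv.Perm.mul_apply, simplePerm_castSucc] at h1
        rw [Equiv.Perm.mul_apply, simplePerm_succ] at h2
        rw [← h1, ← h2]
        exact block_mono J hi.le
      have hs := simplePerm_mem_parabolic (block_simple_iff.1 hb)
      refine mul_mem (ih fun x => ?_) hs
      have := h (simplePerm i x)
      rw [Equiv.Perm.mul_apply, simplePerm_simplePerm] at this
      rw [this]
      by_cases h1 : x = i.castSucc
      · rw [h1, simplePerm_castSucc, hb]
      by_cases h2 : x = i.succ
      · rw [h2, simplePerm_succ, hb]
      rw [simplePerm_of_ne i h1 h2]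

theorem mem_of_descent {J : Finset (Fin m)} {σ : Equiv.Perm (Fin (m + 1))}
    (h : σ ∈ parabolic J) {i : Fin m} (hi : σ i.succ < σ i.castSucc) : i ∈ J := by
  rw [mem_parabolic] at h
  refine block_simple_iff.1 (le_antisymm (block_mono J Fin.castSucc_lt_succ.le) ?_)
  rw [← h i.castSucc, ← h i.succ]
  exact block_mono J hi.le

theorem mem_parabolicFinset {J : Finset (Fin m)} {σ : Equiv.Perm (Fin (m + 1))} :
    σ ∈ parabolicFinset J ↔ σ ∈ parabolic J := by
  simp [parabolicFinset]

theorem parabolic_mono {J K : Finset (Fin m)} (h : J ⊆ K) : parabolic J ≤ parabolic K :=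
  Subgroup.closure_mono (Set.image_mono (Finset.coe_subset.2 h))

theorem parabolic_univ : parabolic (Finset.univ : Finset (Fin m)) = ⊤ := by
  rw [eq_top_iff]
  intro σ _
  rw [mem_parabolic]
  intro x
  simp [block]

theorem parabolic_induction {J : Finset (Fin m)} {motive : Equiv.Perm (Fin (m + 1)) → Prop}
    (one : motive 1)
    (mul : ∀ σ, σ ∈ parabolic J → ∀ i ∈ J, σ i.castSucc < σ i.succ → motive σ →
      motive (σ * simplePerm i))
    (σ : Equiv.Perm (Fin (m + 1))) (h : σ ∈ parabolic J) : motive σ := by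
  induction σ using perm_induction with
  | one => exact one
  | mul σ i hi ih =>
    have hJ : i ∈ J := mem_of_descent h (by simpa [simplePerm_castSucc, simplePerm_succ] using hi)
    have : σ ∈ parabolic J := by
      have := mul_mem h (simplePerm_mem_parabolic hJ)
      rwa [mul_simplePerm_cancel] at this
    exact mul σ this i hJ hi (ih this)

theorem IncOn.lt {J : Finset (Fin m)} {σ : Equiv.Perm (Fin (m + 1))} (h : IncOn J σ)
    {a b : Fin (m + 1)} (hab : a < b) (hJ : block J a = block J b) : σ a < σ b := by
  rw [block_eq_iff hab.le] at hJ
  induction b using Fin.induction with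
  | zero => exact absurd hab (Fin.not_lt_zero a)
  | succ i ih =>
    have hle : a ≤ i.castSucc := Fin.le_castSucc_iff.2 hab
    have hi := h i (hJ i hle Fin.castSucc_lt_succ)
    rcases hle.lt_or_eq with h1 | h1
    · exact (ih h1 fun j hj h2 => hJ j hj (h2.trans Fin.castSucc_lt_succ)).trans hi
    · rwa [h1]

theorem IncOn.lt_iff {J : Finset (Fin m)} {σ : Equiv.Perm (Fin (m + 1))} (h : IncOn J σ)
    {a b : Fin (m + 1)} (hJ : block J a = block J b) : σ a < σ b ↔ a < b := by
  refine ⟨fun h1 => ?_, fun h1 => h.lt h1 hJ⟩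
  rcases lt_trichotomy a b with h2 | h2 | h2
  · exact h2
  · rw [h2] at h1; exact absurd h1 (lt_irrefl _)
  · exact absurd (h.lt h2 hJ.symm) (not_lt.2 h1.le)

theorem IncOn.mul_lt_iff {J : Finset (Fin m)} {d w : Equiv.Perm (Fin (m + 1))} (h : IncOn J d)
    (hw : w ∈ parabolic J) {a b : Fin (m + 1)} (hJ : block J a = block J b) :
    (d * w) a < (d * w) b ↔ w a < w b := by
  rw [mem_parabolic] at hw
  exact h.lt_iff (by rw [hw, hw, hJ])

/-- An element `d` increasing on blocks does not change order comparisons within a block, so each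
ascent of `w ∈ W_J` stays an ascent of `d w`. -/
theorem IncOn.invCount_mul {J : Finset (Fin m)} {d w : Equiv.Perm (Fin (m + 1))} (h : IncOn J d)
    (hw : w ∈ parabolic J) : invCount (d * w) = invCount d + invCount w := by
  refine parabolic_induction (motive := fun w => invCount (d * w) = invCount d + invCount w)
    (by simp) (fun w hw i hi hlt ih => ?_) w hw
  rw [← mul_assoc, invCount_mul_of_lt ((h.mul_lt_iff hw (block_simple_iff.2 hi)).2 hlt),
    invCount_mul_of_lt hlt, ih, add_assoc]

theorem invCount_mul_of_incOn_inv {J : Finset (Fin m)} {d w : Equiv.Perm (Fin (m + 1))}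
    (h : IncOn J d⁻¹) (hw : w ∈ parabolic J) : invCount (w * d) = invCount w + invCount d := by
  rw [← invCount_inv, mul_inv_rev, h.invCount_mul (inv_mem hw), invCount_inv, invCount_inv,
    add_comm]

theorem exists_incOn_mul (J : Finset (Fin m)) (u : Equiv.Perm (Fin (m + 1))) :
    ∃ d w, IncOn J d ∧ w ∈ parabolic J ∧ u = d * w := by
  induction h : invCount u using Nat.strong_induction_on generalizing u with
  | _ l ih =>
    by_cases h1 : IncOn J u
    · exact ⟨u, 1, h1, one_mem _, (mul_one u).symm⟩
    · simp only [IncOn, not_forall, not_lt] at h1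
      obtain ⟨i, hi, h2⟩ := h1
      have h3 := (lt_or_gt_simple u i).resolve_left (not_lt.2 h2)
      have h4 := invCount_mul_of_gt h3
      obtain ⟨d, w, hd, hw, hu⟩ := ih _ (by omega) (u * simplePerm i) rfl
      refine ⟨d, w * simplePerm i, hd, mul_mem hw (simplePerm_mem_parabolic hi), ?_⟩
      rw [← mul_assoc, ← hu, mul_simplePerm_cancel]

theorem eq_one_of_incOn {J : Finset (Fin m)} {w : Equiv.Perm (Fin (m + 1))} (h : IncOn J w)
    (hw : w ∈ parabolic J) : w = 1 := by
  by_contra h1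
  obtain ⟨i, hi⟩ := exists_descent h1
  exact lt_asymm hi (h i (mem_of_descent hw hi))

theorem IncOn.eq_one_of_mul {J : Finset (Fin m)} {d w : Equiv.Perm (Fin (m + 1))}
    (h : IncOn J d) (hw : w ∈ parabolic J) (h' : IncOn J (d * w)) : w = 1 :=
  eq_one_of_incOn (fun i hi => (h.mul_lt_iff hw (block_simple_iff.2 hi)).1 (h' i hi)) hw

theorem incOn_mul_unique {J : Finset (Fin m)} {d w d' w' : Equiv.Perm (Fin (m + 1))}
    (h : IncOn J d) (hw : w ∈ parabolic J) (h' : IncOn J d') (hw' : w' ∈ parabolic J)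
    (he : d * w = d' * w') : d = d' ∧ w = w' := by
  have h1 : d' = d * (w * w'⁻¹) := by rw [← mul_assoc, he, mul_inv_cancel_right]
  have h2 : w * w'⁻¹ = 1 := h.eq_one_of_mul (mul_mem hw (inv_mem hw')) (h1 ▸ h')
  rw [h2, mul_one] at h1
  exact ⟨h1.symm, mul_inv_eq_one.1 h2⟩

/-- The image of the `J`-minimal permutation `d` under a simple reflection is either `J`-minimal
again, or the reflection passes through `d`. -/
theorem incOn_simple_mul_or {J : Finset (Fin m)} {d : Equiv.Perm (Fin (m + 1))} (h : IncOn J d)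
    (i : Fin m) : IncOn J (simplePerm i * d) ∨
      ∃ j ∈ J, d j.castSucc = i.castSucc ∧ d j.succ = i.succ := by
  by_cases hc : ∃ j ∈ J, d j.castSucc = i.castSucc ∧ d j.succ = i.succ
  · exact Or.inr hc
  · refine Or.inl fun j hj => simplePerm_lt i (h j hj) fun h1 => hc ⟨j, hj, h1⟩

theorem simple_mul_eq {d : Equiv.Perm (Fin (m + 1))} {i j : Fin m}
    (h₁ : d j.castSucc = i.castSucc) (h₂ : d j.succ = i.succ) :
    simplePerm i * d = d * simplePerm j := by
  rw [simplePerm, simplePerm, ← h₁, ← h₂, Equiv.mul_swap_eq_swap_mul]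

end Combinatorics

/-! ### Demazure–Lusztig operators satisfy the Hecke relations. -/

section DemazureLusztig

variable {K : Type*} [Field K]

/-- The Demazure–Lusztig operator attached to an automorphism `s` exchanging `x` and `y`. -/
def demLus (q x y : K) (s : K ≃+* K) (f : K) : K := q * s f + (q - 1) * y / (y - x) * (f - s f)

variable {q x y z : K} {s t : K ≃+* K}

theorem demLus_quadratic (hxy : x ≠ y) (hq : s q = q) (hx : s x = y) (hy : s y = x)
    (hs : ∀ f, s (s f) = f) (f : K) :
    demLus q x y s (demLus q x y s f) = (q - 1) * demLus q x y s f + q * f := by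
  have h1 : y - x ≠ 0 := sub_ne_zero.2 hxy.symm
  have h2 : x - y ≠ 0 := sub_ne_zero.2 hxy
  simp only [demLus, map_add, map_mul, map_sub, map_div₀, hq, hx, hy, hs, map_one]
  have h3 : x / (x - y) = - x / (y - x) := by rw [← neg_sub y x, div_neg, neg_div]
  rw [mul_div_assoc _ x, h3]
  field_simp
  ring

theorem demLus_mul_fixed (c : K) (hc : s c = c) (f : K) :
    demLus q x y s (c * f) = c * demLus q x y s f := by
  simp only [demLus, map_mul, hc]
  ring

theorem demLus_bernstein (hxy : x ≠ y) (hq : s q = q) (hx : s x = y) (hy : s y = x)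
    (hs : ∀ f, s (s f) = f) (f : K) :
    demLus q x y s (x * demLus q x y s f) = q * (y * f) := by
  have h1 : y - x ≠ 0 := sub_ne_zero.2 hxy.symm
  have h2 : x - y ≠ 0 := sub_ne_zero.2 hxy
  simp only [demLus, map_add, map_mul, map_sub, map_div₀, hq, hx, hy, hs, map_one]
  have h3 : x / (x - y) = - x / (y - x) := by rw [← neg_sub y x, div_neg, neg_div]
  rw [mul_div_assoc _ x (x - y), h3]
  field_simp
  ring

/-- After pushing the automorphisms inwards, both sides are combinations of the six images of `f`
under the group generated by `s` and `t`. The rewriting of `x / (x - y)` aligns the denominators, so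
that a rational identity remains. -/
theorem demLus_braid (hxy : x ≠ y) (hyz : y ≠ z) (hxz : x ≠ z) (hqs : s q = q) (hqt : t q = q)
    (hsx : s x = y) (hsy : s y = x) (hsz : s z = z) (htx : t x = x) (hty : t y = z) (htz : t z = y)
    (hs : ∀ f, s (s f) = f) (ht : ∀ f, t (t f) = f) (hst : ∀ f, s (t (s f)) = t (s (t f))) (f : K) :
    demLus q x y s (demLus q y z t (demLus q x y s f)) =
      demLus q y z t (demLus q x y s (demLus q y z t f)) := by
  have h1 : y - x ≠ 0 := sub_ne_zero.2 hxy.symm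
  have h3 : z - y ≠ 0 := sub_ne_zero.2 hyz.symm
  have h5 : z - x ≠ 0 := sub_ne_zero.2 hxz.symm
  have h6 : x / (x - y) = - x / (y - x) := by rw [← neg_sub y x, div_neg, neg_div]
  have h7 : y / (y - z) = - y / (z - y) := by rw [← neg_sub z y, div_neg, neg_div]
  simp only [demLus, map_add, map_mul, map_sub, map_div₀, hqs, hqt, hsx, hsy, hsz, htx, hty, htz, hs,
    ht, hst, map_one]
  simp only [mul_div_assoc, h6, h7]
  generalize s f = f1
  generalize t f = f2
  generalize t (s f) = f3
  generalize s (t f) = f4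
  field_simp
  ring

theorem demLus_far {x' y' : K} (hqs : s q = q) (hqt : t q = q)
    (hsx : s x' = x') (hsy : s y' = y') (htx : t x = x) (hty : t y = y)
    (hst : ∀ f, s (t f) = t (s f)) (f : K) :
    demLus q x y s (demLus q x' y' t f) = demLus q x' y' t (demLus q x y s f) := by
  simp only [demLus, map_add, map_mul, map_sub, map_div₀, hqs, hqt, hsx, hsy, htx, hty, hst, map_one]
  ring

end DemazureLusztig

/-! ### Laurent polynomials and rational functions with the action of permutations. -/

section LaurentPolynomials

variable (k : Type*) [Field k] (m : ℕ)

/-- Laurent polynomials in `X_1, …, X_n`. -/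
abbrev Laurent : Type _ := AddMonoidAlgebra k (Fin (m + 1) → ℤ)

/-- Rational functions in `X_1, …, X_n`. -/
abbrev RatFun : Type _ := FractionRing (Laurent k m)

variable {m}

/-- The action of a permutation on exponent vectors. -/
def permExp (σ : Equiv.Perm (Fin (m + 1))) : (Fin (m + 1) → ℤ) ≃+ (Fin (m + 1) → ℤ) where
  toFun a i := a (σ⁻¹ i)
  invFun a i := a (σ i)
  left_inv a := by funext i; simp
  right_inv a := by funext i; simp
  map_add' a b := rfl

theorem permExp_apply (σ : Equiv.Perm (Fin (m + 1))) (a : Fin (m + 1) → ℤ) (i : Fin (m + 1)) :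
    permExp σ a i = a (σ⁻¹ i) := rfl

theorem permExp_mul (σ τ : Equiv.Perm (Fin (m + 1))) (a : Fin (m + 1) → ℤ) :
    permExp (σ * τ) a = permExp σ (permExp τ a) := rfl

@[simp]
theorem permExp_one (a : Fin (m + 1) → ℤ) : permExp 1 a = a := rfl

theorem permExp_single (σ : Equiv.Perm (Fin (m + 1))) (i : Fin (m + 1)) (c : ℤ) :
    permExp σ (Pi.single i c) = Pi.single (σ i) c := by
  funext j
  rw [permExp_apply, Pi.single_apply, Pi.single_apply]
  congr 1
  rw [eq_iff_iff, Equiv.Perm.inv_eq_iff_eq, eq_comm (a := j), eq_comm]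

/-- The action of a permutation on Laurent polynomials. -/
def permLaurent (σ : Equiv.Perm (Fin (m + 1))) : Laurent k m ≃ₐ[k] Laurent k m :=
  AddMonoidAlgebra.domCongr k k (permExp σ)

variable {k}

/-- The Laurent monomial with exponent vector `a`. -/
def mono (a : Fin (m + 1) → ℤ) : Laurent k m := AddMonoidAlgebra.single a 1

variable (k) in
/-- The variable `X_i` as a Laurent polynomial. -/
def var (i : Fin (m + 1)) : Laurent k m := mono (Pi.single i 1)

theorem permLaurent_single (σ : Equiv.Perm (Fin (m + 1))) (a : Fin (m + 1) → ℤ) (c : k) :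
    permLaurent k σ (AddMonoidAlgebra.single a c) = AddMonoidAlgebra.single (permExp σ a) c :=
  AddMonoidAlgebra.domCongr_single _ _ _

theorem permLaurent_mono (σ : Equiv.Perm (Fin (m + 1))) (a : Fin (m + 1) → ℤ) :
    permLaurent k σ (mono a) = mono (permExp σ a) :=
  permLaurent_single _ _ _

theorem permLaurent_var (σ : Equiv.Perm (Fin (m + 1))) (i : Fin (m + 1)) :
    permLaurent k σ (var k i) = var k (σ i) := by
  rw [var, permLaurent_mono, permExp_single]; rfl

theorem mono_add (a b : Fin (m + 1) → ℤ) : (mono (a + b) : Laurent k m) = mono a * mono b := by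
  rw [mono, mono, mono, AddMonoidAlgebra.single_mul_single, one_mul]

@[simp]
theorem mono_zero : (mono 0 : Laurent k m) = 1 := rfl

theorem mono_ne_zero (a : Fin (m + 1) → ℤ) : (mono a : Laurent k m) ≠ 0 := by
  intro h
  have := congrArg (fun f : Laurent k m => f.coeff a) h
  simp [mono] at this

theorem laurent_induction {motive : Laurent k m → Prop} (add : ∀ f g, motive f → motive g →
    motive (f + g)) (smul : ∀ (c : k) f, motive f → motive (c • f)) (mono : ∀ a, motive (mono a))
    (f : Laurent k m) : motive f := by
  refine AddMonoidAlgebra.induction_on (motive := motive) f (fun a => mono _) (fun f g => add f g)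
    (fun c f => smul c f)

variable (k) in
theorem permLaurent_mul (σ τ : Equiv.Perm (Fin (m + 1))) (f : Laurent k m) :
    permLaurent k (σ * τ) f = permLaurent k σ (permLaurent k τ f) := by
  induction f using laurent_induction with
  | add f g hf hg => simp only [map_add, hf, hg]
  | smul c f hf => simp only [map_smul, hf]
  | mono a => simp only [permLaurent_mono, permExp_mul]

variable (k) in
@[simp]
theorem permLaurent_one (f : Laurent k m) : permLaurent k 1 f = f := by
  induction f using laurent_induction with
  | add f g hf hg => simp only [map_add, hf, hg]
  | smul c f hf => simp only [map_smul, hf]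
  | mono a => simp only [permLaurent_mono, permExp_one]

variable (k) in
/-- The action of a permutation on rational functions. -/
def permRat (σ : Equiv.Perm (Fin (m + 1))) : RatFun k m ≃+* RatFun k m :=
  IsFractionRing.ringEquivOfRingEquiv (permLaurent k σ).toRingEquiv

theorem permRat_algebraMap (σ : Equiv.Perm (Fin (m + 1))) (f : Laurent k m) :
    permRat k σ (algebraMap _ _ f) = algebraMap _ _ (permLaurent k σ f) :=
  IsFractionRing.ringEquivOfRingEquiv_algebraMap _ _

variable (k) in
theorem permRat_mul (σ τ : Equiv.Perm (Fin (m + 1))) (f : RatFun k m) :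
    permRat k (σ * τ) f = permRat k σ (permRat k τ f) := by
  obtain ⟨a, b, rfl⟩ := IsFractionRing.div_surjective (A := Laurent k m) f |>.imp fun a h =>
    h.imp fun b h => h.2.symm
  simp only [map_div₀, permRat_algebraMap, permLaurent_mul]

variable (k) in
@[simp]
theorem permRat_one (f : RatFun k m) : permRat k 1 f = f := by
  obtain ⟨a, b, rfl⟩ := IsFractionRing.div_surjective (A := Laurent k m) f |>.imp fun a h =>
    h.imp fun b h => h.2.symm
  simp only [map_div₀, permRat_algebraMap, permLaurent_one]

variable (k) in
/-- The constants in the rational functions. -/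
def cst (c : k) : RatFun k m := algebraMap (Laurent k m) _ (algebraMap k _ c)

theorem smul_eq_cst_mul (c : k) (f : RatFun k m) : c • f = cst k c * f := by
  rw [cst, ← IsScalarTower.algebraMap_apply, Algebra.smul_def]

theorem permRat_cst (σ : Equiv.Perm (Fin (m + 1))) (c : k) :
    permRat k σ (cst k c : RatFun k m) = cst k c := by
  rw [cst, permRat_algebraMap, AlgEquiv.commutes]

variable (k) in
/-- The variable `X_i` as a rational function. -/
def varRat (i : Fin (m + 1)) : RatFun k m := algebraMap (Laurent k m) _ (var k i)

theorem permRat_varRat (σ : Equiv.Perm (Fin (m + 1))) (i : Fin (m + 1)) :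
    permRat k σ (varRat k i) = varRat k (σ i) := by
  rw [varRat, permRat_algebraMap, permLaurent_var]; rfl

theorem algebraMap_laurent_injective :
    Function.Injective (algebraMap (Laurent k m) (RatFun k m)) :=
  IsFractionRing.injective _ _

theorem mono_injective : Function.Injective (mono : _ → Laurent k m) := by
  intro a b h
  have h1 : (mono a : Laurent k m).coeff a = (mono b : Laurent k m).coeff a := by rw [h]
  by_contra hab
  simp [mono, Ne.symm hab] at h1

theorem var_injective : Function.Injective (var k : Fin (m + 1) → Laurent k m) := by
  intro i j h
  have := congrFun (mono_injective h) i
  by_contra hij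
  simp [hij] at this

theorem varRat_injective : Function.Injective (varRat k : Fin (m + 1) → RatFun k m) :=
  algebraMap_laurent_injective.comp var_injective

end LaurentPolynomials

/-- A `k`-algebra with generators satisfying the defining relations of the affine Hecke algebra,
together with its action on rational functions by Demazure–Lusztig operators. -/
structure HeckeModel {k : Type*} [Field k] (q : k) (m : ℕ) (A : Type*) [Ring A] [Algebra k A] where
  /-- The generators `T_i`. -/
  T : Fin m → A
  /-- The generators `X_i`. -/
  X : Fin (m + 1) → Aˣ
  T_mul_self : ∀ i, T i * T i = (q - 1) • T i + q • (1 : A)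
  T_far : ∀ i j : Fin m, (i : ℕ) + 1 < j → T i * T j = T j * T i
  T_braid : ∀ i j : Fin m, (i : ℕ) + 1 = j → T i * T j * T i = T j * T i * T j
  X_comm : ∀ i j, Commute (X i) (X j)
  T_X : ∀ (i : Fin m) (j : Fin (m + 1)), j ≠ i.castSucc → j ≠ i.succ →
    T i * (X j : A) = X j * T i
  T_X_T : ∀ i : Fin m, T i * (X i.castSucc : A) * T i = q • (X i.succ : A)
  adjoin_eq_top : Algebra.adjoin k
    (Set.range T ∪ Set.range (fun i => (X i : A)) ∪ Set.range (fun i => ((X i)⁻¹ : Aˣ).val)) = ⊤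
  /-- The action on rational functions. -/
  rep : A →ₐ[k] Module.End k (RatFun k m)
  rep_T : ∀ i f, rep (T i) f =
    demLus (cst k q) (varRat k i.castSucc) (varRat k i.succ) (permRat k (simplePerm i)) f
  rep_X : ∀ i f, rep (X i) f = varRat k i * f

/-! ### The finite Hecke algebra: the elements `T_σ` and `v_J`. -/

section Permutations

variable {m : ℕ}

theorem simplePerm_far {i j : Fin m} (h : (i : ℕ) + 1 < j) :
    simplePerm i * simplePerm j = simplePerm j * simplePerm i := by
  refine Equiv.ext fun x => Fin.ext ?_
  simp only [Equiv.Perm.mul_apply, simplePerm_val]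
  split_ifs <;> omega

theorem simplePerm_braid {i j : Fin m} (h : (i : ℕ) + 1 = j) :
    simplePerm i * simplePerm j * simplePerm i = simplePerm j * simplePerm i * simplePerm j := by
  have ne : ∀ a b : Fin (m + 1), (a : ℕ) ≠ b → a ≠ b := fun a b h h' => h (by rw [h'])
  have e : i.succ = j.castSucc := Fin.ext (by simpa using h)
  have h1 : i.castSucc ≠ j.castSucc := ne _ _ (by simp only [Fin.val_castSucc]; omega)
  have h2 : i.castSucc ≠ j.succ := ne _ _ (by simp only [Fin.val_castSucc, Fin.val_succ]; omega)
  have h3 : j.castSucc ≠ j.succ := Fin.castSucc_lt_succ.ne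
  rw [simplePerm, simplePerm, e, Equiv.swap_mul_swap_mul_swap h1 h2, Equiv.swap_comm j.castSucc,
    Equiv.swap_comm i.castSucc, Equiv.swap_mul_swap_mul_swap h3.symm h2.symm, Equiv.swap_comm]

theorem invCount_mul_le (u w : Equiv.Perm (Fin (m + 1))) :
    invCount (u * w) ≤ invCount u + invCount w := by
  induction w using perm_induction with
  | one => simp
  | mul w i hi ih =>
    have := invCount_mul_simple_le (u * w) i
    rw [← mul_assoc, invCount_mul_of_lt hi]; omega

theorem invCount_simple (i : Fin m) : invCount (simplePerm i) = 1 := by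
  have h1 := invCount_mul_of_lt (σ := 1) (i := i) Fin.castSucc_lt_succ
  rwa [one_mul, invCount_one] at h1

end Permutations

namespace HeckeModel

variable {k : Type*} [Field k] {q : k} {m : ℕ} {A : Type*} [Ring A] [Algebra k A]
  (H : HeckeModel q m A)

/-- `T_i⁻¹`. -/
def Tinv (i : Fin m) : A := q⁻¹ • H.T i + algebraMap k A (q⁻¹ - 1)

theorem Tinv_mul (hq : q ≠ 0) (i : Fin m) : H.Tinv i * H.T i = 1 := by
  rw [Tinv, add_mul, smul_mul_assoc, H.T_mul_self, Algebra.algebraMap_eq_smul_one, smul_mul_assoc,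
    one_mul, smul_add, smul_smul, smul_smul, inv_mul_cancel₀ hq, add_right_comm, ← add_smul,
    mul_sub, inv_mul_cancel₀ hq]
  simp

theorem T_mul_Tinv (hq : q ≠ 0) (i : Fin m) : H.T i * H.Tinv i = 1 := by
  rw [Tinv, mul_add, mul_smul_comm, H.T_mul_self, Algebra.algebraMap_eq_smul_one, mul_smul_comm,
    mul_one, smul_add, smul_smul, smul_smul, inv_mul_cancel₀ hq, add_right_comm, ← add_smul,
    mul_sub, inv_mul_cancel₀ hq]
  simp

open scoped Classical in
/-- The basis element `T_σ` of the finite Hecke algebra. -/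
def TT (σ : Equiv.Perm (Fin (m + 1))) : A :=
  if h : σ = 1 then 1 else TT (σ * simplePerm (exists_descent h).choose) *
    H.T (exists_descent h).choose
termination_by invCount σ
decreasing_by
  have := invCount_mul_of_gt (exists_descent h).choose_spec
  omega

@[simp]
theorem TT_one : H.TT 1 = 1 := by
  rw [TT, dif_pos rfl]

theorem TT_far_aux {σ : Equiv.Perm (Fin (m + 1))} {i j : Fin m} (hij : (i : ℕ) + 1 < j)
    (hi : σ i.succ < σ i.castSucc) (hj : σ j.succ < σ j.castSucc)
    (ih : ∀ τ : Equiv.Perm (Fin (m + 1)), invCount τ < invCount σ → ∀ i : Fin m,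
      τ i.succ < τ i.castSucc → H.TT τ = H.TT (τ * simplePerm i) * H.T i) :
    H.TT (σ * simplePerm i) * H.T i = H.TT (σ * simplePerm j) * H.T j := by
  have h1 := invCount_mul_of_gt hi
  have h2 := invCount_mul_of_gt hj
  have ne : ∀ a b : Fin (m + 1), (a : ℕ) ≠ b → a ≠ b := fun a b h h' => h (by rw [h'])
  rw [ih (σ * simplePerm i) (by omega) j, ih (σ * simplePerm j) (by omega) i, mul_assoc σ,
    simplePerm_far hij, mul_assoc, ← H.T_far i j hij, mul_assoc, mul_assoc σ]
  · rw [Equiv.Perm.mul_apply, Equiv.Perm.mul_apply, simplePerm_of_ne, simplePerm_of_ne]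
    · exact hi
    all_goals apply ne; simp only [Fin.val_castSucc, Fin.val_succ]; omega
  · rw [Equiv.Perm.mul_apply, Equiv.Perm.mul_apply, simplePerm_of_ne, simplePerm_of_ne]
    · exact hj
    all_goals apply ne; simp only [Fin.val_castSucc, Fin.val_succ]; omega

theorem TT_braid_aux {σ : Equiv.Perm (Fin (m + 1))} {i j : Fin m} (hij : (i : ℕ) + 1 = j)
    (hi : σ i.succ < σ i.castSucc) (hj : σ j.succ < σ j.castSucc)
    (ih : ∀ τ : Equiv.Perm (Fin (m + 1)), invCount τ < invCount σ → ∀ i : Fin m,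
      τ i.succ < τ i.castSucc → H.TT τ = H.TT (τ * simplePerm i) * H.T i) :
    H.TT (σ * simplePerm i) * H.T i = H.TT (σ * simplePerm j) * H.T j := by
  have h1 := invCount_mul_of_gt hi
  have h2 := invCount_mul_of_gt hj
  have e : i.succ = j.castSucc := Fin.ext (by simpa using hij)
  have ne : ∀ a b : Fin (m + 1), (a : ℕ) ≠ b → a ≠ b := fun a b h h' => h (by rw [h'])
  have e1 : simplePerm i j.succ = j.succ := by
    apply simplePerm_of_ne <;> apply ne <;> simp only [Fin.val_castSucc, Fin.val_succ] <;> omega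
  have e2 : simplePerm j i.castSucc = i.castSucc := by
    apply simplePerm_of_ne <;> apply ne <;> simp only [Fin.val_castSucc, Fin.val_succ] <;> omega
  have e3 : simplePerm i j.castSucc = i.castSucc := by rw [← e, simplePerm_succ]
  have e4 : simplePerm j i.succ = j.succ := by rw [e, simplePerm_castSucc]
  have hij' : σ j.succ < σ i.castSucc := by rw [← e] at hj; exact hj.trans hi
  have d1 : (σ * simplePerm i) j.succ < (σ * simplePerm i) j.castSucc := by
    simpa only [Equiv.Perm.mul_apply, e1, e3] using hij'
  have d2 : (σ * simplePerm j) i.succ < (σ * simplePerm j) i.castSucc := by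
    simpa only [Equiv.Perm.mul_apply, e2, e4] using hij'
  have d3 : (σ * simplePerm i * simplePerm j) i.succ <
      (σ * simplePerm i * simplePerm j) i.castSucc := by
    simpa only [Equiv.Perm.mul_apply, e2, e4, e1, simplePerm_castSucc, e] using hj
  have d4 : (σ * simplePerm j * simplePerm i) j.succ <
      (σ * simplePerm j * simplePerm i) j.castSucc := by
    simpa only [Equiv.Perm.mul_apply, e3, e1, e2, simplePerm_succ, ← e] using hi
  have h3 := invCount_mul_of_gt d1
  have h4 := invCount_mul_of_gt d2
  have h5 : σ * simplePerm i * simplePerm j * simplePerm i =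
      σ * simplePerm j * simplePerm i * simplePerm j := by
    rw [mul_assoc, mul_assoc, ← mul_assoc (simplePerm i), simplePerm_braid hij, mul_assoc,
      mul_assoc, mul_assoc]
  rw [ih (σ * simplePerm i) (by omega) j d1, ih (σ * simplePerm j) (by omega) i d2,
    ih (σ * simplePerm i * simplePerm j) (by omega) i d3,
    ih (σ * simplePerm j * simplePerm i) (by omega) j d4, h5]
  have := H.T_braid i j hij
  simp only [mul_assoc] at this ⊢
  rw [this]

/-- `TT` is defined through one chosen descent; any other gives the same element. For two distinct
descents `i` and `j`, the induction hypothesis lets both expressions be carried down to a common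
shorter permutation, where the commutation or braid relation identifies them. -/
theorem TT_of_descent {σ : Equiv.Perm (Fin (m + 1))} {i : Fin m}
    (hi : σ i.succ < σ i.castSucc) : H.TT σ = H.TT (σ * simplePerm i) * H.T i := by
  induction h : invCount σ using Nat.strong_induction_on generalizing σ i with
  | _ l ih =>
    have ih' : ∀ τ : Equiv.Perm (Fin (m + 1)), invCount τ < invCount σ → ∀ i : Fin m,
      τ i.succ < τ i.castSucc → H.TT τ = H.TT (τ * simplePerm i) * H.T i :=
      fun τ hτ i hi => ih _ (h ▸ hτ) hi rfl
    have h1 : σ ≠ 1 := by rintro rfl; exact lt_asymm hi Fin.castSucc_lt_succ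
    rw [TT, dif_neg h1]
    have hj := (exists_descent h1).choose_spec
    generalize (exists_descent h1).choose = j at hj
    rcases lt_trichotomy (i : ℕ) j with hlt | heq | hlt
    · rcases (Nat.succ_le_of_lt hlt).eq_or_lt with h2 | h2
      · exact (H.TT_braid_aux h2 hi hj ih').symm
      · exact (H.TT_far_aux h2 hi hj ih').symm
    · rw [Fin.ext heq]
    · rcases (Nat.succ_le_of_lt hlt).eq_or_lt with h2 | h2
      · exact H.TT_braid_aux h2 hj hi ih'
      · exact H.TT_far_aux h2 hj hi ih'

theorem TT_mul_simple {σ : Equiv.Perm (Fin (m + 1))} {i : Fin m}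
    (hi : σ i.castSucc < σ i.succ) : H.TT (σ * simplePerm i) = H.TT σ * H.T i := by
  rw [H.TT_of_descent (i := i), mul_simplePerm_cancel]
  simpa [simplePerm_castSucc, simplePerm_succ] using hi

@[simp]
theorem TT_simple (i : Fin m) : H.TT (simplePerm i) = H.T i := by
  have := H.TT_mul_simple (σ := 1) (i := i) Fin.castSucc_lt_succ
  rwa [one_mul, TT_one, one_mul] at this

theorem TT_mul {u w : Equiv.Perm (Fin (m + 1))}
    (h : invCount (u * w) = invCount u + invCount w) :
    H.TT (u * w) = H.TT u * H.TT w := by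
  induction w using perm_induction with
  | one => simp
  | mul w i hi ih =>
    have h1 := invCount_mul_of_lt hi
    have h2 := invCount_mul_simple_le (u * w) i
    have h3 := invCount_mul_le u w
    rw [← mul_assoc] at h ⊢
    have h4 : (u * w) i.castSucc < (u * w) i.succ := lt_iff_invCount_mul.2 (by omega)
    rw [H.TT_mul_simple h4, ih (by omega), H.TT_mul_simple hi, mul_assoc]

theorem TT_mul_T_of_gt {σ : Equiv.Perm (Fin (m + 1))} {i : Fin m}
    (hi : σ i.succ < σ i.castSucc) :
    H.TT σ * H.T i = (q - 1) • H.TT σ + q • H.TT (σ * simplePerm i) := by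
  rw [H.TT_of_descent hi, mul_assoc, H.T_mul_self, mul_add, mul_smul_comm, mul_smul_comm, mul_one]

theorem T_mul_TT {σ : Equiv.Perm (Fin (m + 1))} {i : Fin m}
    (hi : σ⁻¹ i.castSucc < σ⁻¹ i.succ) : H.T i * H.TT σ = H.TT (simplePerm i * σ) := by
  rw [TT_mul, TT_simple]
  rw [invCount_simple_mul_of_lt hi, invCount_simple, add_comm]

theorem T_mul_TT_of_gt {σ : Equiv.Perm (Fin (m + 1))} {i : Fin m}
    (hi : σ⁻¹ i.succ < σ⁻¹ i.castSucc) :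
    H.T i * H.TT σ = (q - 1) • H.TT σ + q • H.TT (simplePerm i * σ) := by
  have h : H.TT σ = H.T i * H.TT (simplePerm i * σ) := by
    rw [T_mul_TT, simplePerm_mul_cancel]
    simpa [mul_inv_rev, simplePerm_castSucc, simplePerm_succ] using hi
  rw [h, ← mul_assoc, H.T_mul_self, add_mul, smul_mul_assoc, smul_mul_assoc, one_mul]

theorem TT_mul_of_incOn {J : Finset (Fin m)} {d w : Equiv.Perm (Fin (m + 1))} (h : IncOn J d)
    (hw : w ∈ parabolic J) : H.TT (d * w) = H.TT d * H.TT w :=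
  H.TT_mul (h.invCount_mul hw)

theorem TT_mul_of_incOn_inv {J : Finset (Fin m)} {d w : Equiv.Perm (Fin (m + 1))}
    (h : IncOn J d⁻¹) (hw : w ∈ parabolic J) : H.TT (w * d) = H.TT w * H.TT d :=
  H.TT_mul (invCount_mul_of_incOn_inv h hw)

/-- The element `v_J`, the sum of the `T_σ` over the parabolic subgroup `W_J`. -/
def vee (J : Finset (Fin m)) : A := ∑ σ ∈ parabolicFinset J, H.TT σ

end HeckeModel

theorem sum_mul_simple_eq {m : ℕ} {J : Finset (Fin m)} {i : Fin m} (hi : i ∈ J) {M : Type*}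
    [AddCommMonoid M] (f : Equiv.Perm (Fin (m + 1)) → M) :
    ∑ σ ∈ parabolicFinset J, f (σ * simplePerm i) = ∑ σ ∈ parabolicFinset J, f σ := by
  have hs := simplePerm_mem_parabolic hi
  refine Finset.sum_bij' (fun σ _ => σ * simplePerm i) (fun σ _ => σ * simplePerm i) ?_ ?_ ?_ ?_ ?_
  · exact fun σ h => mem_parabolicFinset.2 (mul_mem (mem_parabolicFinset.1 h) hs)
  · exact fun σ h => mem_parabolicFinset.2 (mul_mem (mem_parabolicFinset.1 h) hs)
  · intros; simp
  · intros; simp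
  · intros; rfl

theorem sum_simple_mul_eq {m : ℕ} {J : Finset (Fin m)} {i : Fin m} (hi : i ∈ J) {M : Type*}
    [AddCommMonoid M] (f : Equiv.Perm (Fin (m + 1)) → M) :
    ∑ σ ∈ parabolicFinset J, f (simplePerm i * σ) = ∑ σ ∈ parabolicFinset J, f σ := by
  have hs := simplePerm_mem_parabolic hi
  refine Finset.sum_bij' (fun σ _ => simplePerm i * σ) (fun σ _ => simplePerm i * σ) ?_ ?_ ?_ ?_ ?_
  · exact fun σ h => mem_parabolicFinset.2 (mul_mem hs (mem_parabolicFinset.1 h))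
  · exact fun σ h => mem_parabolicFinset.2 (mul_mem hs (mem_parabolicFinset.1 h))
  · intros; simp
  · intros; simp
  · intros; rfl

namespace HeckeModel

variable {k : Type*} [Field k] {q : k} {m : ℕ} {A : Type*} [Ring A] [Algebra k A]
  (H : HeckeModel q m A)

open scoped Classical in
theorem vee_mul_T {J : Finset (Fin m)} {i : Fin m} (hi : i ∈ J) :
    H.vee J * H.T i = q • H.vee J := by
  have key : ∀ σ : Equiv.Perm (Fin (m + 1)), H.TT σ * H.T i =
      (if σ i.castSucc < σ i.succ then 0 else (q - 1) • H.TT σ) +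
        (if σ i.castSucc < σ i.succ then (1 : k) else q) • H.TT (σ * simplePerm i) := by
    intro σ
    rcases lt_or_gt_simple σ i with h | h
    · rw [if_pos h, if_pos h, H.TT_mul_simple h, zero_add, one_smul]
    · rw [if_neg h.not_gt, if_neg h.not_gt, H.TT_mul_T_of_gt h]
  -- Reindexing the second sum by `σ ↦ σ s_i` collects the coefficient of `T_σ`: it is `0 + q` if
  -- `i` is an ascent of `σ`, and `(q - 1) + 1` if it is a descent.
  rw [vee, Finset.sum_mul, Finset.sum_congr rfl fun σ _ => key σ, Finset.sum_add_distrib,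
    ← sum_mul_simple_eq hi (fun σ => (if σ i.castSucc < σ i.succ then (1 : k) else q) •
      H.TT (σ * simplePerm i)), ← Finset.sum_add_distrib, Finset.smul_sum]
  refine Finset.sum_congr rfl fun σ _ => ?_
  simp only [Equiv.Perm.mul_apply, simplePerm_castSucc, simplePerm_succ, mul_simplePerm_cancel]
  rcases lt_or_gt_simple σ i with h | h
  · rw [if_pos h, if_neg h.not_gt, zero_add]
  · rw [if_neg h.not_gt, if_pos h, ← add_smul, sub_add_cancel]

open scoped Classical in
theorem T_mul_vee {J : Finset (Fin m)} {i : Fin m} (hi : i ∈ J) :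
    H.T i * H.vee J = q • H.vee J := by
  have key : ∀ σ : Equiv.Perm (Fin (m + 1)), H.T i * H.TT σ =
      (if σ⁻¹ i.castSucc < σ⁻¹ i.succ then 0 else (q - 1) • H.TT σ) +
        (if σ⁻¹ i.castSucc < σ⁻¹ i.succ then (1 : k) else q) • H.TT (simplePerm i * σ) := by
    intro σ
    rcases lt_or_gt_simple σ⁻¹ i with h | h
    · rw [if_pos h, if_pos h, H.T_mul_TT h, zero_add, one_smul]
    · rw [if_neg h.not_gt, if_neg h.not_gt, H.T_mul_TT_of_gt h]
  rw [vee, Finset.mul_sum, Finset.sum_congr rfl fun σ _ => key σ, Finset.sum_add_distrib,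
    ← sum_simple_mul_eq hi (fun σ => (if σ⁻¹ i.castSucc < σ⁻¹ i.succ then (1 : k) else q) •
      H.TT (simplePerm i * σ)), ← Finset.sum_add_distrib, Finset.smul_sum]
  refine Finset.sum_congr rfl fun σ _ => ?_
  simp only [mul_inv_rev, simplePerm_inv, Equiv.Perm.mul_apply, simplePerm_castSucc,
    simplePerm_succ, simplePerm_mul_cancel]
  rcases lt_or_gt_simple σ⁻¹ i with h | h
  · rw [if_pos h, if_neg h.not_gt, zero_add]
  · rw [if_neg h.not_gt, if_pos h, ← add_smul, sub_add_cancel]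

end HeckeModel

theorem list_prod_mul_of_commute {G ι : Type*} [Group G] (f g : ι → G)
    (h : ∀ i j, Commute (g i) (f j)) (l : List ι) :
    (l.map fun i => f i * g i).prod = (l.map f).prod * (l.map g).prod := by
  induction l with
  | nil => simp
  | cons i l ih =>
    have hc : Commute (g i) (l.map f).prod :=
      Commute.list_prod_right _ _ fun x hx => by
        obtain ⟨j, _, rfl⟩ := List.mem_map.1 hx
        exact h i j
    rw [List.map_cons, List.prod_cons, List.map_cons, List.prod_cons, List.map_cons, List.prod_cons,
      ih, mul_assoc, ← mul_assoc (g i), hc.eq, mul_assoc, mul_assoc]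

theorem list_prod_map_single {G ι : Type*} [Group G] (f : ι → G) (i : ι) (l : List ι)
    (hl : l.Nodup) (hi : i ∈ l) (h : ∀ j, j ≠ i → f j = 1) : (l.map f).prod = f i := by
  obtain ⟨l₁, l₂, rfl⟩ := List.append_of_mem hi
  have h0 : ∀ l' : List ι, i ∉ l' → (l'.map f).prod = 1 := fun l' hl' =>
    List.prod_eq_one fun x hx => by
      obtain ⟨j, hj, rfl⟩ := List.mem_map.1 hx
      exact h j fun e => hl' (e ▸ hj)
  rw [List.nodup_append] at hl
  obtain ⟨_, h2, h3⟩ := hl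
  rw [List.map_append, List.prod_append, List.map_cons, List.prod_cons,
    h0 l₁ (fun hm => h3 i hm i (by simp) rfl), h0 l₂ (List.nodup_cons.1 h2).1, one_mul, mul_one]

/-! ### The Bernstein relation and normal forms in Levi subalgebras. -/

namespace HeckeModel

variable {k : Type*} [Field k] {q : k} {m : ℕ} {A : Type*} [Ring A] [Algebra k A]
  (H : HeckeModel q m A)

/-- The Laurent monomial with exponent vector `a` in the Hecke algebra. -/
def mon (a : Fin (m + 1) → ℤ) : Aˣ := (List.ofFn fun i => H.X i ^ a i).prod

theorem mon_add (a b : Fin (m + 1) → ℤ) : H.mon (a + b) = H.mon a * H.mon b := by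
  simp only [mon, List.ofFn_eq_map, Pi.add_apply, zpow_add]
  exact list_prod_mul_of_commute _ _ (fun i j => (H.X_comm i j).zpow_zpow _ _) _

theorem mon_single (i : Fin (m + 1)) (c : ℤ) : H.mon (Pi.single i c) = H.X i ^ c := by
  simp only [mon, List.ofFn_eq_map]
  rw [list_prod_map_single _ i _ (List.nodup_finRange _) (List.mem_finRange _), Pi.single_eq_same]
  intro j hj
  rw [Pi.single_eq_of_ne hj, zpow_zero]

theorem mon_zero : H.mon 0 = 1 := by
  simp [mon, List.ofFn_eq_map]

/-- The monomials as a group homomorphism. -/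
def monHom : Multiplicative (Fin (m + 1) → ℤ) →* A where
  toFun a := (H.mon a.toAdd : A)
  map_one' := by rw [toAdd_one, mon_zero, Units.val_one]
  map_mul' a b := by rw [toAdd_mul, mon_add, Units.val_mul]

/-- The inclusion of the Laurent polynomials in the Hecke algebra. -/
def lau : Laurent k m →ₐ[k] A := AddMonoidAlgebra.lift k A _ H.monHom

theorem lau_mono (a : Fin (m + 1) → ℤ) : H.lau (mono a) = H.mon a := by
  rw [lau, mono, AddMonoidAlgebra.lift_single, one_smul]; rfl

theorem lau_var (i : Fin (m + 1)) : H.lau (var k i) = H.X i := by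
  rw [var, lau_mono, mon_single, zpow_one]

theorem lau_var_inv (i : Fin (m + 1)) : H.lau (mono (Pi.single i (-1))) = (H.X i)⁻¹.val := by
  rw [lau_mono, mon_single, zpow_neg, zpow_one]

theorem laurent_adjoin_induction {motive : Laurent k m → Prop}
    (var : ∀ i, motive (var k i)) (inv : ∀ i, motive (mono (Pi.single i (-1))))
    (const : ∀ c, motive (algebraMap k _ c)) (add : ∀ f g, motive f → motive g → motive (f + g))
    (mul : ∀ f g, motive f → motive g → motive (f * g)) (f : Laurent k m) : motive f := by
  have one : motive 1 := by rw [← map_one (algebraMap k _)]; exact const 1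
  have hc : ∀ (c : ℤ) (i : Fin (m + 1)), motive (mono (Pi.single i c)) := by
    intro c i
    induction c with
    | zero => simpa using one
    | succ c ih =>
      have := mul _ _ ih (var i)
      rwa [AffineSchur.var, ← mono_add, ← Pi.single_add] at this
    | pred c ih =>
      have := mul _ _ ih (inv i)
      rwa [← mono_add, ← Pi.single_add] at this
  have hm : ∀ a : Fin (m + 1) → ℤ, motive (mono a) := by
    intro a
    rw [← Finset.univ_sum_single a]
    induction (Finset.univ : Finset (Fin (m + 1))) using Finset.induction_on with
    | empty => simpa using one
    | insert i s hi ih => rw [Finset.sum_insert hi, mono_add]; exact mul _ _ (hc _ _) ih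
  induction f using laurent_induction with
  | add f g hf hg => exact add f g hf hg
  | smul c f hf => rw [Algebra.smul_def]; exact mul _ _ (const c) hf
  | mono a => exact hm a

theorem T_mul_X (hq : q ≠ 0) (i : Fin m) : H.T i * (H.X i.castSucc : A) =
    H.X i.succ * H.T i + (q - 1) • -(H.X i.succ : A) := by
  calc H.T i * (H.X i.castSucc : A)
      = H.T i * H.X i.castSucc * H.T i * H.Tinv i := by rw [mul_assoc _ (H.T i), H.T_mul_Tinv hq,
        mul_one]
    _ = _ := by
      rw [H.T_X_T, Tinv, smul_mul_assoc, mul_add, mul_smul_comm, smul_add, smul_smul,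
        mul_inv_cancel₀ hq, one_smul, Algebra.algebraMap_eq_smul_one, mul_smul_comm, mul_one,
        smul_smul, mul_sub, mul_inv_cancel₀ hq, mul_one, smul_neg, ← neg_smul, neg_sub]

theorem T_mul_X_succ (hq : q ≠ 0) (i : Fin m) : H.T i * (H.X i.succ : A) =
    H.X i.castSucc * H.T i + (q - 1) • (H.X i.succ : A) := by
  have h : (H.X i.succ : A) = q⁻¹ • (H.T i * (H.X i.castSucc : A) * H.T i) := by
    rw [H.T_X_T, smul_smul, inv_mul_cancel₀ hq, one_smul]
  have h2 : H.T i * (H.T i * (H.X i.castSucc : A) * H.T i) =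
      (q - 1) • (H.T i * (H.X i.castSucc : A) * H.T i) + q • ((H.X i.castSucc : A) * H.T i) := by
    rw [← mul_assoc, ← mul_assoc, H.T_mul_self, add_mul, add_mul, smul_mul_assoc, smul_mul_assoc,
      smul_mul_assoc, smul_mul_assoc, one_mul]
  rw [h, mul_smul_comm, h2, smul_add, smul_smul, smul_smul, smul_smul, inv_mul_cancel₀ hq, one_smul,
    mul_comm, add_comm]

/-- `δ` is the correction term in the Bernstein relation between `T_i` and `f`. -/
def IsBernstein (i : Fin m) (f δ : Laurent k m) : Prop :=
  H.T i * H.lau f = H.lau (permLaurent k (simplePerm i) f) * H.T i + (q - 1) • H.lau δ ∧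
    (var k i.succ - var k i.castSucc) * δ = var k i.succ * (f - permLaurent k (simplePerm i) f)

variable {H} in
-- Multiply the relation for `f` by `s_i g` on the left and by `g` on the right. This extends the
-- Bernstein relation from the variables to their inverses.
theorem IsBernstein.inv {i : Fin m} {f δ g : Laurent k m} (h : H.IsBernstein i f δ)
    (hg : f * g = 1) : H.IsBernstein i g (-(permLaurent k (simplePerm i) g * δ * g)) := by
  obtain ⟨h1, h2⟩ := h
  have hs : permLaurent k (simplePerm i) f * permLaurent k (simplePerm i) g = 1 := by
    rw [← map_mul, hg, map_one]
  have hg' : H.lau f * H.lau g = 1 := by rw [← map_mul, hg, map_one]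
  have hs' : H.lau (permLaurent k (simplePerm i) g) * H.lau (permLaurent k (simplePerm i) f) = 1 := by
    rw [← map_mul, mul_comm, hs, map_one]
  constructor
  · have h3 : H.lau (permLaurent k (simplePerm i) g) * (H.T i * H.lau f) * H.lau g =
        H.lau (permLaurent k (simplePerm i) g) *
        (H.lau (permLaurent k (simplePerm i) f) * H.T i + (q - 1) • H.lau δ) * H.lau g := by rw [h1]
    rw [← mul_assoc, mul_assoc, hg', mul_one, mul_add, ← mul_assoc, hs', one_mul, add_mul,
      mul_smul_comm, smul_mul_assoc, ← map_mul, ← map_mul] at h3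
    rw [h3, map_neg, smul_neg, add_neg_cancel_right]
  · linear_combination (-(permLaurent k (simplePerm i) g) * g) * h2 +
      (-(var k i.succ) * permLaurent k (simplePerm i) g) * hg + var k i.succ * g * hs

variable {H} in
theorem IsBernstein.mul {i : Fin m} {f δ g ε : Laurent k m} (hf : H.IsBernstein i f δ)
    (hg : H.IsBernstein i g ε) :
    H.IsBernstein i (f * g) (permLaurent k (simplePerm i) f * ε + δ * g) := by
  obtain ⟨h1, h2⟩ := hf
  obtain ⟨h3, h4⟩ := hg
  constructor
  · rw [map_mul, ← mul_assoc, h1, add_mul, mul_assoc, h3, mul_add, map_mul, map_mul, ← mul_assoc,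
      map_add, smul_add, map_mul, map_mul, mul_smul_comm, smul_mul_assoc, add_assoc]
  · rw [map_mul]
    linear_combination permLaurent k (simplePerm i) f * h4 + g * h2

variable {H} in
theorem IsBernstein.add {i : Fin m} {f δ g ε : Laurent k m} (hf : H.IsBernstein i f δ)
    (hg : H.IsBernstein i g ε) : H.IsBernstein i (f + g) (δ + ε) := by
  obtain ⟨h1, h2⟩ := hf
  obtain ⟨h3, h4⟩ := hg
  constructor
  · rw [map_add, mul_add, h1, h3, map_add, map_add, add_mul, map_add, smul_add]
    abel
  · rw [map_add]
    linear_combination h2 + h4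

theorem isBernstein_const (i : Fin m) (c : k) : H.IsBernstein i (algebraMap k _ c) 0 := by
  constructor
  · rw [AlgEquiv.commutes, AlgHom.commutes, map_zero, smul_zero, add_zero,
      Algebra.commutes]
  · rw [AlgEquiv.commutes, sub_self, mul_zero, mul_zero]

theorem isBernstein_of_ne {i : Fin m} {j : Fin (m + 1)} (h₁ : j ≠ i.castSucc) (h₂ : j ≠ i.succ) :
    H.IsBernstein i (var k j) 0 := by
  constructor
  · rw [permLaurent_var, simplePerm_of_ne i h₁ h₂, lau_var, H.T_X i j h₁ h₂, map_zero, smul_zero,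
      add_zero]
  · rw [permLaurent_var, simplePerm_of_ne i h₁ h₂, sub_self, mul_zero, mul_zero]

theorem isBernstein_castSucc (hq : q ≠ 0) (i : Fin m) :
    H.IsBernstein i (var k i.castSucc) (-var k i.succ) := by
  constructor
  · rw [permLaurent_var, simplePerm_castSucc, lau_var, lau_var, map_neg, lau_var, H.T_mul_X hq]
  · rw [permLaurent_var, simplePerm_castSucc]; ring

theorem isBernstein_succ (hq : q ≠ 0) (i : Fin m) :
    H.IsBernstein i (var k i.succ) (var k i.succ) := by
  constructor
  · rw [permLaurent_var, simplePerm_succ, lau_var, lau_var, H.T_mul_X_succ hq]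
  · rw [permLaurent_var, simplePerm_succ]; ring

/-- The relation holds for the variables and is stable under sums, products and inverses. Recording
`δ` through its product with `X_{i+1} - X_i` avoids proving divisibility in the Laurent ring, and
still determines `δ` because that ring is a domain. -/
theorem exists_isBernstein (hq : q ≠ 0) (i : Fin m) (f : Laurent k m) :
    ∃ δ, H.IsBernstein i f δ := by
  have hv : ∀ j, ∃ δ, H.IsBernstein i (var k j) δ := by
    intro j
    by_cases h₁ : j = i.castSucc
    · exact ⟨_, h₁ ▸ H.isBernstein_castSucc hq i⟩
    by_cases h₂ : j = i.succ
    · exact ⟨_, h₂ ▸ H.isBernstein_succ hq i⟩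
    exact ⟨_, H.isBernstein_of_ne h₁ h₂⟩
  induction f using laurent_adjoin_induction with
  | var j => exact hv j
  | inv j =>
    obtain ⟨δ, hδ⟩ := hv j
    exact ⟨_, hδ.inv (by rw [var, ← mono_add, ← Pi.single_add]; simp)⟩
  | const c => exact ⟨_, H.isBernstein_const i c⟩
  | add f g hf hg => exact ⟨_, hf.choose_spec.add hg.choose_spec⟩
  | mul f g hf hg => exact ⟨_, hf.choose_spec.mul hg.choose_spec⟩

variable {H} in
theorem IsBernstein.of_fixed {i : Fin m} {f δ : Laurent k m} (h : H.IsBernstein i f δ)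
    (hf : permLaurent k (simplePerm i) f = f) : H.T i * H.lau f = H.lau f * H.T i := by
  obtain ⟨h1, h2⟩ := h
  rw [hf, sub_self, mul_zero] at h2
  have h3 : var k i.succ - var k i.castSucc ≠ 0 :=
    sub_ne_zero.2 fun h => Fin.castSucc_lt_succ.ne' (var_injective h)
  rw [h1, (mul_eq_zero.1 h2).resolve_left h3, hf, map_zero, smul_zero, add_zero]

theorem T_comm_lau (hq : q ≠ 0) {i : Fin m} {f : Laurent k m}
    (hf : permLaurent k (simplePerm i) f = f) : H.T i * H.lau f = H.lau f * H.T i :=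
  (H.exists_isBernstein hq i f).choose_spec.of_fixed hf

theorem lau_mul_T (hq : q ≠ 0) (i : Fin m) (f : Laurent k m) : ∃ δ : Laurent k m,
    H.lau f * H.T i = H.T i * H.lau (permLaurent k (simplePerm i) f) + H.lau δ := by
  obtain ⟨δ, h, -⟩ := H.exists_isBernstein hq i (permLaurent k (simplePerm i) f)
  rw [← permLaurent_mul, simplePerm_mul_self, permLaurent_one] at h
  exact ⟨-((q - 1) • δ), by rw [h, map_neg, map_smul, add_neg_cancel_right]⟩

section Levi

variable (J : Finset (Fin m))

/-- The elements `∑ T_w f_w`, `w ∈ W_J`, with Laurent polynomials as right coefficients. -/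
def rightSum : (Equiv.Perm (Fin (m + 1)) → Laurent k m) →ₗ[k] A where
  toFun f := ∑ w ∈ parabolicFinset J, H.TT w * H.lau (f w)
  map_add' f g := by simp only [Pi.add_apply, map_add, mul_add, Finset.sum_add_distrib]
  map_smul' c f := by
    simp only [Pi.smul_apply, map_smul, mul_smul_comm, Finset.smul_sum, RingHom.id_apply]

/-- The elements `∑ f_w T_w`, `w ∈ W_J`, with Laurent polynomials as left coefficients. -/
def leftSum : (Equiv.Perm (Fin (m + 1)) → Laurent k m) →ₗ[k] A where
  toFun f := ∑ w ∈ parabolicFinset J, H.lau (f w) * H.TT w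
  map_add' f g := by simp only [Pi.add_apply, map_add, add_mul, Finset.sum_add_distrib]
  map_smul' c f := by
    simp only [Pi.smul_apply, map_smul, smul_mul_assoc, Finset.smul_sum, RingHom.id_apply]

theorem rightSum_apply (f : Equiv.Perm (Fin (m + 1)) → Laurent k m) :
    H.rightSum J f = ∑ w ∈ parabolicFinset J, H.TT w * H.lau (f w) := rfl

theorem leftSum_apply (f : Equiv.Perm (Fin (m + 1)) → Laurent k m) :
    H.leftSum J f = ∑ w ∈ parabolicFinset J, H.lau (f w) * H.TT w := rfl

/-- The affine Hecke algebra of the Levi subgroup attached to `J`. -/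
def levi : Subalgebra k A := Algebra.adjoin k (H.T '' J ∪ Set.range H.lau)

variable {J}

theorem T_mem_levi {i : Fin m} (hi : i ∈ J) : H.T i ∈ H.levi J :=
  Algebra.subset_adjoin (Or.inl ⟨i, hi, rfl⟩)

theorem lau_mem_levi (f : Laurent k m) : H.lau f ∈ H.levi J :=
  Algebra.subset_adjoin (Or.inr ⟨f, rfl⟩)

theorem TT_mem_levi {w : Equiv.Perm (Fin (m + 1))} (hw : w ∈ parabolic J) :
    H.TT w ∈ H.levi J := by
  refine parabolic_induction (motive := fun w => H.TT w ∈ H.levi J) ?_ (fun w hw i hi hlt ih => ?_)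
    w hw
  · rw [TT_one]; exact one_mem _
  · rw [H.TT_mul_simple hlt]; exact mul_mem ih (H.T_mem_levi hi)

theorem levi_univ : H.levi Finset.univ = ⊤ := by
  rw [← top_le_iff, ← H.adjoin_eq_top]
  refine Algebra.adjoin_le ?_
  rintro x ((⟨i, rfl⟩ | ⟨i, rfl⟩) | ⟨i, rfl⟩)
  · exact H.T_mem_levi (Finset.mem_univ _)
  · have := H.lau_mem_levi (J := Finset.univ) (var k i)
    rw [lau_var] at this
    exact this
  · have := H.lau_mem_levi (J := Finset.univ) (mono (Pi.single i (-1)))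
    rw [lau_var_inv] at this
    exact this

open scoped Classical in
theorem TT_mul_lau_mem {w : Equiv.Perm (Fin (m + 1))} (hw : w ∈ parabolic J) (f : Laurent k m) :
    H.TT w * H.lau f ∈ LinearMap.range (H.rightSum J) := by
  refine ⟨Pi.single w f, ?_⟩
  rw [rightSum_apply, Finset.sum_eq_single w]
  · rw [Pi.single_eq_same]
  · intro w' _ hne
    rw [Pi.single_eq_of_ne hne, map_zero, mul_zero]
  · exact fun h => absurd (mem_parabolicFinset.2 hw) h

open scoped Classical in
theorem lau_mul_TT_mem {w : Equiv.Perm (Fin (m + 1))} (hw : w ∈ parabolic J) (f : Laurent k m) :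
    H.lau f * H.TT w ∈ LinearMap.range (H.leftSum J) := by
  refine ⟨Pi.single w f, ?_⟩
  rw [leftSum_apply, Finset.sum_eq_single w]
  · rw [Pi.single_eq_same]
  · intro w' _ hne
    rw [Pi.single_eq_of_ne hne, map_zero, zero_mul]
  · exact fun h => absurd (mem_parabolicFinset.2 hw) h

/-- The range of `rightSum` contains `1` and is stable under right multiplication by generators of
the Levi subalgebra: the Bernstein relation moves a `T_i` to the left of the coefficient, where it
is absorbed by `T_w`. -/
theorem mem_range_rightSum (hq : q ≠ 0) {y : A} (hy : y ∈ H.levi J) :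
    ∃ f, y = H.rightSum J f := by
  suffices h : ∀ x ∈ LinearMap.range (H.rightSum J), x * y ∈ LinearMap.range (H.rightSum J) by
    obtain ⟨f, hf⟩ := h 1 (by simpa using H.TT_mul_lau_mem (J := J) (one_mem _) 1)
    exact ⟨f, by rw [hf, one_mul]⟩
  induction hy using Algebra.adjoin_induction with
  | mem y hy =>
    rintro _ ⟨f, rfl⟩
    rw [rightSum_apply, Finset.sum_mul]
    refine Submodule.sum_mem _ fun w hw => ?_
    rw [mem_parabolicFinset] at hw
    rcases hy with ⟨i, hi, rfl⟩ | ⟨g, rfl⟩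
    · obtain ⟨δ, hδ⟩ := H.lau_mul_T hq i (f w)
      have hi' := simplePerm_mem_parabolic (Finset.mem_coe.1 hi)
      rw [mul_assoc, hδ, mul_add, ← mul_assoc]
      refine Submodule.add_mem _ ?_ (H.TT_mul_lau_mem hw _)
      rcases lt_or_gt_simple w i with h | h
      · rw [← H.TT_mul_simple h]
        exact H.TT_mul_lau_mem (mul_mem hw hi') _
      · rw [H.TT_mul_T_of_gt h, add_mul, smul_mul_assoc, smul_mul_assoc]
        exact Submodule.add_mem _ (Submodule.smul_mem _ _ (H.TT_mul_lau_mem hw _))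
          (Submodule.smul_mem _ _ (H.TT_mul_lau_mem (mul_mem hw hi') _))
    · rw [mul_assoc, ← map_mul]
      exact H.TT_mul_lau_mem hw _
  | algebraMap c =>
    intro x hx
    rw [← Algebra.commutes, ← Algebra.smul_def]
    exact Submodule.smul_mem _ _ hx
  | add y z _ _ hy hz => intro x hx; rw [mul_add]; exact Submodule.add_mem _ (hy x hx) (hz x hx)
  | mul y z _ _ hy hz => intro x hx; rw [← mul_assoc]; exact hz _ (hy x hx)

theorem mem_range_leftSum (hq : q ≠ 0) {y : A} (hy : y ∈ H.levi J) :
    ∃ f, y = H.leftSum J f := by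
  suffices h : ∀ x ∈ LinearMap.range (H.leftSum J), y * x ∈ LinearMap.range (H.leftSum J) by
    obtain ⟨f, hf⟩ := h 1 (by simpa using H.lau_mul_TT_mem (J := J) (one_mem _) 1)
    exact ⟨f, by rw [hf, mul_one]⟩
  induction hy using Algebra.adjoin_induction with
  | mem y hy =>
    rintro _ ⟨f, rfl⟩
    rw [leftSum_apply, Finset.mul_sum]
    refine Submodule.sum_mem _ fun w hw => ?_
    rw [mem_parabolicFinset] at hw
    rcases hy with ⟨i, hi, rfl⟩ | ⟨g, rfl⟩
    · obtain ⟨δ, hδ, -⟩ := H.exists_isBernstein hq i (f w)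
      have hi' := simplePerm_mem_parabolic (Finset.mem_coe.1 hi)
      rw [← mul_assoc, hδ, add_mul, mul_assoc, smul_mul_assoc]
      refine Submodule.add_mem _ ?_ (Submodule.smul_mem _ _ (H.lau_mul_TT_mem hw _))
      rcases lt_or_gt_simple w⁻¹ i with h | h
      · rw [H.T_mul_TT h]
        exact H.lau_mul_TT_mem (mul_mem hi' hw) _
      · rw [H.T_mul_TT_of_gt h, mul_add, mul_smul_comm, mul_smul_comm]
        exact Submodule.add_mem _ (Submodule.smul_mem _ _ (H.lau_mul_TT_mem hw _))
          (Submodule.smul_mem _ _ (H.lau_mul_TT_mem (mul_mem hi' hw) _))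
    · rw [← mul_assoc, ← map_mul]
      exact H.lau_mul_TT_mem hw _
  | algebraMap c =>
    intro x hx
    rw [← Algebra.smul_def]
    exact Submodule.smul_mem _ _ hx
  | add y z _ _ hy hz => intro x hx; rw [add_mul]; exact Submodule.add_mem _ (hy x hx) (hz x hx)
  | mul y z _ _ hy hz => intro x hx; rw [mul_assoc]; exact hy _ (hz x hx)

end Levi

end HeckeModel

/-! ### The basis theorem, by independence of automorphisms. -/

section Automorphisms

variable {k : Type*} [Field k] {m : ℕ}

theorem permRat_injective : Function.Injective
    (fun σ : Equiv.Perm (Fin (m + 1)) => ((permRat k σ : RatFun k m →+* RatFun k m) :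
      RatFun k m →* RatFun k m)) := by
  intro σ τ h
  ext i
  have h1 : permRat k σ (varRat k i) = permRat k τ (varRat k i) := DFunLike.congr_fun h (varRat k i)
  rw [permRat_varRat, permRat_varRat] at h1
  exact congrArg Fin.val (varRat_injective h1)

/-- Independence of the automorphisms of the rational functions given by permutations. -/
theorem eq_zero_of_sum_permRat (e : Equiv.Perm (Fin (m + 1)) → RatFun k m)
    (h : ∀ g, ∑ w, e w * permRat k w g = 0) (w : Equiv.Perm (Fin (m + 1))) : e w = 0 := by
  have hl := (linearIndependent_monoidHom (RatFun k m) (RatFun k m)).comp _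
    (permRat_injective (k := k) (m := m))
  rw [Fintype.linearIndependent_iff] at hl
  refine hl e ?_ w
  funext g
  rw [Finset.sum_apply]
  exact h g

end Automorphisms

namespace HeckeModel

variable {k : Type*} [Field k] {q : k} {m : ℕ} {A : Type*} [Ring A] [Algebra k A]
  (H : HeckeModel q m A)

theorem rep_lau (f : Laurent k m) (g : RatFun k m) :
    H.rep (H.lau f) g = algebraMap _ _ f * g := by
  induction f using laurent_adjoin_induction generalizing g with
  | var i => rw [lau_var, H.rep_X]; rfl
  | inv i =>
    have h1 : H.rep (H.X i) (H.rep ((H.X i)⁻¹ : Aˣ).val g) = g := by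
      rw [← Module.End.mul_apply, ← map_mul, Units.mul_inv, map_one, Module.End.one_apply]
    rw [H.rep_X] at h1
    have h2 : (algebraMap (Laurent k m) (RatFun k m) (mono (Pi.single i (-1)))) * varRat k i = 1 := by
      rw [varRat, var, ← map_mul, ← mono_add, ← Pi.single_add]; simp
    rw [lau_var_inv]
    conv_rhs => rw [← h1]
    rw [← mul_assoc, h2, one_mul]
  | const c => rw [AlgHom.commutes, AlgHom.commutes, Module.algebraMap_end_apply, smul_eq_cst_mul,
      cst]
  | add f g hf hg => rw [map_add, map_add, LinearMap.add_apply, hf, hg, map_add, add_mul]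
  | mul f g hf hg => rw [map_mul, map_mul, Module.End.mul_apply, hf, hg, map_mul, mul_assoc]

theorem varRat_sub_ne_zero (i : Fin m) : varRat k i.succ - varRat k i.castSucc ≠ 0 :=
  sub_ne_zero.2 fun h => Fin.castSucc_lt_succ.ne' (varRat_injective h)

theorem varRat_sub_mul_ne_zero (q : k) (i : Fin m) :
    varRat k i.succ - cst k q * varRat k i.castSucc ≠ 0 := by
  intro h
  rw [cst, varRat, varRat, ← map_mul, ← map_sub] at h
  have h1 := (map_eq_zero_iff _ algebraMap_laurent_injective).1 h
  rw [← Algebra.smul_def] at h1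
  have h2 := congrArg (fun f : Laurent k m => f.coeff (Pi.single i.succ 1)) h1
  have hne : (Pi.single i.castSucc 1 : Fin (m + 1) → ℤ) ≠ Pi.single i.succ 1 := fun h =>
    Fin.castSucc_lt_succ.ne (var_injective (k := k) (congrArg mono h))
  simp [var, mono, hne] at h2

open scoped Classical in
/-- The action of `T_σ` on rational functions is triangular. -/
theorem exists_rep_TT (σ : Equiv.Perm (Fin (m + 1))) :
    ∃ c : Equiv.Perm (Fin (m + 1)) → RatFun k m,
      (∀ g, H.rep (H.TT σ) g = ∑ w, c w * permRat k w g) ∧ c σ ≠ 0 ∧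
      ∀ w, c w ≠ 0 → w = σ ∨ invCount w < invCount σ := by
  induction σ using perm_induction with
  | one =>
    refine ⟨Pi.single 1 1, fun g => ?_, by simp, fun w hw => ?_⟩
    · rw [TT_one, map_one, Module.End.one_apply, Finset.sum_eq_single 1]
      · simp
      · intro w _ hw; rw [Pi.single_eq_of_ne hw, zero_mul]
      · simp
    · by_contra h
      rw [not_or] at h
      exact hw (Pi.single_eq_of_ne h.1 _)
  | mul σ i hi ih =>
    obtain ⟨c, hc, h1, h2⟩ := ih
    set a : RatFun k m := (cst k q - 1) * varRat k i.succ / (varRat k i.succ - varRat k i.castSucc)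
      with ha
    set b : RatFun k m := cst k q - a with hb
    -- The operator of `T_i` is `a + b s_i` with `b = (X_{i+1} - q X_i) / (X_{i+1} - X_i)`, so its
    -- leading coefficient never vanishes, whatever the value of `q`.
    have hb0 : b ≠ 0 := by
      have h3 := varRat_sub_ne_zero (k := k) i
      have : b = (varRat k i.succ - cst k q * varRat k i.castSucc) /
          (varRat k i.succ - varRat k i.castSucc) := by
        rw [hb, ha]; field_simp; ring
      rw [this]
      exact div_ne_zero (varRat_sub_mul_ne_zero q i) h3
    have hT : ∀ g, H.rep (H.T i) g = a * g + b * permRat k (simplePerm i) g := by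
      intro g
      rw [H.rep_T, demLus, ← ha, hb]; ring
    -- In `(∑ c_w w)(a + b s_i)` the automorphism `w` arises from `w` itself with the coefficient
    -- `a`, and from `w s_i` with the coefficient `b`.
    refine ⟨fun w => c w * permRat k w a + c (w * simplePerm i) * permRat k (w * simplePerm i) b,
      fun g => ?_, ?_, fun w hw => ?_⟩
    · rw [H.TT_mul_simple hi, map_mul, Module.End.mul_apply, hT, hc]
      simp only [map_add, map_mul, mul_add, add_mul, Finset.sum_add_distrib]
      congr 1
      · exact Finset.sum_congr rfl fun w _ => by ring
      · refine Fintype.sum_equiv (Equiv.mulRight (simplePerm i)) _ _ fun w => ?_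
        simp only [Equiv.coe_mulRight, mul_simplePerm_cancel, permRat_mul]
        ring
    · have h3 : c (σ * simplePerm i) = 0 := by
        by_contra h
        have h5 := invCount_mul_of_lt hi
        rcases h2 _ h with h4 | h4
        · rw [h4] at h5; omega
        · omega
      simp only [h3, zero_mul, zero_add, mul_simplePerm_cancel]
      exact mul_ne_zero h1 ((map_ne_zero_iff _ (permRat k σ).injective).2 hb0)
    · rw [invCount_mul_of_lt hi]
      by_cases h3 : c w = 0
      · have h4 : c (w * simplePerm i) ≠ 0 := fun h => hw (by simp [h3, h])
        have h6 := invCount_mul_simple_le (w * simplePerm i) i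
        rw [mul_simplePerm_cancel] at h6
        rcases h2 _ h4 with h5 | h5
        · left; rw [← h5, mul_simplePerm_cancel]
        · right; omega
      · right
        rcases h2 _ h3 with h5 | h5
        · rw [h5]; omega
        · omega

/-- Among the rows with nonzero diagonal entry, take one of maximal length, with index `v`. No other
row contributes to the automorphism `v`, so independence of automorphisms kills its diagonal entry.
-/
theorem eq_zero_of_triangular (C : Equiv.Perm (Fin (m + 1)) → Equiv.Perm (Fin (m + 1)) → RatFun k m)
    (h0 : ∀ u, C u u = 0 → ∀ w, C u w = 0)
    (h1 : ∀ u w, C u w ≠ 0 → w = u ∨ invCount w < invCount u)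
    (h : ∀ g, ∑ u, ∑ w, C u w * permRat k w g = 0) (u : Equiv.Perm (Fin (m + 1))) : C u u = 0 := by
  classical
  have key : ∀ w, ∑ u, C u w = 0 := eq_zero_of_sum_permRat _ fun g => by
    rw [← h g, Finset.sum_comm]
    exact Finset.sum_congr rfl fun w _ => Finset.sum_mul _ _ _
  by_contra hu
  obtain ⟨v, hv, hmax⟩ := Finset.exists_max_image
    (Finset.univ.filter fun u => C u u ≠ 0) invCount ⟨u, by simp [hu]⟩
  rw [Finset.mem_filter] at hv
  refine hv.2 ?_
  rw [← key v, Finset.sum_eq_single v]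
  · intro w _ hw
    by_contra hC
    rcases h1 w v hC with h2 | h2
    · exact hw h2.symm
    · have := hmax w (by simpa using fun h => hC (h0 w h v))
      omega
  · simp

/-- Apply the relation to a rational function `g`: every `T_w` acts triangularly with nonzero
leading coefficient, and a coefficient `f_w` enters its row as the nonzero factor `w(f_w)` unless it
vanishes. -/
theorem rightSum_univ_eq_zero (f : Equiv.Perm (Fin (m + 1)) → Laurent k m)
    (h : ∑ w, H.TT w * H.lau (f w) = 0) (w : Equiv.Perm (Fin (m + 1))) : f w = 0 := by
  choose c hc h1 h2 using H.exists_rep_TT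
  have hz : ∀ u : Equiv.Perm (Fin (m + 1)), ∀ p : Laurent k m,
      permRat k u (algebraMap _ _ p) = 0 ↔ p = 0 := fun u p => by
    rw [map_eq_zero_iff _ (permRat k u).injective, map_eq_zero_iff _ algebraMap_laurent_injective]
  have := eq_zero_of_triangular (fun u w => c u w * permRat k w (algebraMap _ _ (f u)))
    (fun u hu w => by
      rw [(hz u (f u)).1 ((mul_eq_zero.1 hu).resolve_left (h1 u)), map_zero, map_zero, mul_zero])
    (fun u w hw => h2 u w (left_ne_zero_of_mul hw)) (fun g => by
      have h3 := congrArg (fun y => H.rep y g) h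
      simp only [map_sum, map_mul, map_zero, LinearMap.sum_apply, Module.End.mul_apply,
        rep_lau, hc, LinearMap.zero_apply] at h3
      rw [← h3]
      exact Finset.sum_congr rfl fun u _ => Finset.sum_congr rfl fun w _ => by ring) w
  exact (hz w (f w)).1 ((mul_eq_zero.1 this).resolve_left (h1 w))

theorem leftSum_univ_eq_zero (f : Equiv.Perm (Fin (m + 1)) → Laurent k m)
    (h : ∑ w, H.lau (f w) * H.TT w = 0) (w : Equiv.Perm (Fin (m + 1))) : f w = 0 := by
  choose c hc h1 h2 using H.exists_rep_TT
  have hz : ∀ p : Laurent k m, algebraMap (Laurent k m) (RatFun k m) p = 0 ↔ p = 0 := fun p => by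
    rw [map_eq_zero_iff _ algebraMap_laurent_injective]
  have := eq_zero_of_triangular (fun u w => algebraMap _ _ (f u) * c u w)
    (fun u hu w => by
      rw [(hz (f u)).1 ((mul_eq_zero.1 hu).resolve_right (h1 u)), map_zero, zero_mul])
    (fun u w hw => h2 u w (right_ne_zero_of_mul hw)) (fun g => by
      have h3 := congrArg (fun y => H.rep y g) h
      simp only [map_sum, map_mul, map_zero, LinearMap.sum_apply, Module.End.mul_apply,
        rep_lau, hc, LinearMap.zero_apply] at h3
      rw [← h3]
      exact Finset.sum_congr rfl fun u _ => Finset.sum_congr rfl fun w _ => by ring) w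
  exact (hz (f w)).1 ((mul_eq_zero.1 this).resolve_right (h1 w))

open scoped Classical in
theorem leftSum_eq_zero {J : Finset (Fin m)} {f : Equiv.Perm (Fin (m + 1)) → Laurent k m}
    (h : H.leftSum J f = 0) {w : Equiv.Perm (Fin (m + 1))} (hw : w ∈ parabolic J) : f w = 0 := by
  have := H.leftSum_univ_eq_zero (fun w => if w ∈ parabolicFinset J then f w else 0) (by
    rw [← h, leftSum_apply, ← Finset.sum_filter_add_sum_filter_not Finset.univ
      (fun w => w ∈ parabolicFinset J), Finset.filter_univ_mem]
    rw [Finset.sum_congr rfl fun w hw => by rw [if_pos hw], add_eq_left]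
    exact Finset.sum_eq_zero fun w hw => by
      rw [if_neg (Finset.mem_filter.1 hw).2, map_zero, zero_mul]) w
  rwa [if_pos (mem_parabolicFinset.2 hw)] at this

end HeckeModel

/-! ### The Hecke algebra over a Levi subalgebra, and the shape of homomorphisms. -/

section Cosets

variable {m : ℕ}

open scoped Classical in
/-- The minimal representatives of the cosets `σ W_J`. -/
def incFinset (J : Finset (Fin m)) : Finset (Equiv.Perm (Fin (m + 1))) :=
  Finset.univ.filter (IncOn J)

theorem mem_incFinset {J : Finset (Fin m)} {d : Equiv.Perm (Fin (m + 1))} :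
    d ∈ incFinset J ↔ IncOn J d := by simp [incFinset]

theorem sum_inc_mul (J : Finset (Fin m)) {M : Type*} [AddCommMonoid M]
    (F : Equiv.Perm (Fin (m + 1)) → M) :
    ∑ u, F u = ∑ d ∈ incFinset J, ∑ w ∈ parabolicFinset J, F (d * w) := by
  rw [← Finset.sum_product']
  symm
  refine Finset.sum_bij (fun x _ => x.1 * x.2) (fun _ _ => Finset.mem_univ _) ?_ ?_ (fun _ _ => rfl)
  · rintro ⟨d, w⟩ h ⟨d', w'⟩ h' he
    rw [Finset.mem_product, mem_incFinset, mem_parabolicFinset] at h h'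
    exact Prod.ext_iff.2 (incOn_mul_unique h.1 h.2 h'.1 h'.2 he)
  · intro u _
    obtain ⟨d, w, hd, hw, rfl⟩ := exists_incOn_mul J u
    exact ⟨(d, w), Finset.mem_product.2 ⟨mem_incFinset.2 hd, mem_parabolicFinset.2 hw⟩, rfl⟩

theorem incOn_one (J : Finset (Fin m)) : IncOn J 1 := fun _ _ => Fin.castSucc_lt_succ

/-- The simple reflection `s_i` passes through `d`, as the reflection `s_j`. -/
def Passes (d : Equiv.Perm (Fin (m + 1))) (i j : Fin m) : Prop :=
  d j.castSucc = i.castSucc ∧ d j.succ = i.succ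

theorem Passes.inv {d : Equiv.Perm (Fin (m + 1))} {i j : Fin m} (h : Passes d i j) :
    Passes d⁻¹ j i :=
  ⟨by rw [← h.1, perm_inv_apply], by rw [← h.2, perm_inv_apply]⟩

end Cosets

namespace HeckeModel

variable {k : Type*} [Field k] {q : k} {m : ℕ} {A : Type*} [Ring A] [Algebra k A]
  (H : HeckeModel q m A) {J : Finset (Fin m)}

open scoped Classical in
theorem TT_mul_T (σ : Equiv.Perm (Fin (m + 1))) (i : Fin m) : H.TT σ * H.T i =
    (if σ i.castSucc < σ i.succ then (0 : k) else q - 1) • H.TT σ +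
      (if σ i.castSucc < σ i.succ then (1 : k) else q) • H.TT (σ * simplePerm i) := by
  rcases lt_or_gt_simple σ i with h | h
  · rw [if_pos h, if_pos h, H.TT_mul_simple h, zero_smul, zero_add, one_smul]
  · rw [if_neg h.not_gt, if_neg h.not_gt, H.TT_mul_T_of_gt h]

open scoped Classical in
theorem T_mul_TT_ite (σ : Equiv.Perm (Fin (m + 1))) (i : Fin m) : H.T i * H.TT σ =
    (if σ⁻¹ i.castSucc < σ⁻¹ i.succ then (0 : k) else q - 1) • H.TT σ +
      (if σ⁻¹ i.castSucc < σ⁻¹ i.succ then (1 : k) else q) • H.TT (simplePerm i * σ) := by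
  rcases lt_or_gt_simple σ⁻¹ i with h | h
  · rw [if_pos h, if_pos h, H.T_mul_TT h, zero_smul, zero_add, one_smul]
  · rw [if_neg h.not_gt, if_neg h.not_gt, H.T_mul_TT_of_gt h]

theorem T_mul_TT_of_passes {d : Equiv.Perm (Fin (m + 1))} {i j : Fin m} (h : Passes d i j) :
    H.T i * H.TT d = H.TT d * H.T j := by
  rw [H.T_mul_TT, simple_mul_eq h.1 h.2, H.TT_mul_simple]
  · rw [h.1, h.2]; exact Fin.castSucc_lt_succ
  · rw [h.inv.1, h.inv.2]; exact Fin.castSucc_lt_succ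

/-- Together with `inc_decomposition_unique`: the whole algebra is free as a right module over the
Levi subalgebra, with basis the `T_d` for `d` minimal in `d W_J`. Both follow from the basis `T_u
X^a` by writing `u = d w`, where lengths add. -/
theorem exists_inc_decomposition (hq : q ≠ 0) (J : Finset (Fin m)) (z : A) :
    ∃ y : Equiv.Perm (Fin (m + 1)) → A, (∀ d, y d ∈ H.levi J) ∧
      z = ∑ d ∈ incFinset J, H.TT d * y d := by
  obtain ⟨f, hf⟩ := H.mem_range_rightSum (J := Finset.univ) hq (y := z) (by
    rw [levi_univ]; exact Algebra.mem_top)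
  refine ⟨fun d => H.rightSum J fun w => f (d * w), fun d => ?_, ?_⟩
  · exact sum_mem fun w hw => mul_mem (H.TT_mem_levi (mem_parabolicFinset.1 hw)) (H.lau_mem_levi _)
  · have h1 : parabolicFinset (Finset.univ : Finset (Fin m)) = Finset.univ := by
      ext w; simp [mem_parabolicFinset, parabolic_univ]
    rw [hf, rightSum_apply, h1, sum_inc_mul J]
    refine Finset.sum_congr rfl fun d hd => ?_
    simp only [rightSum_apply, Finset.mul_sum]
    refine Finset.sum_congr rfl fun w hw => ?_
    rw [H.TT_mul_of_incOn (mem_incFinset.1 hd) (mem_parabolicFinset.1 hw), mul_assoc]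

theorem inc_decomposition_unique (hq : q ≠ 0) {y : Equiv.Perm (Fin (m + 1)) → A}
    (hy : ∀ d, y d ∈ H.levi J) (h : ∑ d ∈ incFinset J, H.TT d * y d = 0)
    {d : Equiv.Perm (Fin (m + 1))} (hd : IncOn J d) : y d = 0 := by
  choose f hf using fun d => H.mem_range_rightSum hq (hy d)
  choose D W hD hW hDW using exists_incOn_mul J
  have key : ∀ d w, IncOn J d → w ∈ parabolic J → D (d * w) = d ∧ W (d * w) = w :=
    fun d w hd hw => incOn_mul_unique (hD _) (hW _) hd hw (hDW _).symm
  have h1 : ∑ u, H.TT u * H.lau (f (D u) (W u)) = 0 := by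
    rw [← h, sum_inc_mul J]
    refine Finset.sum_congr rfl fun d hd => ?_
    rw [hf, rightSum_apply, Finset.mul_sum]
    refine Finset.sum_congr rfl fun w hw => ?_
    rw [mem_incFinset] at hd
    rw [mem_parabolicFinset] at hw
    rw [H.TT_mul_of_incOn hd hw, mul_assoc, (key d w hd hw).1, (key d w hd hw).2]
  rw [hf, rightSum_apply]
  refine Finset.sum_eq_zero fun w hw => ?_
  rw [mem_parabolicFinset] at hw
  have h2 := H.rightSum_univ_eq_zero _ h1 (d * w)
  rw [(key d w hd hw).1, (key d w hd hw).2] at h2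
  rw [h2, map_zero, mul_zero]

/-- The coefficient of `T_1` in `f v_J` is `f`. -/
theorem lau_mul_vee_injective (J : Finset (Fin m)) {f g : Laurent k m}
    (h : H.lau f * H.vee J = H.lau g * H.vee J) : f = g := by
  rw [← sub_eq_zero]
  refine H.leftSum_eq_zero (J := J) (f := fun _ => f - g) ?_ (one_mem _)
  rw [leftSum_apply, ← Finset.mul_sum, map_sub, sub_mul]
  exact sub_eq_zero.2 h

theorem vee_mem_levi (J : Finset (Fin m)) : H.vee J ∈ H.levi J :=
  sum_mem fun _ hw => H.TT_mem_levi (mem_parabolicFinset.1 hw)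

open scoped Classical in
-- Write `y = ∑ f_w T_w` over `W_J`. At an ascent `i` of `w`, the coefficient of `T_w` in `y T_i = q
-- y` reads `q f_{w s_i} = q f_w`. All coefficients therefore agree with `f_1`.
theorem exists_eq_lau_mul_vee (hq : q ≠ 0) {y : A} (hy : y ∈ H.levi J)
    (h : ∀ i ∈ J, y * H.T i = q • y) : ∃ f, y = H.lau f * H.vee J := by
  obtain ⟨f, rfl⟩ := H.mem_range_leftSum hq hy
  have step : ∀ i ∈ J, ∀ w ∈ parabolic J, w i.castSucc < w i.succ → f (w * simplePerm i) = f w := by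
    intro i hi w hw hlt
    set a : Equiv.Perm (Fin (m + 1)) → k := fun σ =>
      if σ i.castSucc < σ i.succ then (0 : k) else q - 1 with ha
    set b : Equiv.Perm (Fin (m + 1)) → k := fun σ =>
      if σ i.castSucc < σ i.succ then (1 : k) else q with hb
    have h1 : H.leftSum J (fun w => a w • f w + b (w * simplePerm i) • f (w * simplePerm i) - q • f w)
        = 0 := by
      have h2 := sub_eq_zero.2 (h i hi)
      rw [leftSum_apply, Finset.sum_mul] at h2
      have h3 : ∀ w : Equiv.Perm (Fin (m + 1)), H.lau (f w) * H.TT w * H.T i =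
          H.lau (a w • f w) * H.TT w + H.lau (b w • f w) * H.TT (w * simplePerm i) := by
        intro w
        rw [mul_assoc, H.TT_mul_T, mul_add, mul_smul_comm, mul_smul_comm, map_smul, map_smul,
          smul_mul_assoc, smul_mul_assoc]
      rw [Finset.sum_congr rfl fun w _ => h3 w, Finset.sum_add_distrib,
        ← sum_mul_simple_eq hi (fun w => H.lau (b w • f w) * H.TT (w * simplePerm i)),
        Finset.smul_sum, ← Finset.sum_add_distrib, ← Finset.sum_sub_distrib] at h2
      rw [leftSum_apply, ← h2]
      refine Finset.sum_congr rfl fun w _ => ?_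
      rw [mul_simplePerm_cancel, map_sub, map_add, map_smul H.lau q, sub_mul, add_mul,
        smul_mul_assoc]
    have h2 := H.leftSum_eq_zero h1 hw
    have h3 : ¬ (w * simplePerm i) i.castSucc < (w * simplePerm i) i.succ := by
      simpa [simplePerm_castSucc, simplePerm_succ] using hlt.le
    simp only [ha, hb, if_pos hlt, if_neg h3, zero_smul, zero_add, ← smul_sub] at h2
    exact sub_eq_zero.1 ((smul_eq_zero.1 h2).resolve_left hq)
  have hconst : ∀ w ∈ parabolic J, f w = f 1 := fun w hw =>
    parabolic_induction (motive := fun w => f w = f 1) rfl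
      (fun w hw i hi hlt ih => (step i hi w hw hlt).trans ih) w hw
  refine ⟨f 1, ?_⟩
  rw [leftSum_apply, vee, Finset.mul_sum]
  exact Finset.sum_congr rfl fun w hw => by rw [hconst w (mem_parabolicFinset.1 hw)]

/-- The elements `∑ T_d f_d v_J`, the sum over the minimal representatives `d`. -/
def homSum (J : Finset (Fin m)) (f : Equiv.Perm (Fin (m + 1)) → Laurent k m) : A :=
  ∑ d ∈ incFinset J, H.TT d * (H.lau (f d) * H.vee J)

theorem homSum_sub (f g : Equiv.Perm (Fin (m + 1)) → Laurent k m) :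
    H.homSum J (f - g) = H.homSum J f - H.homSum J g := by
  rw [homSum, homSum, homSum, ← Finset.sum_sub_distrib]
  exact Finset.sum_congr rfl fun d _ => by rw [Pi.sub_apply, map_sub, sub_mul, mul_sub]

/-- Right multiplication by `T_i`, `i ∈ J`, acts separately on the components of `z` over the Levi
subalgebra. Each component is thus an eigenvector of the same kind and has the form `f v_J`. -/
theorem exists_homSum (hq : q ≠ 0) {z : A} (h : ∀ i ∈ J, z * H.T i = q • z) :
    ∃ f, z = H.homSum J f := by
  obtain ⟨y, hy, rfl⟩ := H.exists_inc_decomposition hq J z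
  have key : ∀ d, IncOn J d → ∃ f, y d = H.lau f * H.vee J := by
    intro d hd
    refine H.exists_eq_lau_mul_vee hq (hy d) fun i hi => ?_
    rw [← sub_eq_zero]
    refine H.inc_decomposition_unique hq (J := J) (y := fun d => y d * H.T i - q • y d)
      (fun d => sub_mem (mul_mem (hy d) (H.T_mem_levi hi)) (Subalgebra.smul_mem _ (hy d) q)) ?_ hd
    have h1 := sub_eq_zero.2 (h i hi)
    rw [← h1, Finset.sum_mul, Finset.smul_sum, ← Finset.sum_sub_distrib]
    exact Finset.sum_congr rfl fun d _ => by rw [mul_sub, mul_assoc, mul_smul_comm]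
  choose! f hf using key
  exact ⟨f, Finset.sum_congr rfl fun d hd => by rw [hf d (mem_incFinset.1 hd)]⟩

open scoped Classical in
/-- The components of `T_i z` for `z = ∑ T_d y_d`. -/
theorem homSum_left_components (hq : q ≠ 0) {y : Equiv.Perm (Fin (m + 1)) → A}
    (hy : ∀ d, y d ∈ H.levi J) {i : Fin m}
    (h : H.T i * ∑ d ∈ incFinset J, H.TT d * y d = q • ∑ d ∈ incFinset J, H.TT d * y d)
    {d : Equiv.Perm (Fin (m + 1))} (hd : IncOn J d) :
    (∀ j ∈ J, Passes d i j → H.T j * y d = q • y d) ∧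
      (IncOn J (simplePerm i * d) → y (simplePerm i * d) = y d) := by
  set a : Equiv.Perm (Fin (m + 1)) → k := fun σ =>
    if σ⁻¹ i.castSucc < σ⁻¹ i.succ then (0 : k) else q - 1 with ha
  set b : Equiv.Perm (Fin (m + 1)) → k := fun σ =>
    if σ⁻¹ i.castSucc < σ⁻¹ i.succ then (1 : k) else q with hb
  set P : Equiv.Perm (Fin (m + 1)) → Prop := fun d => ∃ j ∈ J, Passes d i j with hP
  -- These are the components of `T_i z - q z`. If `s_i` passes through `d`, the factor `T_i` turns
  -- into a `T_j` acting on `y_d`; otherwise `s_i` permutes the remaining representatives, and the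
  -- component at `d` receives terms from `d` and `s_i d`.
  set y' : Equiv.Perm (Fin (m + 1)) → A := fun d =>
    (if h : P d then H.T h.choose * y d else
      a d • y d + b (simplePerm i * d) • y (simplePerm i * d)) - q • y d with hy'
  have hmem : ∀ d, y' d ∈ H.levi J := by
    intro d
    refine sub_mem ?_ (Subalgebra.smul_mem _ (hy d) q)
    split_ifs with h1
    · exact mul_mem (H.T_mem_levi h1.choose_spec.1) (hy d)
    · exact add_mem (Subalgebra.smul_mem _ (hy d) _) (Subalgebra.smul_mem _ (hy _) _)
  -- The representatives through which `s_i` does not pass are stable under `d ↦ s_i d`; this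
  -- justifies the reindexing of the sum below.
  have hswap : ∀ d, IncOn J d → ¬ P d → IncOn J (simplePerm i * d) ∧ ¬ P (simplePerm i * d) := by
    intro d hd hnP
    refine ⟨(incOn_simple_mul_or hd i).resolve_right hnP, ?_⟩
    rintro ⟨j, hj, h1, h2⟩
    rw [Equiv.Perm.mul_apply] at h1 h2
    have h3 : d j.castSucc = i.succ := by
      rw [← simplePerm_simplePerm i (d j.castSucc), h1, simplePerm_castSucc]
    have h4 : d j.succ = i.castSucc := by
      rw [← simplePerm_simplePerm i (d j.succ), h2, simplePerm_succ]
    have := hd j hj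
    rw [h3, h4] at this
    exact lt_asymm this Fin.castSucc_lt_succ
  have hsum : ∑ d ∈ incFinset J, H.TT d * y' d = 0 := by
    rw [← sub_eq_zero.2 h, Finset.mul_sum, Finset.smul_sum, ← Finset.sum_sub_distrib]
    simp only [hy', mul_sub, mul_smul_comm, Finset.sum_sub_distrib]
    congr 1
    rw [← Finset.sum_filter_add_sum_filter_not (incFinset J) P,
      ← Finset.sum_filter_add_sum_filter_not (incFinset J) P (fun d => H.T i * (H.TT d * y d))]
    congr 1
    · refine Finset.sum_congr rfl fun d hd => ?_
      have h1 := (Finset.mem_filter.1 hd).2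
      rw [dif_pos h1, ← mul_assoc, ← mul_assoc, H.T_mul_TT_of_passes h1.choose_spec.2]
    · have hN : ∀ d, d ∈ (incFinset J).filter (fun d => ¬ P d) ↔ IncOn J d ∧ ¬ P d := fun d => by
        rw [Finset.mem_filter, mem_incFinset]
      have h1 : ∀ F : Equiv.Perm (Fin (m + 1)) → A,
          ∑ d ∈ (incFinset J).filter (fun d => ¬ P d), F (simplePerm i * d) =
          ∑ d ∈ (incFinset J).filter (fun d => ¬ P d), F d := by
        intro F
        refine Finset.sum_bij' (fun d _ => simplePerm i * d) (fun d _ => simplePerm i * d)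
          ?_ ?_ ?_ ?_ ?_
        · exact fun d hd => (hN _).2 (hswap d ((hN d).1 hd).1 ((hN d).1 hd).2)
        · exact fun d hd => (hN _).2 (hswap d ((hN d).1 hd).1 ((hN d).1 hd).2)
        · intros; simp
        · intros; simp
        · intros; rfl
      have h2 : ∀ d, H.T i * (H.TT d * y d) =
          H.TT d * (a d • y d) + H.TT (simplePerm i * d) * (b d • y d) := by
        intro d
        rw [← mul_assoc, H.T_mul_TT_ite, add_mul, smul_mul_assoc, smul_mul_assoc, mul_smul_comm,
          mul_smul_comm]
      rw [Finset.sum_congr rfl fun d _ => h2 d, Finset.sum_add_distrib,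
        ← h1 (fun d => H.TT (simplePerm i * d) * (b d • y d)), ← Finset.sum_add_distrib]
      refine Finset.sum_congr rfl fun d hd => ?_
      rw [dif_neg ((hN d).1 hd).2, mul_add, simplePerm_mul_cancel]
  have h0 := H.inc_decomposition_unique hq hmem hsum hd
  simp only [hy'] at h0
  constructor
  · intro j hj hp
    have h1 : P d := ⟨j, hj, hp⟩
    rw [dif_pos h1] at h0
    have h2 : h1.choose = j := by
      have h3 := h1.choose_spec.2
      exact Fin.castSucc_injective _ (d.injective (h3.1.trans hp.1.symm))
    rw [h2] at h0
    exact sub_eq_zero.1 h0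
  · intro hs
    have h1 : ¬ P d := by
      rintro ⟨j, hj, h1, h2⟩
      have := hs j hj
      rw [Equiv.Perm.mul_apply, Equiv.Perm.mul_apply, h1, h2, simplePerm_castSucc,
        simplePerm_succ] at this
      exact lt_asymm this Fin.castSucc_lt_succ
    rw [dif_neg h1] at h0
    have h5 : (simplePerm i * d)⁻¹ i.castSucc = d⁻¹ i.succ := by
      rw [mul_inv_rev, simplePerm_inv, Equiv.Perm.mul_apply, simplePerm_castSucc]
    have h6 : (simplePerm i * d)⁻¹ i.succ = d⁻¹ i.castSucc := by
      rw [mul_inv_rev, simplePerm_inv, Equiv.Perm.mul_apply, simplePerm_succ]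
    simp only [ha, hb, h5, h6] at h0
    rcases lt_or_gt_simple d⁻¹ i with h2 | h2
    · rw [if_pos h2, if_neg h2.not_gt, zero_smul, zero_add, ← smul_sub] at h0
      exact sub_eq_zero.1 ((smul_eq_zero_iff_right hq).1 h0)
    · rw [if_neg h2.not_gt, if_pos h2, one_smul, sub_smul, one_smul] at h0
      rw [← sub_eq_zero, ← h0]; abel

/-- The Bernstein relation gives `q s_j f + (q - 1) δ = q f`. Multiplied by `X_{j+1} - X_j`, this
becomes `(s_j f - f)(X_{j+1} - q X_j) = 0`, and the second factor is not zero. -/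
theorem perm_eq_of_T_mul (hq : q ≠ 0) {j : Fin m} (hj : j ∈ J) {f : Laurent k m}
    (h : H.T j * (H.lau f * H.vee J) = q • (H.lau f * H.vee J)) :
    permLaurent k (simplePerm j) f = f := by
  obtain ⟨δ, h1, h2⟩ := H.exists_isBernstein hq j f
  rw [← mul_assoc, h1, add_mul, mul_assoc, H.T_mul_vee hj, mul_smul_comm, ← smul_mul_assoc,
    ← add_mul, ← smul_mul_assoc, ← map_smul H.lau, ← map_smul H.lau, ← map_smul H.lau, ← map_add] at h
  have h3 := H.lau_mul_vee_injective J h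
  rw [Algebra.smul_def, Algebra.smul_def, Algebra.smul_def, map_sub, map_one] at h3
  have h4 : (permLaurent k (simplePerm j) f - f) *
      (var k j.succ - algebraMap k _ q * var k j.castSucc) = 0 := by
    linear_combination (var k j.succ - var k j.castSucc) * h3 -
      (algebraMap k (Laurent k m) q - 1) * h2
  refine sub_eq_zero.1 ((mul_eq_zero.1 h4).resolve_right fun h5 => ?_)
  refine varRat_sub_mul_ne_zero q j ?_
  rw [varRat, varRat, cst, ← map_mul, ← map_sub, h5, map_zero]

theorem homSum_invariance (hq : q ≠ 0) {f : Equiv.Perm (Fin (m + 1)) → Laurent k m} {i : Fin m}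
    (h : H.T i * H.homSum J f = q • H.homSum J f) {d : Equiv.Perm (Fin (m + 1))} (hd : IncOn J d) :
    (∀ j ∈ J, Passes d i j → permLaurent k (simplePerm j) (f d) = f d) ∧
      (IncOn J (simplePerm i * d) → f (simplePerm i * d) = f d) := by
  have := H.homSum_left_components hq (J := J) (y := fun d => H.lau (f d) * H.vee J)
    (fun d => mul_mem (H.lau_mem_levi _) (H.vee_mem_levi J)) h hd
  exact ⟨fun j hj hp => H.perm_eq_of_T_mul hq hj (this.1 j hj hp),
    fun hs => H.lau_mul_vee_injective J (this.2 hs)⟩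

end HeckeModel

/-! ### Homomorphisms between the right ideals `v_J A`. -/

section CyclicModules

variable {k : Type*} [Field k] {A : Type*} [Ring A] [Algebra k A] {m : ℕ}

/-- The right ideal `x A`. -/
abbrev cyc (x : A) : Submodule Aᵐᵒᵖ A := Submodule.span Aᵐᵒᵖ {x}

theorem mem_cyc {x z : A} : z ∈ cyc x ↔ ∃ h, z = x * h := by
  rw [Submodule.mem_span_singleton]
  exact ⟨fun ⟨a, ha⟩ => ⟨a.unop, ha.symm⟩, fun ⟨h, hh⟩ => ⟨MulOpposite.op h, hh.symm⟩⟩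

/-- Left multiplication as an endomorphism of the right module `A`. -/
def leftMul (y : A) : A →ₗ[Aᵐᵒᵖ] A where
  toFun x := y * x
  map_add' := mul_add y
  map_smul' a x := (mul_assoc y x a.unop).symm

variable (v : Finset (Fin m) → A)

/-- The direct sum of the right ideals `v_J A`. -/
abbrev CycSum : Type _ := ⨁ J : Finset (Fin m), cyc (v J)

/-- The endomorphism ring of the direct sum of the right ideals `v_J A`. -/
abbrev CycEnd : Type _ := Module.End Aᵐᵒᵖ (CycSum v)

/-- The generator of the right ideal `v_J A`. -/
def cycGen (J : Finset (Fin m)) : cyc (v J) := ⟨v J, Submodule.mem_span_singleton_self _⟩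

/-- The inclusion of a summand. -/
abbrev cycIncl (J : Finset (Fin m)) : cyc (v J) →ₗ[Aᵐᵒᵖ] CycSum v :=
  DirectSum.lof Aᵐᵒᵖ _ (fun L => cyc (v L)) J

/-- The projection to a summand. -/
abbrev cycProj (J : Finset (Fin m)) : CycSum v →ₗ[Aᵐᵒᵖ] cyc (v J) :=
  DirectSum.component Aᵐᵒᵖ _ (fun L => cyc (v L)) J

/-- The endomorphism `φ` is the homomorphism `v_J A → v_K A` with `v_J ↦ y`, extended by zero. -/
def IsHom (K J : Finset (Fin m)) (y : A) (φ : CycEnd v) : Prop :=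
  (∀ L, L ≠ J → ∀ x : cyc (v L), φ (cycIncl v L x) = 0) ∧
    ∃ z : cyc (v K), (z : A) = y ∧ φ (cycIncl v J (cycGen v J)) = cycIncl v K z

variable {v} {K J L : Finset (Fin m)}

theorem smul_cycGen (h : A) : MulOpposite.op h • (cycGen v J : cyc (v J)) =
    ⟨v J * h, mem_cyc.2 ⟨h, rfl⟩⟩ := rfl

theorem IsHom.mem {y : A} {φ : CycEnd v} (h : IsHom v K J y φ) : y ∈ cyc (v K) := by
  obtain ⟨-, z, rfl, -⟩ := h
  exact z.2

theorem exists_isHom {y : A} (h : y * v J ∈ cyc (v K)) : ∃ φ, IsHom v K J (y * v J) φ := by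
  have hm : ∀ x ∈ cyc (v J), leftMul y x ∈ cyc (v K) := by
    intro x hx
    obtain ⟨a, rfl⟩ := mem_cyc.1 hx
    obtain ⟨b, hb⟩ := mem_cyc.1 h
    refine mem_cyc.2 ⟨b * a, ?_⟩
    rw [← mul_assoc, ← hb, mul_assoc]; rfl
  refine ⟨cycIncl v K ∘ₗ (leftMul y).restrict hm ∘ₗ cycProj v J, fun L hL x => ?_,
    ⟨y * v J, h⟩, rfl, ?_⟩
  · simp only [LinearMap.comp_apply]
    rw [DirectSum.component.of, dif_neg hL, map_zero, map_zero]
  · simp only [LinearMap.comp_apply]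
    rw [DirectSum.component.of, dif_pos rfl]
    rfl

theorem IsHom.unique {y : A} {φ ψ : CycEnd v} (h₁ : IsHom v K J y φ) (h₂ : IsHom v K J y ψ) :
    φ = ψ := by
  refine DirectSum.linearMap_ext Aᵐᵒᵖ fun L => ?_
  by_cases hL : L = J
  · subst hL
    ext1 ⟨x, hx⟩
    obtain ⟨a, rfl⟩ := mem_cyc.1 hx
    obtain ⟨z₁, hz₁, e₁⟩ := h₁.2
    obtain ⟨z₂, hz₂, e₂⟩ := h₂.2
    have hz : z₁ = z₂ := Subtype.ext (hz₁.trans hz₂.symm)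
    rw [← smul_cycGen, map_smul, map_smul, LinearMap.comp_apply, LinearMap.comp_apply, e₁, e₂, hz]
  · ext1 x
    rw [LinearMap.comp_apply, LinearMap.comp_apply, h₁.1 L hL, h₂.1 L hL]

/-- Writing the image of `v_K` as `y v_K` makes the homomorphism left multiplication by `y`, so
composites are computed by multiplying on the left. -/
theorem IsHom.comp {y z : A} {φ ψ : CycEnd v} (h₁ : IsHom v L K (y * v K) φ)
    (h₂ : IsHom v K J z ψ) : IsHom v L J (y * z) (φ * ψ) := by
  obtain ⟨x, hx, ex⟩ := h₁.2
  obtain ⟨⟨z, hz⟩, rfl, ez⟩ := h₂.2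
  obtain ⟨a, rfl⟩ := mem_cyc.1 hz
  refine ⟨fun I hI w => by rw [Module.End.mul_apply, h₂.1 I hI, map_zero],
    MulOpposite.op a • x, ?_, ?_⟩
  · rw [Submodule.coe_smul, hx]
    exact mul_assoc _ _ _
  · rw [Module.End.mul_apply, ez, ← smul_cycGen, map_smul, map_smul, ex, map_smul]

theorem IsHom.add {y z : A} {φ ψ : CycEnd v} (h₁ : IsHom v K J y φ) (h₂ : IsHom v K J z ψ) :
    IsHom v K J (y + z) (φ + ψ) := by
  obtain ⟨y, rfl, ey⟩ := h₁.2
  obtain ⟨z, rfl, ez⟩ := h₂.2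
  exact ⟨fun I hI w => by rw [LinearMap.add_apply, h₁.1 I hI, h₂.1 I hI, add_zero], y + z, rfl,
    by rw [LinearMap.add_apply, ey, ez, map_add]⟩

theorem IsHom.smul {y : A} {φ : CycEnd v} (c : k) (h : IsHom v K J y φ) :
    IsHom v K J (c • y) (c • φ) := by
  obtain ⟨y, rfl, ey⟩ := h.2
  refine ⟨fun I hI w => by rw [LinearMap.smul_apply, h.1 I hI, smul_zero], c • y, rfl, ?_⟩
  rw [LinearMap.smul_apply, ey]
  have hc : ∀ x : CycSum v, c • x = (MulOpposite.op (algebraMap k A c) : Aᵐᵒᵖ) • x := fun x => by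
    rw [← MulOpposite.algebraMap_apply, algebraMap_smul]
  rw [hc, ← map_smul]
  congr 1
  ext1
  rw [Submodule.coe_smul]
  change (y : A) * algebraMap k A c = c • (y : A)
  rw [← Algebra.commutes, Algebra.smul_def]

theorem isHom_zero : IsHom v K J (0 : A) 0 :=
  ⟨fun _ _ _ => rfl, 0, rfl, by rw [map_zero, LinearMap.zero_apply]⟩

theorem isHom_one : IsHom v J J (v J) (cycIncl v J ∘ₗ cycProj v J) := by
  refine ⟨fun I hI w => ?_, cycGen v J, rfl, ?_⟩
  · rw [LinearMap.comp_apply, DirectSum.component.of, dif_neg hI, map_zero]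
  · rw [LinearMap.comp_apply, DirectSum.component.of, dif_pos rfl]

theorem IsHom.mul_eq_zero {y z : A} {φ ψ : CycEnd v} {I : Finset (Fin m)} (hne : K ≠ I)
    (h₁ : IsHom v L I y φ) (h₂ : IsHom v K J z ψ) : φ * ψ = 0 := by
  obtain ⟨⟨z, hz⟩, rfl, ez⟩ := h₂.2
  have h0 : IsHom v L J (0 : A) (φ * ψ) := by
    refine ⟨fun I hI w => by rw [Module.End.mul_apply, h₂.1 I hI, map_zero], 0, rfl, ?_⟩
    rw [Module.End.mul_apply, ez, h₁.1 K hne, map_zero]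
  exact h0.unique isHom_zero

theorem sum_incl_proj : ∑ J, (cycIncl v J ∘ₗ cycProj v J : CycEnd v) = 1 := by
  refine DirectSum.linearMap_ext Aᵐᵒᵖ fun L => ?_
  ext1 x
  rw [LinearMap.comp_apply, LinearMap.sum_apply, Finset.sum_eq_single L]
  · rw [LinearMap.comp_apply, DirectSum.component.of, dif_pos rfl]; rfl
  · intro I _ hI
    rw [LinearMap.comp_apply, DirectSum.component.of, dif_neg hI.symm, map_zero]
  · simp

/-- By right linearity, the image of `v_J` inherits every eigenvalue relation of `v_J`. Only these
relations, and not the full annihilator of `v_J`, are used later. -/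
theorem exists_isHom_component (K J : Finset (Fin m)) (φ : CycEnd v) :
    ∃ z ∈ cyc (v K), (∀ (t : A) (c : k), v J * t = c • v J → z * t = c • z) ∧
      IsHom v K J z ((cycIncl v K ∘ₗ cycProj v K) * φ * (cycIncl v J ∘ₗ cycProj v J)) := by
  refine ⟨(cycProj v K (φ (cycIncl v J (cycGen v J))) : cyc (v K)), Subtype.coe_prop _,
    fun t c h => ?_, fun I hI w => ?_, _, rfl, ?_⟩
  · have h1 : MulOpposite.op t • (cycGen v J : cyc (v J)) =
        MulOpposite.op (algebraMap k A c) • cycGen v J := by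
      ext1
      change v J * t = v J * algebraMap k A c
      rw [h, ← Algebra.commutes, Algebra.smul_def]
    have h2 := congrArg (fun x => ((cycProj v K (φ (cycIncl v J x)) : cyc (v K)) : A)) h1
    simp only [map_smul] at h2
    rw [Submodule.coe_smul, Submodule.coe_smul] at h2
    rw [Algebra.smul_def, Algebra.commutes]
    exact h2
  · rw [Module.End.mul_apply, LinearMap.comp_apply, DirectSum.component.of, dif_neg hI, map_zero,
      map_zero]
  · rw [Module.End.mul_apply, LinearMap.comp_apply, DirectSum.component.of, dif_pos rfl]
    rfl

/-- The homomorphism `v_J A → v_K A` with `v_J ↦ z` belongs to the subalgebra `S`. -/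
def Mem (S : Subalgebra k (CycEnd v)) (K J : Finset (Fin m)) (z : A) : Prop :=
  ∃ φ ∈ S, IsHom v K J z φ

variable {S : Subalgebra k (CycEnd v)}

theorem Mem.comp {y z : A} (h₁ : Mem S L K (y * v K)) (h₂ : Mem S K J z) : Mem S L J (y * z) := by
  obtain ⟨φ, hφ, h₁⟩ := h₁
  obtain ⟨ψ, hψ, h₂⟩ := h₂
  exact ⟨φ * ψ, mul_mem hφ hψ, h₁.comp h₂⟩

theorem Mem.add {y z : A} (h₁ : Mem S K J y) (h₂ : Mem S K J z) : Mem S K J (y + z) := by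
  obtain ⟨φ, hφ, h₁⟩ := h₁
  obtain ⟨ψ, hψ, h₂⟩ := h₂
  exact ⟨φ + ψ, add_mem hφ hψ, h₁.add h₂⟩

theorem Mem.smul {y : A} (c : k) (h : Mem S K J y) : Mem S K J (c • y) := by
  obtain ⟨φ, hφ, h⟩ := h
  exact ⟨c • φ, S.smul_mem hφ c, h.smul c⟩

theorem Mem.sub {y z : A} (h₁ : Mem S K J y) (h₂ : Mem S K J z) : Mem S K J (y - z) := by
  have := h₁.add (h₂.smul (-1 : k))
  rwa [neg_smul, one_smul, ← sub_eq_add_neg] at this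

theorem mem_zero : Mem S K J (0 : A) := ⟨0, zero_mem S, isHom_zero⟩

theorem Mem.mem {y : A} (h : Mem S K J y) : y ∈ cyc (v K) := by
  obtain ⟨φ, -, h⟩ := h
  exact h.mem

theorem Mem.of_isHom {y : A} {φ : CycEnd v} (h : Mem S K J y) (hφ : IsHom v K J y φ) : φ ∈ S := by
  obtain ⟨ψ, hψ, h⟩ := h
  rwa [hφ.unique h]

theorem eq_top_of_mem (h : ∀ (K J : Finset (Fin m)) (z : A), z ∈ cyc (v K) →
    (∀ (t : A) (c : k), v J * t = c • v J → z * t = c • z) → Mem S K J z) : S = ⊤ := by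
  rw [eq_top_iff]
  intro φ _
  rw [← one_mul φ, ← mul_one (1 * φ), ← sum_incl_proj, Finset.sum_mul, Finset.sum_mul]
  refine sum_mem fun K _ => ?_
  rw [Finset.mul_sum]
  refine sum_mem fun J _ => ?_
  obtain ⟨z, hz, ht, hφ⟩ := exists_isHom_component (k := k) K J φ
  exact (h K J z hz ht).of_isHom hφ

end CyclicModules

/-! ### Double cosets of parabolic subgroups and matching Levi types. -/

section DoubleCosets

variable {m : ℕ} {J K L L' : Finset (Fin m)} {σ : Equiv.Perm (Fin (m + 1))}

theorem block_induction {R : Fin (m + 1) → Fin (m + 1) → Prop} (refl : ∀ x, R x x)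
    (step : ∀ x, ∀ i ∈ J, x ≤ i.castSucc → R x i.castSucc → R x i.succ) :
    ∀ y x, x ≤ y → block J x = block J y → R x y := by
  intro y
  induction y using Fin.induction with
  | zero => intro x hx _; rw [Fin.le_zero_iff.1 hx]; exact refl 0
  | succ j ih =>
    intro x hx hb
    rcases hx.eq_or_lt with rfl | hlt
    · exact refl _
    have hle : x ≤ j.castSucc := Fin.le_castSucc_iff.2 hlt
    have h1 := block_mono J hle
    have h2 := block_mono J (Fin.castSucc_lt_succ (i := j)).le
    have hj : block J j.castSucc = block J j.succ := by omega
    exact step x j (block_simple_iff.1 hj) hle (ih x hle (hb.trans hj.symm))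

theorem block_eq_of_forall {g : Fin (m + 1) → ℕ} (hg : ∀ i ∈ L, g i.castSucc = g i.succ)
    {x y : Fin (m + 1)} (h : block L x = block L y) : g x = g y := by
  have key := block_induction (J := L) (R := fun x y => g x = g y) (fun _ => rfl)
    (fun x i hi _ hx => hx.trans (hg i hi))
  rcases le_total x y with hxy | hxy
  · exact key y x hxy h
  · exact (key x y hxy h.symm).symm

/-- The permutation `σ` matches the simple reflections in `L'` with those in `L`. -/
def Matches (σ : Equiv.Perm (Fin (m + 1))) (L L' : Finset (Fin m)) : Prop :=
  (∀ j ∈ L', ∃ i ∈ L, Passes σ i j) ∧ ∀ i ∈ L, ∃ j ∈ L', Passes σ i j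

theorem Matches.incOn (h : Matches σ L L') : IncOn L' σ := by
  intro j hj
  obtain ⟨i, -, h1, h2⟩ := h.1 j hj
  rw [h1, h2]
  exact Fin.castSucc_lt_succ

theorem Matches.block_eq (h : Matches σ L L') {x y : Fin (m + 1)} (hb : block L x = block L y) :
    block L' (σ⁻¹ x) = block L' (σ⁻¹ y) := by
  refine block_eq_of_forall (g := fun x => block L' (σ⁻¹ x)) (fun i hi => ?_) hb
  obtain ⟨j, hj, h1⟩ := h.2 i hi
  rw [h1.inv.1, h1.inv.2]
  exact block_simple_iff.2 hj

/-- If the images of `j` and `j+1` were not neighbours, then `σ⁻¹`, being increasing on the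
`K`-block, would send an index between them strictly between `j` and `j+1`. -/
theorem exists_passes_of_block_eq (h : IncOn K σ⁻¹) {j : Fin m}
    (hlt : σ j.castSucc < σ j.succ)
    (hb : block K (σ j.castSucc) = block K (σ j.succ)) : ∃ i ∈ K, Passes σ i j := by
  have hne : σ j.castSucc ≠ Fin.last m := (hlt.trans_le (Fin.le_last _)).ne
  obtain ⟨i, hi⟩ := Fin.exists_castSucc_eq.2 hne
  have hle : i.succ ≤ σ j.succ := by
    rw [← Fin.castSucc_lt_iff_succ_le, hi]; exact hlt
  have hiK : i ∈ K := by
    refine (block_eq_iff hlt.le).1 hb i hi.ge ?_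
    rw [hi]; exact hlt
  refine ⟨i, hiK, hi.symm, ?_⟩
  rcases hle.eq_or_lt with h1 | h1
  · exact h1.symm
  · exfalso
    have h2 : block K i.castSucc = block K i.succ := block_simple_iff.2 hiK
    have h3 := h.lt h1 (h2.symm.trans (by rw [hi]; exact hb))
    rw [perm_inv_apply] at h3
    have h4 := h i hiK
    rw [hi, perm_inv_apply] at h4
    rw [Fin.lt_def] at h3 h4
    simp only [Fin.val_succ, Fin.val_castSucc] at h3 h4
    omega

open scoped Classical in
/-- The simple reflections in `K` that correspond under `σ` to those in `J`. -/
def leftLevi (σ : Equiv.Perm (Fin (m + 1))) (K J : Finset (Fin m)) : Finset (Fin m) :=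
  K.filter fun i => ∃ j ∈ J, Passes σ i j

open scoped Classical in
/-- The simple reflections in `J` that correspond under `σ` to those in `K`. -/
def rightLevi (σ : Equiv.Perm (Fin (m + 1))) (K J : Finset (Fin m)) : Finset (Fin m) :=
  J.filter fun j => ∃ i ∈ K, Passes σ i j

theorem matches_levi : Matches σ (leftLevi σ K J) (rightLevi σ K J) := by
  classical
  constructor
  · intro j hj
    obtain ⟨hj, i, hi, h⟩ := Finset.mem_filter.1 hj
    exact ⟨i, Finset.mem_filter.2 ⟨hi, j, hj, h⟩, h⟩
  · intro i hi
    obtain ⟨hi, j, hj, h⟩ := Finset.mem_filter.1 hi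
    exact ⟨j, Finset.mem_filter.2 ⟨hj, i, hi, h⟩, h⟩

theorem leftLevi_subset : leftLevi σ K J ⊆ K := by
  classical exact Finset.filter_subset _ _

theorem rightLevi_subset : rightLevi σ K J ⊆ J := by
  classical exact Finset.filter_subset _ _

/-- The double coset `W_K σ W_J` is parametrised by `d σ w` with `d` minimal modulo `leftLevi σ K
J`. A `J`-neighbour pair sent by `σ` into different `K`-blocks keeps its order since `d` preserves
the blocks; a pair sent into one block comes from a reflection in `leftLevi`. -/
theorem incOn_mul_of_leftLevi (hJ : IncOn J σ) (hK : IncOn K σ⁻¹) {d : Equiv.Perm (Fin (m + 1))}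
    (hd : d ∈ parabolic K) (hL : IncOn (leftLevi σ K J) d) : IncOn J (d * σ) := by
  classical
  intro j hj
  rw [Equiv.Perm.mul_apply, Equiv.Perm.mul_apply]
  by_cases hb : block K (σ j.castSucc) = block K (σ j.succ)
  · obtain ⟨i, hi, hp⟩ := exists_passes_of_block_eq hK (hJ j hj) hb
    rw [hp.1, hp.2]
    exact hL i (Finset.mem_filter.2 ⟨hi, j, hj, hp⟩)
  · by_contra hle
    have h1 := block_mono K (not_lt.1 hle)
    rw [mem_parabolic.1 hd, mem_parabolic.1 hd] at h1
    exact hb (le_antisymm (block_mono K (hJ j hj).le) h1)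

/-- Here `σ` exchanges two adjacent blocks inside a block of `L ∪ {i}`, hence inverts every pair of
positions taken from the two. An element `u` of that parabolic subgroup which increases on
`L'`-blocks can only invert such pairs, so `σ` is the longest of these `u`. -/
theorem inversions_subset_of_matches (h : Matches σ L L') {i : Fin m}
    (hi : σ⁻¹ i.succ < σ⁻¹ i.castSucc) (hσ : σ ∈ parabolic (insert i L))
    {u : Equiv.Perm (Fin (m + 1))} (hu : u ∈ parabolic (insert i L)) (hL : IncOn L' u) :
    inversions u ⊆ inversions σ := by
  rintro ⟨a, b⟩ hab
  rw [mem_inversions] at hab ⊢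
  obtain ⟨hab, hlt⟩ := hab
  refine ⟨hab, ?_⟩
  have hne : block L' a ≠ block L' b := fun hb => lt_asymm hlt (hL.lt hab hb)
  have hb : block (insert i L) a = block (insert i L) b := by
    refine le_antisymm (block_mono _ hab.le) ?_
    have := block_mono (insert i L) hlt.le
    rwa [mem_parabolic.1 hu, mem_parabolic.1 hu] at this
  have hbσ : block (insert i L) (σ a) = block (insert i L) (σ b) := by
    rw [mem_parabolic.1 hσ, mem_parabolic.1 hσ, hb]
  by_contra hcon
  have hσlt : σ a < σ b := lt_of_le_of_ne (not_lt.1 hcon) (σ.injective.ne hab.ne)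
  have hLne : block L (σ a) ≠ block L (σ b) := fun h1 => by
    have h2 := h.block_eq h1
    rw [perm_inv_apply, perm_inv_apply] at h2
    exact hne h2
  have hall := (block_eq_iff hσlt.le).1 hbσ
  have hiI : σ a ≤ i.castSucc ∧ i.castSucc < σ b := by
    by_contra hno
    refine hLne ((block_eq_iff hσlt.le).2 fun j h1 h2 => ?_)
    rcases Finset.mem_insert.1 (hall j h1 h2) with rfl | h3
    · exact absurd ⟨h1, h2⟩ hno
    · exact h3
  have h1 : block L (σ a) = block L i.castSucc := by
    refine (block_eq_iff hiI.1).2 fun j h1 h2 => ?_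
    rcases Finset.mem_insert.1 (hall j h1 (h2.trans hiI.2)) with rfl | h3
    · exact absurd h2 (lt_irrefl _)
    · exact h3
  have h2 : block L i.succ = block L (σ b) := by
    refine (block_eq_iff (Fin.castSucc_lt_iff_succ_le.1 hiI.2)).2 fun j h1 h2 => ?_
    rcases Finset.mem_insert.1 (hall j (hiI.1.trans (Fin.castSucc_lt_succ.le.trans h1)) h2)
      with rfl | h3
    · exact absurd h1 (not_le.2 Fin.castSucc_lt_succ)
    · exact h3
  have h3 := h.block_eq h1
  have h4 := h.block_eq h2
  rw [perm_inv_apply] at h3 h4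
  have h5 := block_mono L' hab.le
  have h6 := block_mono L' hi.le
  omega

end DoubleCosets

/-! ### Reduction to invariant polynomials, using splits and merges. -/

namespace HeckeModel

variable {k : Type*} [Field k] {q : k} {m : ℕ} {A : Type*} [Ring A] [Algebra k A]
  (H : HeckeModel q m A) {J K L L' : Finset (Fin m)}

open scoped Classical in
/-- The sum of the `T_d` over the minimal representatives of the cosets in `W_K / W_L`. -/
def relSum (L K : Finset (Fin m)) : A :=
  ∑ d ∈ (incFinset L).filter (· ∈ parabolic K), H.TT d

open scoped Classical in
theorem mem_relFinset {L K : Finset (Fin m)} {d : Equiv.Perm (Fin (m + 1))} :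
    d ∈ (incFinset L).filter (· ∈ parabolic K) ↔ IncOn L d ∧ d ∈ parabolic K := by
  rw [Finset.mem_filter, mem_incFinset]

open scoped Classical in
theorem relSum_mul_vee (h : L ⊆ K) : H.relSum L K * H.vee L = H.vee K := by
  rw [relSum, vee, vee, Finset.sum_mul_sum, ← Finset.sum_product']
  refine Finset.sum_bij (fun x _ => x.1 * x.2) ?_ ?_ ?_ ?_
  · rintro ⟨d, w⟩ hx
    rw [Finset.mem_product, mem_relFinset, mem_parabolicFinset] at hx
    exact mem_parabolicFinset.2 (mul_mem hx.1.2 (parabolic_mono h hx.2))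
  · rintro ⟨d, w⟩ hx ⟨d', w'⟩ hx' he
    rw [Finset.mem_product, mem_relFinset, mem_parabolicFinset] at hx hx'
    exact Prod.ext_iff.2 (incOn_mul_unique hx.1.1 hx.2 hx'.1.1 hx'.2 he)
  · intro u hu
    obtain ⟨d, w, hd, hw, rfl⟩ := exists_incOn_mul L u
    refine ⟨(d, w), ?_, rfl⟩
    rw [Finset.mem_product, mem_relFinset, mem_parabolicFinset]
    refine ⟨⟨hd, ?_⟩, hw⟩
    rw [mem_parabolicFinset] at hu
    exact (Subgroup.mul_mem_cancel_right _ (parabolic_mono h hw)).1 hu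
  · rintro ⟨d, w⟩ hx
    rw [Finset.mem_product, mem_relFinset, mem_parabolicFinset] at hx
    exact (H.TT_mul_of_incOn hx.1.1 hx.2).symm

open scoped Classical in
theorem vee_mem_cyc (h : L ⊆ K) : H.vee K ∈ cyc (H.vee L) := by
  refine mem_cyc.2 ⟨∑ d ∈ (incFinset L).filter (· ∈ parabolic K), H.TT d⁻¹, ?_⟩
  have hinv : ∀ (J : Finset (Fin m)) (F : Equiv.Perm (Fin (m + 1)) → A),
      ∑ w ∈ parabolicFinset J, F w = ∑ w ∈ parabolicFinset J, F w⁻¹ := by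
    intro J F
    refine Finset.sum_bij' (fun w _ => w⁻¹) (fun w _ => w⁻¹) ?_ ?_ ?_ ?_ ?_ <;>
      simp [mem_parabolicFinset]
  rw [vee, vee, hinv K, hinv L, Finset.sum_mul_sum, Finset.sum_comm, ← Finset.sum_product']
  symm
  refine Finset.sum_bij (fun x _ => x.1 * x.2) ?_ ?_ ?_ ?_
  · rintro ⟨d, w⟩ hx
    rw [Finset.mem_product, mem_relFinset, mem_parabolicFinset] at hx
    exact mem_parabolicFinset.2 (mul_mem hx.1.2 (parabolic_mono h hx.2))
  · rintro ⟨d, w⟩ hx ⟨d', w'⟩ hx' he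
    rw [Finset.mem_product, mem_relFinset, mem_parabolicFinset] at hx hx'
    exact Prod.ext_iff.2 (incOn_mul_unique hx.1.1 hx.2 hx'.1.1 hx'.2 he)
  · intro u hu
    obtain ⟨d, w, hd, hw, rfl⟩ := exists_incOn_mul L u
    refine ⟨(d, w), ?_, rfl⟩
    rw [Finset.mem_product, mem_relFinset, mem_parabolicFinset]
    refine ⟨⟨hd, ?_⟩, hw⟩
    rw [mem_parabolicFinset] at hu
    exact (Subgroup.mul_mem_cancel_right _ (parabolic_mono h hw)).1 hu
  · rintro ⟨d, w⟩ hx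
    rw [Finset.mem_product, mem_relFinset, mem_parabolicFinset] at hx
    simp only
    rw [mul_inv_rev]
    exact (H.TT_mul_of_incOn_inv (by rw [inv_inv]; exact hx.1.1) (inv_mem hx.2)).symm

/-- The elements `v_J ↦ v_K` with `J ⊆ K` and `v_J ↦ v_J` with `K ⊆ J` belong to `S`. -/
structure HasSplitsMerges (S : Subalgebra k (CycEnd H.vee)) : Prop where
  merge : ∀ {J K : Finset (Fin m)}, J ⊆ K → Mem S K J (H.vee K)
  split : ∀ {J K : Finset (Fin m)}, K ⊆ J → Mem S K J (H.vee J)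

variable {H} {S : Subalgebra k (CycEnd H.vee)}

/-- If `d` is not minimal on the left, some `i ∈ K` makes `s_i d` shorter. A descent cannot pass
through `d`, so `s_i d` is again `J`-minimal and has the same coefficient. The coefficients at
minimal double coset representatives therefore determine all others. -/
theorem homSum_eq_zero (hq : q ≠ 0) {f : Equiv.Perm (Fin (m + 1)) → Laurent k m}
    (h : ∀ i ∈ K, H.T i * H.homSum J f = q • H.homSum J f)
    (hf : ∀ σ, IncOn J σ → IncOn K σ⁻¹ → f σ = 0) : H.homSum J f = 0 := by
  have key : ∀ n : ℕ, ∀ d, IncOn J d → invCount d = n → f d = 0 := by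
    intro n
    induction n using Nat.strong_induction_on with
    | _ n ih =>
      intro d hd hn
      by_cases hK : IncOn K d⁻¹
      · exact hf d hd hK
      · simp only [IncOn, not_forall] at hK
        obtain ⟨i, hi, hlt⟩ := hK
        have hgt := (lt_or_gt_simple d⁻¹ i).resolve_left hlt
        have hinv := invCount_simple_mul_of_gt hgt
        rcases incOn_simple_mul_or hd i with h1 | ⟨j, hj, h1, h2⟩
        · rw [← (H.homSum_invariance hq (h i hi) hd).2 h1]
          exact ih _ (by omega) _ h1 rfl
        · exfalso
          rw [← h1, ← h2, perm_inv_apply, perm_inv_apply] at hgt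
          exact lt_asymm hgt Fin.castSucc_lt_succ
  refine Finset.sum_eq_zero fun d hd => ?_
  rw [key _ d (mem_incFinset.1 hd) rfl, map_zero, zero_mul, mul_zero]

open scoped Classical in
-- Induction on the number of minimal double coset representatives at which `f` is nonzero. For such
-- a `σ`, the composite `v_J → v_{L'} → v_{L'} → v_L → v_K` (split, multiply by `f_σ`, apply `T_σ`,
-- merge) has coefficients `g` agreeing with `f` at `σ` and vanishing at the other representatives.
theorem HasSplitsMerges.mem_homSum (hq : q ≠ 0) (hS : H.HasSplitsMerges S)
    {f : Equiv.Perm (Fin (m + 1)) → Laurent k m}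
    (h : ∀ i ∈ K, H.T i * H.homSum J f = q • H.homSum J f)
    (hf : ∀ σ, IncOn J σ → IncOn K σ⁻¹ → f σ ≠ 0 →
      Mem S (leftLevi σ K J) (rightLevi σ K J) (H.TT σ * H.vee (rightLevi σ K J)) ∧
      Mem S (rightLevi σ K J) (rightLevi σ K J) (H.lau (f σ) * H.vee (rightLevi σ K J))) :
    Mem S K J (H.homSum J f) := by
  set B : (Equiv.Perm (Fin (m + 1)) → Laurent k m) → Finset (Equiv.Perm (Fin (m + 1))) :=
    fun f => Finset.univ.filter fun σ => IncOn J σ ∧ IncOn K σ⁻¹ ∧ f σ ≠ 0 with hB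
  have hmemB : ∀ f σ, σ ∈ B f ↔ IncOn J σ ∧ IncOn K σ⁻¹ ∧ f σ ≠ 0 := fun f σ => by simp [hB]
  have key : ∀ n : ℕ, ∀ f : Equiv.Perm (Fin (m + 1)) → Laurent k m, (B f).card = n →
      (∀ i ∈ K, H.T i * H.homSum J f = q • H.homSum J f) →
      (∀ σ ∈ B f,
        Mem S (leftLevi σ K J) (rightLevi σ K J) (H.TT σ * H.vee (rightLevi σ K J)) ∧
        Mem S (rightLevi σ K J) (rightLevi σ K J) (H.lau (f σ) * H.vee (rightLevi σ K J))) →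
      Mem S K J (H.homSum J f) := by
    intro n
    induction n with
    | zero =>
      intro f hn h _
      rw [homSum_eq_zero hq h fun σ h1 h2 => ?_]
      · exact mem_zero
      · by_contra h3
        have := (hmemB f σ).2 ⟨h1, h2, h3⟩
        rw [Finset.card_eq_zero.1 hn] at this
        exact Finset.notMem_empty _ this
    | succ n ih =>
      intro f hn h hf
      obtain ⟨σ, hσ⟩ := Finset.card_pos.1 (n.succ_pos.trans_eq hn.symm)
      obtain ⟨hJ, hK, hne⟩ := (hmemB f σ).1 hσ
      set g : Equiv.Perm (Fin (m + 1)) → Laurent k m := fun u =>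
        if IncOn (leftLevi σ K J) (u * σ⁻¹) ∧ u * σ⁻¹ ∈ parabolic K then f σ else 0 with hg
      have hgsum : H.homSum J g =
          H.relSum (leftLevi σ K J) K * (H.TT σ * (H.lau (f σ) * H.vee J)) := by
        rw [relSum, Finset.sum_mul, homSum]
        symm
        refine Finset.sum_of_injOn (fun d => d * σ) (mul_left_injective σ).injOn ?_ ?_ ?_
        · intro d hd
          obtain ⟨h1, h2⟩ := mem_relFinset.1 hd
          exact mem_incFinset.2 (incOn_mul_of_leftLevi hJ hK h2 h1)
        · intro u hu hnot
          simp only [hg]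
          rw [if_neg, map_zero, zero_mul, mul_zero]
          intro hc
          exact hnot ⟨u * σ⁻¹, mem_relFinset.2 hc, inv_mul_cancel_right u σ⟩
        · intro d hd
          have hd := mem_relFinset.1 hd
          simp only [hg]
          rw [mul_inv_cancel_right, if_pos hd, H.TT_mul_of_incOn_inv hK hd.2, mul_assoc]
      have hgmem : Mem S K J (H.homSum J g) := by
        rw [hgsum]
        obtain ⟨h1, h2⟩ := hf σ hσ
        refine Mem.comp (K := leftLevi σ K J) ?_ (Mem.comp h1 (Mem.comp h2 (hS.split rightLevi_subset)))
        rw [H.relSum_mul_vee leftLevi_subset]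
        exact hS.merge leftLevi_subset
      -- The support of `g` lies in the coset `W_K σ`, and the only element of that coset minimal on
      -- the left is `σ`. Subtracting `g` hence removes exactly one representative from the support.
      have hgB : ∀ u, IncOn K u⁻¹ → g u = if u = σ then f σ else 0 := by
        intro u hu
        simp only [hg]
        by_cases h1 : u = σ
        · subst h1
          rw [if_pos rfl, if_pos]
          rw [mul_inv_cancel]
          exact ⟨incOn_one _, one_mem _⟩
        · rw [if_neg h1, if_neg]
          rintro ⟨-, h2⟩
          have h3 : (u * σ⁻¹)⁻¹ = 1 := by
            refine hK.eq_one_of_mul (inv_mem h2) ?_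
            rw [mul_inv_rev, inv_inv, inv_mul_cancel_left]
            exact hu
          exact h1 (mul_inv_eq_one.1 (inv_eq_one.1 h3))
      have hsub : B (f - g) = (B f).erase σ := by
        ext u
        rw [Finset.mem_erase, hmemB, hmemB]
        constructor
        · rintro ⟨h1, h2, h3⟩
          rw [Pi.sub_apply, hgB u h2] at h3
          by_cases h4 : u = σ
          · rw [if_pos h4, h4, sub_self] at h3; exact absurd rfl h3
          · rw [if_neg h4, sub_zero] at h3; exact ⟨h4, h1, h2, h3⟩
        · rintro ⟨h4, h1, h2, h3⟩
          refine ⟨h1, h2, ?_⟩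
          rwa [Pi.sub_apply, hgB u h2, if_neg h4, sub_zero]
      have hfg := H.homSum_sub (J := J) f g
      have hginv : ∀ i ∈ K, H.T i * H.homSum J g = q • H.homSum J g := by
        intro i hi
        obtain ⟨y, hy⟩ := mem_cyc.1 hgmem.mem
        rw [hy, ← mul_assoc, H.T_mul_vee hi, smul_mul_assoc]
      have h1 := ih (f - g) (by rw [hsub, Finset.card_erase_of_mem hσ, hn, Nat.add_sub_cancel])
        (fun i hi => by rw [hfg, mul_sub, h i hi, hginv i hi, smul_sub]) ?_
      · have := h1.add hgmem
        rwa [hfg, sub_add_cancel] at this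
      · intro u hu
        rw [hsub, Finset.mem_erase] at hu
        rw [Pi.sub_apply, hgB u ((hmemB f u).1 hu.2).2.1, if_neg hu.1, sub_zero]
        exact hf u hu.2
  exact key _ f rfl h fun σ hσ => hf σ ((hmemB f σ).1 hσ).1 ((hmemB f σ).1 hσ).2.1
    ((hmemB f σ).1 hσ).2.2

open scoped Classical in
-- Take a descent `i` of `σ⁻¹` and write `σ = w⁻¹ d⁻¹` with `w ∈ W_{L ∪ {i}}` and `d` minimal. If
-- both factors are nontrivial, they match suitable Levi types and are shorter. If `d = 1`, then `σ`
-- swaps adjacent blocks and is found by subtraction from a merge followed by a split.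
theorem HasSplitsMerges.mem_TT (hq : q ≠ 0) (hS : H.HasSplitsMerges S)
    {σ : Equiv.Perm (Fin (m + 1))} (h : Matches σ L L') : Mem S L L' (H.TT σ * H.vee L') := by
  induction hn : invCount σ using Nat.strong_induction_on generalizing σ L L' with
  | _ n ih =>
    by_cases hσ : σ = 1
    · have hLL : L = L' := by
        subst hσ
        have hpp : ∀ i j : Fin m, Passes 1 i j → i = j :=
          fun i j hp => (Fin.castSucc_injective _ hp.1).symm
        ext i
        constructor
        · intro hi
          obtain ⟨j, hj, hp⟩ := h.2 i hi
          rwa [hpp i j hp]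
        · intro hj
          obtain ⟨j, hj, hp⟩ := h.1 i hj
          rwa [← hpp j i hp]
      subst hLL
      rw [hσ, H.TT_one, one_mul]
      exact hS.merge subset_rfl
    obtain ⟨i, hi⟩ := exists_descent (inv_ne_one.2 hσ)
    obtain ⟨d, w, hd, hw, hdw⟩ := exists_incOn_mul (insert i L) σ⁻¹
    have hσw : σ = w⁻¹ * d⁻¹ := by rw [← mul_inv_rev, ← hdw, inv_inv]
    have hd' : IncOn (insert i L) (d⁻¹)⁻¹ := by rwa [inv_inv]
    have hlen := invCount_mul_of_incOn_inv hd' (inv_mem hw)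
    rw [← hσw, hn] at hlen
    have hw1 : w ≠ 1 := by
      rintro rfl
      rw [mul_one] at hdw
      exact lt_asymm hi (hdw ▸ hd i (Finset.mem_insert_self i L))
    have hw0 : invCount w⁻¹ ≠ 0 := fun h0 => hw1 (inv_eq_one.1 (invCount_eq_zero.1 h0))
    by_cases hd1 : d = 1
    · have hσp : σ ∈ parabolic (insert i L) := by
        rw [hσw, hd1, inv_one, mul_one]; exact inv_mem hw
      have hL' : L' ⊆ insert i L := by
        intro j hj
        obtain ⟨a, ha, hp⟩ := h.1 j hj
        rw [← block_simple_iff, ← mem_parabolic.1 hσp, ← mem_parabolic.1 hσp j.succ, hp.1, hp.2]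
        exact block_simple_iff.2 (Finset.mem_insert_of_mem ha)
      -- Merge from `L'` to `L ∪ {i}`, then split to `L`. The image of `v_{L'}` is the sum of all
      -- `T_u v_{L'}` over minimal `u` in `W_{L ∪ {i}}`.
      have hfull : Mem S L L' (H.vee (insert i L)) := by
        have h1 : Mem S L (insert i L) (1 * H.vee (insert i L)) := by
          rw [one_mul]; exact hS.split (Finset.subset_insert i L)
        have h2 := h1.comp (hS.merge hL')
        rwa [one_mul] at h2
      -- These are the coefficients of the composite with the term at `σ` removed. Where nonzero
      -- they equal `1`, so the invariant multiplications are identities and only the shorter `T_u`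
      -- are needed.
      set f : Equiv.Perm (Fin (m + 1)) → Laurent k m := fun u =>
        if u ∈ parabolic (insert i L) ∧ u ≠ σ then 1 else 0 with hf
      have hz : H.homSum L' f = H.vee (insert i L) - H.TT σ * H.vee L' := by
        rw [← H.relSum_mul_vee hL', relSum, Finset.sum_mul, homSum, eq_sub_iff_add_eq,
          ← Finset.sum_erase_add _ _ (mem_relFinset.2 ⟨h.incOn, hσp⟩)]
        congr 1
        symm
        refine Finset.sum_subset_zero_on_sdiff ?_ ?_ ?_
        · exact (Finset.erase_subset _ _).trans (Finset.filter_subset _ _)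
        · intro u hu
          obtain ⟨h1, h2⟩ := Finset.mem_sdiff.1 hu
          simp only [hf]
          rw [if_neg, map_zero, zero_mul, mul_zero]
          rintro ⟨h3, h4⟩
          exact h2 (Finset.mem_erase.2 ⟨h4, mem_relFinset.2 ⟨mem_incFinset.1 h1, h3⟩⟩)
        · intro u hu
          obtain ⟨h1, h2⟩ := Finset.mem_erase.1 hu
          simp only [hf]
          rw [if_pos ⟨(mem_relFinset.1 h2).2, h1⟩, map_one, one_mul]
      have hmem : Mem S L L' (H.homSum L' f) := by
        refine hS.mem_homSum hq ?_ ?_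
        · intro a ha
          obtain ⟨j, hj, hp⟩ := h.2 a ha
          rw [hz, mul_sub, H.T_mul_vee (Finset.mem_insert_of_mem ha), ← mul_assoc,
            H.T_mul_TT_of_passes hp, mul_assoc, H.T_mul_vee hj, mul_smul_comm, smul_sub]
        · intro u hu _ hfu
          have hu' : u ∈ parabolic (insert i L) ∧ u ≠ σ := by
            by_contra hc
            exact hfu (if_neg hc)
          have hsub := inversions_subset_of_matches h hi hσp hu'.1 hu
          have hlt : invCount u < invCount σ :=
            Finset.card_lt_card (hsub.ssubset_of_ne fun he => hu'.2 (eq_of_inversions_eq he))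
          refine ⟨ih _ (hn ▸ hlt) matches_levi rfl, ?_⟩
          simp only [hf]
          rw [if_pos hu', map_one, one_mul]
          exact hS.merge subset_rfl
      have := hfull.sub hmem
      rwa [hz, sub_sub_cancel] at this
    · have hd0 : invCount d⁻¹ ≠ 0 := fun h0 => hd1 (inv_eq_one.1 (invCount_eq_zero.1 h0))
      -- A matching of `σ` factors through an intermediate reflection `b`: since `w` preserves the
      -- blocks of `L ∪ {i}`, the pair `(j, j+1)` lands in one block under `d⁻¹`, and there it must
      -- remain a pair of neighbours.
      have hpass : ∀ a ∈ L, ∀ j, Passes σ a j →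
          ∃ b ∈ insert i L, Passes d⁻¹ b j ∧ Passes w⁻¹ a b := by
        intro a ha j hp
        have e1 : d⁻¹ j.castSucc = w a.castSucc := by
          rw [← hp.1, hσw, Equiv.Perm.mul_apply, perm_apply_inv]
        have e2 : d⁻¹ j.succ = w a.succ := by
          rw [← hp.2, hσw, Equiv.Perm.mul_apply, perm_apply_inv]
        have hb : block (insert i L) (d⁻¹ j.castSucc) = block (insert i L) (d⁻¹ j.succ) := by
          rw [e1, e2, mem_parabolic.1 hw, mem_parabolic.1 hw]
          exact block_simple_iff.2 (Finset.mem_insert_of_mem ha)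
        have hlt : d⁻¹ j.castSucc < d⁻¹ j.succ := by
          rw [← hd.lt_iff hb, perm_apply_inv, perm_apply_inv]
          exact Fin.castSucc_lt_succ
        obtain ⟨b, hb, hpb⟩ := exists_passes_of_block_eq hd' hlt hb
        refine ⟨b, hb, hpb, ?_, ?_⟩
        · rw [← hpb.1, e1, perm_inv_apply]
        · rw [← hpb.2, e2, perm_inv_apply]
      have h1 : Matches d⁻¹ (leftLevi d⁻¹ (insert i L) L') L' := by
        refine ⟨fun j hj => ?_, fun b hb => (Finset.mem_filter.1 hb).2⟩
        obtain ⟨a, ha, hp⟩ := h.1 j hj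
        obtain ⟨b, hb, hp1, -⟩ := hpass a ha j hp
        exact ⟨b, Finset.mem_filter.2 ⟨hb, j, hj, hp1⟩, hp1⟩
      have h2 : Matches w⁻¹ L (leftLevi d⁻¹ (insert i L) L') := by
        constructor
        · intro b hb
          obtain ⟨hb, j, hj, hp⟩ := Finset.mem_filter.1 hb
          obtain ⟨a, ha, hpa⟩ := h.1 j hj
          obtain ⟨b', hb', hp1, hp2⟩ := hpass a ha j hpa
          have hbb : b = b' := Fin.castSucc_injective _ (hp.1.symm.trans hp1.1)
          exact ⟨a, ha, hbb ▸ hp2⟩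
        · intro a ha
          obtain ⟨j, hj, hp⟩ := h.2 a ha
          obtain ⟨b, hb, hp1, hp2⟩ := hpass a ha j hp
          exact ⟨b, Finset.mem_filter.2 ⟨hb, j, hj, hp1⟩, hp2⟩
      have hcomp := (ih _ (by omega) h2 rfl).comp (ih _ (by omega) h1 rfl)
      rwa [← mul_assoc, ← H.TT_mul_of_incOn_inv hd' (inv_mem hw), ← hσw] at hcomp

theorem HasSplitsMerges.eq_top (hq : q ≠ 0) (hS : H.HasSplitsMerges S)
    (hI : ∀ (L : Finset (Fin m)) (f : Laurent k m),
      (∀ j ∈ L, permLaurent k (simplePerm j) f = f) → Mem S L L (H.lau f * H.vee L)) : S = ⊤ := by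
  classical
  refine eq_top_of_mem fun K J z hz ht => ?_
  obtain ⟨f, rfl⟩ := H.exists_homSum hq (J := J) (z := z) fun j hj => ht _ _ (H.vee_mul_T hj)
  have hK : ∀ i ∈ K, H.T i * H.homSum J f = q • H.homSum J f := by
    intro i hi
    obtain ⟨y, hy⟩ := mem_cyc.1 hz
    rw [hy, ← mul_assoc, H.T_mul_vee hi, smul_mul_assoc]
  refine hS.mem_homSum hq hK fun σ h1 _ _ => ⟨hS.mem_TT hq matches_levi, hI _ _ fun j hj => ?_⟩
  obtain ⟨hj, i, hi, hp⟩ := Finset.mem_filter.1 hj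
  exact (H.homSum_invariance hq (hK i hi) h1).1 j hj hp

end HeckeModel

/-! ### Dominant exponents, orbit sums and the norm filtration. -/

section Orbits

variable {k : Type*} [Field k] {m : ℕ} {J : Finset (Fin m)}

theorem isDominant_iff {a : Fin (m + 1) → ℤ} :
    IsDominant J a ↔ ∀ j ∈ J, a j.succ ≤ a j.castSucc := by
  constructor
  · exact fun h j hj => h _ _ Fin.castSucc_lt_succ.le
      ⟨simplePerm j, simplePerm_mem_parabolic hj, simplePerm_castSucc j⟩
  · rintro h i j hij ⟨σ, hσ, rfl⟩
    exact block_induction (R := fun x y => a y ≤ a x) (fun _ => le_rfl)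
      (fun x i hi _ hx => (h i hi).trans hx) _ _ hij (mem_parabolic.1 hσ i).symm

theorem IsDominant.le {a : Fin (m + 1) → ℤ} (h : IsDominant J a) {x y : Fin (m + 1)} (hxy : x ≤ y)
    (hb : block J x = block J y) : a y ≤ a x :=
  block_induction (R := fun x y => a y ≤ a x) (fun _ => le_rfl)
    (fun _ i hi _ hx => (isDominant_iff.1 h i hi).trans hx) _ _ hxy hb

theorem mem_orbitFinset {a b : Fin (m + 1) → ℤ} :
    b ∈ orbitFinset J a ↔ ∃ w ∈ parabolic J, permExp w a = b := by
  classical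
  rw [orbitFinset, Finset.mem_image]
  simp only [mem_parabolicFinset]
  exact Iff.rfl

theorem exists_isDominant (J : Finset (Fin m)) (a : Fin (m + 1) → ℤ) :
    ∃ w ∈ parabolic J, IsDominant J (permExp w a) := by
  classical
  -- Minimising `∑ x · a_x` over the orbit works because exchanging the entries `j` and `j+1`
  -- changes the sum by `a_j - a_{j+1}`, which must then be nonnegative.
  obtain ⟨w, hw, hmin⟩ := Finset.exists_min_image (parabolicFinset J)
    (fun w => ∑ x : Fin (m + 1), (x : ℤ) * permExp w a x) ⟨1, mem_parabolicFinset.2 (one_mem _)⟩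
  rw [mem_parabolicFinset] at hw
  refine ⟨w, hw, isDominant_iff.2 fun j hj => ?_⟩
  have h1 := hmin (simplePerm j * w)
    (mem_parabolicFinset.2 (mul_mem (simplePerm_mem_parabolic hj) hw))
  have h2 : ∑ x : Fin (m + 1), (x : ℤ) * permExp (simplePerm j * w) a x =
      ∑ x : Fin (m + 1), (simplePerm j x : ℤ) * permExp w a x := by
    rw [← Equiv.sum_comp (simplePerm j) (fun x => (x : ℤ) * permExp (simplePerm j * w) a x)]
    refine Finset.sum_congr rfl fun x _ => ?_
    rw [permExp_mul, permExp_apply (simplePerm j), perm_inv_apply]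
  have h3 : ∑ x : Fin (m + 1), ((simplePerm j x : ℤ) * permExp w a x - (x : ℤ) * permExp w a x) =
      permExp w a j.castSucc - permExp w a j.succ := by
    rw [Fintype.sum_eq_add j.castSucc j.succ (Fin.castSucc_lt_succ).ne]
    · rw [simplePerm_castSucc, simplePerm_succ]
      simp only [Fin.val_succ, Fin.val_castSucc]
      push_cast
      ring
    · rintro x ⟨h1, h2⟩
      rw [simplePerm_of_ne j h1 h2, sub_self]
  rw [Finset.sum_sub_distrib, ← h2] at h3
  linarith

theorem coeff_mono (a b : Fin (m + 1) → ℤ) [Decidable (a = b)] :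
    (mono a : Laurent k m).coeff b = if a = b then 1 else 0 := by
  classical
  rw [mono, AddMonoidAlgebra.coeff_single, Finsupp.single_apply]

theorem coeff_permLaurent (σ : Equiv.Perm (Fin (m + 1))) (f : Laurent k m)
    (a : Fin (m + 1) → ℤ) : (permLaurent k σ f).coeff (permExp σ a) = f.coeff a := by
  classical
  induction f using laurent_induction with
  | add f g hf hg => simp [map_add, hf, hg]
  | smul c f hf => simp [map_smul, hf]
  | mono b => simp only [permLaurent_mono, coeff_mono, (permExp σ).injective.eq_iff]

theorem permLaurent_eq_of_mem {f : Laurent k m}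
    (h : ∀ j ∈ J, permLaurent k (simplePerm j) f = f) {w : Equiv.Perm (Fin (m + 1))}
    (hw : w ∈ parabolic J) : permLaurent k w f = f := by
  refine parabolic_induction (motive := fun w => permLaurent k w f = f) (permLaurent_one k f)
    (fun w _ i hi _ ih => ?_) w hw
  rw [permLaurent_mul, h i hi, ih]

variable (k) in
/-- The sum of the monomials in an orbit of a parabolic subgroup. -/
def orbitSum (J : Finset (Fin m)) (a : Fin (m + 1) → ℤ) : Laurent k m :=
  ∑ b ∈ orbitFinset J a, mono b

theorem permLaurent_orbitSum (a : Fin (m + 1) → ℤ) {w : Equiv.Perm (Fin (m + 1))}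
    (hw : w ∈ parabolic J) : permLaurent k w (orbitSum k J a) = orbitSum k J a := by
  rw [orbitSum, map_sum]
  refine Finset.sum_bij' (fun b _ => permExp w b) (fun b _ => permExp w⁻¹ b) ?_ ?_ ?_ ?_ ?_
  · intro b hb
    obtain ⟨u, hu, rfl⟩ := mem_orbitFinset.1 hb
    exact mem_orbitFinset.2 ⟨w * u, mul_mem hw hu, permExp_mul w u a⟩
  · intro b hb
    obtain ⟨u, hu, rfl⟩ := mem_orbitFinset.1 hb
    exact mem_orbitFinset.2 ⟨w⁻¹ * u, mul_mem (inv_mem hw) hu, permExp_mul w⁻¹ u a⟩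
  · intro b _
    rw [← permExp_mul, inv_mul_cancel, permExp_one]
  · intro b _
    rw [← permExp_mul, mul_inv_cancel, permExp_one]
  · intro b _
    rw [permLaurent_mono]

open scoped Classical in
theorem coeff_orbitSum (a b : Fin (m + 1) → ℤ) :
    (orbitSum k J a).coeff b = if b ∈ orbitFinset J a then 1 else 0 := by
  rw [orbitSum, AddMonoidAlgebra.coeff_sum, Finsupp.finsetSum_apply]
  simp only [coeff_mono]
  rw [Finset.sum_ite_eq' (orbitFinset J a) b (fun _ => (1 : k))]

/-- Coefficients of an invariant polynomial are constant on orbits, so subtracting a multiple of an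
orbit sum removes one orbit from the support. The predicate `P` records a condition on the support,
such as a norm bound, that passes to the orbit sums used. -/
theorem mem_span_orbitSum {P : (Fin (m + 1) → ℤ) → Prop} {f : Laurent k m}
    (h : ∀ j ∈ J, permLaurent k (simplePerm j) f = f) (hP : ∀ a, f.coeff a ≠ 0 → P a) :
    f ∈ Submodule.span k (orbitSum k J '' {a | IsDominant J a ∧ P a}) := by
  classical
  induction hn : f.coeff.support.card using Nat.strong_induction_on generalizing f with
  | _ n ih =>
    by_cases hf : f.coeff.support = ∅
    · have : f = 0 := by
        apply AddMonoidAlgebra.coeff_injective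
        rw [Finsupp.support_eq_empty.1 hf]; rfl
      rw [this]
      exact zero_mem _
    obtain ⟨a₀, ha₀⟩ := Finset.nonempty_iff_ne_empty.2 hf
    obtain ⟨w, hw, hdom⟩ := exists_isDominant J a₀
    set a := permExp w a₀ with ha
    have horb : ∀ b ∈ orbitFinset J a, f.coeff b = f.coeff a := by
      intro b hb
      obtain ⟨u, hu, rfl⟩ := mem_orbitFinset.1 hb
      conv_lhs => rw [← permLaurent_eq_of_mem h hu]
      rw [coeff_permLaurent]
    have haa : a ∈ orbitFinset J a := mem_orbitFinset.2 ⟨1, one_mem _, permExp_one a⟩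
    have ha₀' : a₀ ∈ orbitFinset J a := mem_orbitFinset.2
      ⟨w⁻¹, inv_mem hw, by rw [ha, ← permExp_mul, inv_mul_cancel, permExp_one]⟩
    have hne : f.coeff a ≠ 0 := by
      rw [← horb a₀ ha₀']; exact Finsupp.mem_support_iff.1 ha₀
    set g := f - f.coeff a • orbitSum k J a with hg
    have hgc : ∀ b, g.coeff b = if b ∈ orbitFinset J a then 0 else f.coeff b := by
      intro b
      rw [hg, AddMonoidAlgebra.coeff_sub, AddMonoidAlgebra.coeff_smul, Finsupp.sub_apply,
        Finsupp.smul_apply, coeff_orbitSum]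
      split_ifs with hb
      · rw [horb b hb, smul_eq_mul, mul_one, sub_self]
      · rw [smul_zero, sub_zero]
    have hsub : ∀ b, g.coeff b ≠ 0 → f.coeff b ≠ 0 := by
      intro b hb
      rw [hgc] at hb
      split_ifs at hb with h1
      · exact absurd rfl hb
      · exact hb
    have hginv : ∀ j ∈ J, permLaurent k (simplePerm j) g = g := by
      intro j hj
      rw [hg, map_sub, map_smul, h j hj, permLaurent_orbitSum _ (simplePerm_mem_parabolic hj)]
    have hlt : g.coeff.support.card < n := by
      rw [← hn]
      refine Finset.card_lt_card (Finset.ssubset_iff_subset_ne.2 ⟨fun b hb => ?_, fun he => ?_⟩)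
      · exact Finsupp.mem_support_iff.2 (hsub b (Finsupp.mem_support_iff.1 hb))
      · have h1 : a ∈ g.coeff.support := he ▸ Finsupp.mem_support_iff.2 hne
        rw [Finsupp.mem_support_iff, hgc, if_pos haa] at h1
        exact h1 rfl
    have h2 := ih _ hlt hginv (fun b hb => hP b (hsub b hb)) rfl
    have h3 := add_mem h2 (Submodule.smul_mem _ (f.coeff a)
      (Submodule.subset_span ⟨a, ⟨hdom, hP a hne⟩, rfl⟩))
    rwa [hg, sub_add_cancel] at h3

theorem permExp_simplePerm_eq {a : Fin (m + 1) → ℤ} {i : Fin m} (h : a i.castSucc = a i.succ) :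
    permExp (simplePerm i) a = a := by
  funext x
  rw [permExp_apply, simplePerm_inv]
  by_cases h1 : x = i.castSucc
  · rw [h1, simplePerm_castSucc, h]
  by_cases h2 : x = i.succ
  · rw [h2, simplePerm_succ, h]
  rw [simplePerm_of_ne i h1 h2]

theorem permExp_eq_self {a : Fin (m + 1) → ℤ} (h : ∀ j ∈ J, a j.castSucc = a j.succ)
    {w : Equiv.Perm (Fin (m + 1))} (hw : w ∈ parabolic J) : permExp w a = a := by
  refine parabolic_induction (motive := fun w => permExp w a = a) (permExp_one a)
    (fun w _ i hi _ ih => ?_) w hw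
  rw [permExp_mul, permExp_simplePerm_eq (h i hi), ih]

/-- The squared Euclidean norm of an exponent vector. -/
def sqNorm (a : Fin (m + 1) → ℤ) : ℕ := ∑ x, (a x).natAbs ^ 2

theorem sqNorm_cast (a : Fin (m + 1) → ℤ) : (sqNorm a : ℤ) = ∑ x, a x ^ 2 := by
  rw [sqNorm]
  push_cast
  simp only [sq_abs]

theorem sqNorm_permExp (σ : Equiv.Perm (Fin (m + 1))) (a : Fin (m + 1) → ℤ) :
    sqNorm (permExp σ a) = sqNorm a := by
  rw [sqNorm, sqNorm]
  exact Equiv.sum_comp σ⁻¹ (fun x => (a x).natAbs ^ 2)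

theorem sqNorm_add_single (a : Fin (m + 1) → ℤ) (i : Fin (m + 1)) (t : ℤ) :
    (sqNorm (a + Pi.single i t) : ℤ) = sqNorm a + 2 * t * a i + t ^ 2 := by
  rw [sqNorm_cast, sqNorm_cast, ← sub_eq_zero]
  have h : ∑ x, ((a + Pi.single i t : Fin (m + 1) → ℤ) x ^ 2 - a x ^ 2) = 2 * t * a i + t ^ 2 := by
    rw [Finset.sum_eq_single i]
    · rw [Pi.add_apply, Pi.single_eq_same]; ring
    · intro x _ hx
      rw [Pi.add_apply, Pi.single_eq_of_ne hx]; ring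
    · simp
  rw [Finset.sum_sub_distrib] at h
  linarith

variable (k m) in
/-- The span of the monomials of squared norm less than `N`. -/
def lowNorm (N : ℕ) : Submodule k (Laurent k m) :=
  Submodule.span k (mono '' {a | sqNorm a < N})

theorem mono_mem_lowNorm {a : Fin (m + 1) → ℤ} {N : ℕ} (h : sqNorm a < N) :
    mono a ∈ lowNorm k m N := Submodule.subset_span ⟨a, h, rfl⟩

theorem sqNorm_lt_of_mem_lowNorm {N : ℕ} {f : Laurent k m} (hf : f ∈ lowNorm k m N) :
    ∀ a, f.coeff a ≠ 0 → sqNorm a < N := by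
  classical
  induction hf using Submodule.span_induction with
  | mem f hf =>
    obtain ⟨b, hb, rfl⟩ := hf
    intro a ha
    rw [coeff_mono] at ha
    split_ifs at ha with h
    · exact h ▸ hb
    · exact absurd rfl ha
  | zero => intro a ha; exact absurd rfl ha
  | add f g _ _ hf hg =>
    intro a ha
    by_cases h : f.coeff a = 0
    · refine hg a fun h' => ha ?_
      rw [AddMonoidAlgebra.coeff_add, Finsupp.add_apply, h, h', add_zero]
    · exact hf a h
  | smul c f _ hf =>
    intro a ha
    refine hf a fun h => ha ?_
    rw [AddMonoidAlgebra.coeff_smul, Finsupp.smul_apply, h, smul_zero]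

theorem lowNorm_mono {M N : ℕ} (h : M ≤ N) : lowNorm k m M ≤ lowNorm k m N :=
  Submodule.span_mono (Set.image_mono fun _ ha => lt_of_lt_of_le ha h)

theorem mem_lowNorm_of_coeff {N : ℕ} {f : Laurent k m} (h : ∀ a, f.coeff a ≠ 0 → sqNorm a < N) :
    f ∈ lowNorm k m N := by
  -- For `J = ∅` invariance is void, so this is just the expansion into monomials.
  have h1 := mem_span_orbitSum (J := ∅) (f := f) (by simp) h
  refine Submodule.span_le.2 ?_ h1
  rintro _ ⟨a, ⟨-, ha⟩, rfl⟩
  refine sum_mem fun b hb => ?_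
  obtain ⟨w, -, rfl⟩ := mem_orbitFinset.1 hb
  exact mono_mem_lowNorm (by rwa [sqNorm_permExp])

/-- The exponent vectors on the segment between `a` and `s_i a`. -/
def segExp (a : Fin (m + 1) → ℤ) (i : Fin m) (c t : ℕ) : Fin (m + 1) → ℤ :=
  a + Pi.single i.castSucc (t : ℤ) + Pi.single i.succ ((c : ℤ) - t)

/-- The norm is convex along the segment from `a + c e_{i+1}` to `a + c e_i`: it is greatest at the
two ends, which are exchanged by `s_i`, and strictly smaller at interior points. -/
theorem sqNorm_segExp {a : Fin (m + 1) → ℤ} {i : Fin m} (ha : a i.castSucc = a i.succ) (c t : ℕ) :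
    (sqNorm (segExp a i c t) : ℤ) = sqNorm a + 2 * c * a i.succ + t ^ 2 + (c - t) ^ 2 := by
  rw [segExp, sqNorm_add_single, sqNorm_add_single, Pi.add_apply,
    Pi.single_eq_of_ne (Fin.castSucc_lt_succ).ne', ha]
  ring

theorem mono_segExp (a : Fin (m + 1) → ℤ) (i : Fin m) {c t : ℕ} (h : t ≤ c) :
    (mono (segExp a i c t) : Laurent k m) =
      mono a * (var k i.castSucc ^ t * var k i.succ ^ (c - t)) := by
  have hpow : ∀ (j : Fin (m + 1)) (n : ℕ), (mono (Pi.single j (n : ℤ)) : Laurent k m) =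
      var k j ^ n := by
    intro j n
    induction n with
    | zero => rw [Nat.cast_zero, Pi.single_zero, mono_zero, pow_zero]
    | succ n ih =>
      rw [pow_succ, ← ih, var, ← mono_add, ← Pi.single_add]
      push_cast; rfl
  rw [segExp, mono_add, mono_add, hpow, ← Nat.cast_sub h, hpow, mul_assoc]

theorem permExp_segExp {a : Fin (m + 1) → ℤ} {i : Fin m} (ha : a i.castSucc = a i.succ)
    {c t : ℕ} (h : t ≤ c) :
    permExp (simplePerm i) (segExp a i c t) = segExp a i c (c - t) := by
  rw [segExp, map_add, map_add, permExp_simplePerm_eq ha, permExp_single, permExp_single, simplePerm_castSucc,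
    simplePerm_succ, segExp, add_right_comm, Nat.cast_sub h, sub_sub_cancel]

theorem exists_segExp (a : Fin (m + 1) → ℤ) (i : Fin m) :
    ∃ b c, b i.castSucc = b i.succ ∧ (a = segExp b i c c ∧ (a i.succ < a i.castSucc → 0 < c) ∨
      a = segExp b i c 0 ∧ a i.castSucc ≤ a i.succ) := by
  have hne : i.castSucc ≠ i.succ := (Fin.castSucc_lt_succ).ne
  rcases le_total (a i.succ) (a i.castSucc) with h | h
  · refine ⟨a - Pi.single i.castSucc (a i.castSucc - a i.succ), (a i.castSucc - a i.succ).toNat,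
      ?_, Or.inl ⟨?_, fun h => by omega⟩⟩
    · rw [Pi.sub_apply, Pi.sub_apply, Pi.single_eq_same, Pi.single_eq_of_ne hne.symm]; ring
    · rw [segExp, sub_self, Pi.single_zero, add_zero, Int.toNat_of_nonneg (by omega),
        sub_add_cancel]
  · refine ⟨a - Pi.single i.succ (a i.succ - a i.castSucc), (a i.succ - a i.castSucc).toNat,
      ?_, Or.inr ⟨?_, h⟩⟩
    · rw [Pi.sub_apply, Pi.sub_apply, Pi.single_eq_same, Pi.single_eq_of_ne hne]; ring
    · rw [segExp, Nat.cast_zero, Pi.single_zero, add_zero, sub_zero,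
        Int.toNat_of_nonneg (by omega), sub_add_cancel]

/-- A geometric sum, giving the explicit correction term of the Bernstein relation for a monomial.
-/
theorem seg_bernstein (a : Fin (m + 1) → ℤ) (i : Fin m) (c : ℕ) :
    (var k i.succ - var k i.castSucc) * ∑ t ∈ Finset.range c, (mono (segExp a i c t) : Laurent k m)
      = var k i.succ * (mono (segExp a i c 0) - mono (segExp a i c c)) := by
  have h1 : ∑ t ∈ Finset.range c, (mono (segExp a i c t) : Laurent k m) =
      mono a * var k i.succ *
        ∑ t ∈ Finset.range c, var k i.castSucc ^ t * var k i.succ ^ (c - 1 - t) := by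
    rw [Finset.mul_sum]
    refine Finset.sum_congr rfl fun t ht => ?_
    have ht := Finset.mem_range.1 ht
    rw [mono_segExp a i ht.le, show c - t = c - 1 - t + 1 by omega, pow_succ]
    ring
  have h2 := (Commute.all (var k i.castSucc) (var k i.succ)).geom_sum₂_mul c
  rw [h1, mono_segExp a i le_rfl, mono_segExp a i c.zero_le, Nat.sub_self, Nat.sub_zero, pow_zero,
    pow_zero, one_mul, mul_one]
  linear_combination (-(mono a * var k i.succ : Laurent k m)) * h2

end Orbits

/-! ### Orbit sums from monomials, by triangularity. -/

namespace HeckeModel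

variable {k : Type*} [Field k] {q : k} {m : ℕ} {A : Type*} [Ring A] [Algebra k A]
  (H : HeckeModel q m A) {J K L L' : Finset (Fin m)}

theorem T_mul_lau_mul_vee (hq : q ≠ 0) {i : Fin m} (hi : i ∈ J) {f δ : Laurent k m}
    (h : (var k i.succ - var k i.castSucc) * δ =
      var k i.succ * (f - permLaurent k (simplePerm i) f)) :
    H.T i * (H.lau f * H.vee J) =
      H.lau (q • permLaurent k (simplePerm i) f + (q - 1) • δ) * H.vee J := by
  obtain ⟨ε, h1, h2⟩ := H.exists_isBernstein hq i f
  have hne : var k i.succ - var k i.castSucc ≠ 0 :=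
    sub_ne_zero.2 (var_injective.ne (Fin.castSucc_lt_succ).ne')
  rw [mul_left_cancel₀ hne (h.trans h2.symm), ← mul_assoc, h1, add_mul, mul_assoc, H.T_mul_vee hi,
    map_add, map_smul, map_smul, add_mul, mul_smul_comm, smul_mul_assoc, smul_mul_assoc]

theorem T_mul_segExp (hq : q ≠ 0) {i : Fin m} (hi : i ∈ J) {a : Fin (m + 1) → ℤ}
    (ha : a i.castSucc = a i.succ) (c : ℕ) :
    H.T i * (H.lau (mono (segExp a i c c)) * H.vee J) =
      H.lau (q • mono (segExp a i c 0) +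
        (q - 1) • -∑ t ∈ Finset.range c, mono (segExp a i c t)) * H.vee J ∧
    H.T i * (H.lau (mono (segExp a i c 0)) * H.vee J) =
      H.lau (q • mono (segExp a i c c) +
        (q - 1) • ∑ t ∈ Finset.range c, mono (segExp a i c t)) * H.vee J := by
  have e1 : permExp (simplePerm i) (segExp a i c c) = segExp a i c 0 := by
    rw [permExp_segExp ha le_rfl, Nat.sub_self]
  have e2 : permExp (simplePerm i) (segExp a i c 0) = segExp a i c c := by
    rw [permExp_segExp ha c.zero_le, Nat.sub_zero]
  constructor
  · have h := H.T_mul_lau_mul_vee hq hi (f := mono (segExp a i c c))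
      (δ := -∑ t ∈ Finset.range c, mono (segExp a i c t)) (by
        rw [permLaurent_mono, e1, mul_neg, seg_bernstein]; ring)
    rwa [permLaurent_mono, e1] at h
  · have h := H.T_mul_lau_mul_vee hq hi (f := mono (segExp a i c 0))
      (δ := ∑ t ∈ Finset.range c, mono (segExp a i c t)) (by
        rw [permLaurent_mono, e2, seg_bernstein])
    rwa [permLaurent_mono, e2] at h

/-- All monomials occurring in `T_i X^a v_J` lie on the segment between `a` and `s_i a`, hence have
norm at most that of `a`. -/
theorem exists_T_mul_lowNorm (hq : q ≠ 0) {i : Fin m} (hi : i ∈ J) {N : ℕ} {f : Laurent k m}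
    (hf : f ∈ lowNorm k m N) :
    ∃ g ∈ lowNorm k m N, H.T i * (H.lau f * H.vee J) = H.lau g * H.vee J := by
  induction hf using Submodule.span_induction with
  | mem f hf =>
    obtain ⟨a, ha, rfl⟩ := hf
    have ha : sqNorm a < N := ha
    obtain ⟨b, c, hb, hc⟩ := exists_segExp a i
    have hle : ∀ t ≤ c, sqNorm (segExp b i c t) < N := by
      intro t ht
      have h1 := sqNorm_segExp hb c t
      have h2 : (sqNorm a : ℤ) = sqNorm b + 2 * c * b i.succ + c ^ 2 := by
        rcases hc with ⟨h, -⟩ | ⟨h, -⟩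
        · rw [h, sqNorm_segExp hb]; ring
        · rw [h, sqNorm_segExp hb]; push_cast; ring
      have h3 : (t : ℤ) ≤ c := by exact_mod_cast ht
      have h4 : (0 : ℤ) ≤ t := by positivity
      zify at ha ⊢
      nlinarith [mul_nonneg h4 (sub_nonneg.2 h3)]
    have hmem : ∀ t ≤ c, mono (segExp b i c t) ∈ lowNorm k m N := fun t ht =>
      mono_mem_lowNorm (hle t ht)
    have hsum : ∑ t ∈ Finset.range c, mono (segExp b i c t) ∈ lowNorm k m N :=
      sum_mem fun t ht => hmem t (Finset.mem_range.1 ht).le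
    rcases hc with ⟨h, -⟩ | ⟨h, -⟩
    · exact ⟨_, add_mem (Submodule.smul_mem _ _ (hmem 0 c.zero_le))
        (Submodule.smul_mem _ _ (neg_mem hsum)), h ▸ (H.T_mul_segExp hq hi hb c).1⟩
    · exact ⟨_, add_mem (Submodule.smul_mem _ _ (hmem c le_rfl))
        (Submodule.smul_mem _ _ hsum), h ▸ (H.T_mul_segExp hq hi hb c).2⟩
  | zero => exact ⟨0, zero_mem _, by rw [map_zero, zero_mul, mul_zero]⟩
  | add f g _ _ hf hg =>
    obtain ⟨f', hf', ef⟩ := hf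
    obtain ⟨g', hg', eg⟩ := hg
    exact ⟨f' + g', add_mem hf' hg', by rw [map_add, add_mul, mul_add, ef, eg, map_add, add_mul]⟩
  | smul c f _ hf =>
    obtain ⟨f', hf', ef⟩ := hf
    exact ⟨c • f', Submodule.smul_mem _ _ hf', by
      rw [map_smul, smul_mul_assoc, mul_smul_comm, ef, map_smul, smul_mul_assoc]⟩

theorem exists_T_mul_mono (hq : q ≠ 0) {i : Fin m} (hi : i ∈ J) {a : Fin (m + 1) → ℤ}
    (ha : a i.succ < a i.castSucc) : ∃ g ∈ lowNorm k m (sqNorm a),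
      H.T i * (H.lau (mono a) * H.vee J) =
        H.lau (mono (permExp (simplePerm i) a) + g) * H.vee J := by
  obtain ⟨b, c, hb, hc⟩ := exists_segExp a i
  obtain ⟨h, hpos⟩ := hc.resolve_right fun h => absurd h.2 (not_le.2 ha)
  have hpos := hpos ha
  obtain ⟨c, rfl⟩ := Nat.exists_eq_succ_of_ne_zero hpos.ne'
  -- The term `t = 0` of the correction is `X^{s_i a}` itself, so its total coefficient is `q - (q -
  -- 1) = 1`. The remaining terms are interior points of the segment and have strictly smaller norm.
  refine ⟨-((q - 1) • ∑ t ∈ Finset.range c, mono (segExp b i (c + 1) (t + 1))),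
    neg_mem (Submodule.smul_mem _ _ (sum_mem fun t ht => mono_mem_lowNorm ?_)), ?_⟩
  · have ht := Finset.mem_range.1 ht
    zify at ht ⊢
    rw [h, sqNorm_segExp hb, sqNorm_segExp hb]
    push_cast
    nlinarith
  · rw [h, (H.T_mul_segExp hq hi hb (c + 1)).1, permExp_segExp hb le_rfl, Nat.sub_self,
      Finset.sum_range_succ']
    congr 2
    module

/-- The reflections in `J` that fix an exponent vector. -/
def fixedSimple (J : Finset (Fin m)) (a : Fin (m + 1) → ℤ) : Finset (Fin m) :=
  J.filter fun i => a i.castSucc = a i.succ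

theorem block_fixedSimple {a : Fin (m + 1) → ℤ} (ha : IsDominant J a) {x y : Fin (m + 1)}
    (hxy : x ≤ y) (hb : block J x = block J y) (he : a x = a y) :
    block (fixedSimple J a) x = block (fixedSimple J a) y := by
  refine (block_eq_iff hxy).2 fun i h1 h2 => ?_
  have hi := (block_eq_iff hxy).1 hb i h1 h2
  have h2' := Fin.castSucc_lt_iff_succ_le.1 h2
  have h3 : block J x = block J i.castSucc :=
    (block_eq_iff h1).2 fun j h4 h5 => (block_eq_iff hxy).1 hb j h4 (h5.trans h2)
  have h6 : block J i.succ = block J y :=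
    (block_eq_iff h2').2 fun j h4 h5 =>
      (block_eq_iff hxy).1 hb j (h1.trans (Fin.castSucc_lt_succ.le.trans h4)) h5
  have h7 := ha.le h1 h3
  have h8 := ha.le h2' h6
  have h9 := isDominant_iff.1 ha i hi
  exact Finset.mem_filter.2 ⟨hi, by omega⟩

/-- Peel reflections off `d` from the left. Minimality of `d` modulo the stabiliser of `a` ensures
that at each step the reflected exponent is strictly decreasing at the relevant pair, so the leading
coefficient stays `1`. -/
theorem exists_TT_mul_mono (hq : q ≠ 0) {a : Fin (m + 1) → ℤ} (ha : IsDominant J a)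
    {d : Equiv.Perm (Fin (m + 1))} (hd : d ∈ parabolic J) (hL : IncOn (fixedSimple J a) d) :
    ∃ g ∈ lowNorm k m (sqNorm a),
      H.TT d * (H.lau (mono a) * H.vee J) = H.lau (mono (permExp d a) + g) * H.vee J := by
  induction hn : invCount d using Nat.strong_induction_on generalizing d with
  | _ n ih =>
    by_cases hd1 : d = 1
    · exact ⟨0, zero_mem _, by rw [hd1, H.TT_one, one_mul, permExp_one, add_zero]⟩
    obtain ⟨i, hi⟩ := exists_descent (inv_ne_one.2 hd1)
    have hiJ := mem_of_descent (inv_mem hd) hi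
    have hdL : IncOn (fixedSimple J a) (simplePerm i * d) := by
      refine (incOn_simple_mul_or hL i).resolve_right ?_
      rintro ⟨j, -, h1, h2⟩
      rw [← h1, ← h2, perm_inv_apply, perm_inv_apply] at hi
      exact lt_asymm hi Fin.castSucc_lt_succ
    have hlen := invCount_simple_mul_of_gt hi
    have hdJ := mul_mem (simplePerm_mem_parabolic hiJ) hd
    obtain ⟨g, hg, he⟩ := ih _ (by omega) hdJ hdL rfl
    have hinv1 : (simplePerm i * d)⁻¹ i.castSucc = d⁻¹ i.succ := by
      rw [mul_inv_rev, simplePerm_inv, Equiv.Perm.mul_apply, simplePerm_castSucc]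
    have hinv2 : (simplePerm i * d)⁻¹ i.succ = d⁻¹ i.castSucc := by
      rw [mul_inv_rev, simplePerm_inv, Equiv.Perm.mul_apply, simplePerm_succ]
    have hb : block J (d⁻¹ i.succ) = block J (d⁻¹ i.castSucc) := by
      rw [mem_parabolic.1 (inv_mem hd), mem_parabolic.1 (inv_mem hd)]
      exact (block_simple_iff.2 hiJ).symm
    have hlt : permExp (simplePerm i * d) a i.succ < permExp (simplePerm i * d) a i.castSucc := by
      rw [permExp_apply, permExp_apply, hinv1, hinv2]
      refine lt_of_le_of_ne (ha.le hi.le hb) fun h => ?_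
      have h1 := hL.lt hi (block_fixedSimple ha hi.le hb h.symm)
      rw [perm_apply_inv, perm_apply_inv] at h1
      exact lt_asymm h1 Fin.castSucc_lt_succ
    obtain ⟨g₁, hg₁, e₁⟩ := H.exists_T_mul_mono hq hiJ hlt
    obtain ⟨g₂, hg₂, e₂⟩ := H.exists_T_mul_lowNorm hq hiJ hg
    rw [sqNorm_permExp] at hg₁
    refine ⟨g₁ + g₂, add_mem hg₁ hg₂, ?_⟩
    have hT : H.TT d = H.T i * H.TT (simplePerm i * d) := by
      rw [H.T_mul_TT, simplePerm_mul_cancel]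
      rw [hinv1, hinv2]; exact hi
    rw [hT, mul_assoc, he, map_add, add_mul, mul_add, e₁, e₂, ← add_mul, ← map_add,
      ← permExp_mul, simplePerm_mul_cancel, add_assoc]

theorem mem_parabolic_fixedSimple {a : Fin (m + 1) → ℤ} (ha : IsDominant J a)
    {w : Equiv.Perm (Fin (m + 1))} (hw : w ∈ parabolic J) (h : permExp w a = a) :
    w ∈ parabolic (fixedSimple J a) := by
  rw [mem_parabolic]
  intro x
  have h1 : a x = a (w x) := by
    conv_rhs => rw [← h, permExp_apply, perm_inv_apply]
  have h2 := mem_parabolic.1 hw x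
  rcases le_total x (w x) with hle | hle
  · exact (block_fixedSimple ha hle h2.symm h1).symm
  · exact block_fixedSimple ha hle h2 h1.symm

theorem fixedSimple_subset (a : Fin (m + 1) → ℤ) : fixedSimple J a ⊆ J := Finset.filter_subset _ _

open scoped Classical in
-- The minimal representatives modulo the stabiliser of `a` enumerate the orbit of `a` without
-- repetition, so the leading terms add up to the orbit sum.
theorem exists_relSum_mul_mono (hq : q ≠ 0) {a : Fin (m + 1) → ℤ} (ha : IsDominant J a) :
    ∃ g ∈ lowNorm k m (sqNorm a), H.relSum (fixedSimple J a) J * (H.lau (mono a) * H.vee J) =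
      H.lau (orbitSum k J a + g) * H.vee J := by
  choose! g hg he using fun (d : Equiv.Perm (Fin (m + 1)))
    (hd : IncOn (fixedSimple J a) d ∧ d ∈ parabolic J) => H.exists_TT_mul_mono hq ha hd.2 hd.1
  refine ⟨∑ d ∈ (incFinset (fixedSimple J a)).filter (· ∈ parabolic J), g d,
    sum_mem fun d hd => hg d (mem_relFinset.1 hd), ?_⟩
  have horb : orbitSum k J a =
      ∑ d ∈ (incFinset (fixedSimple J a)).filter (· ∈ parabolic J), mono (permExp d a) := by
    rw [orbitSum]
    symm
    refine Finset.sum_bij (fun d _ => permExp d a) ?_ ?_ ?_ (fun _ _ => rfl)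
    · exact fun d hd => mem_orbitFinset.2 ⟨d, (mem_relFinset.1 hd).2, rfl⟩
    · intro d hd d' hd' h
      rw [mem_relFinset] at hd hd'
      have h1 : permExp (d⁻¹ * d') a = a := by
        rw [permExp_mul, ← h, ← permExp_mul, inv_mul_cancel, permExp_one]
      have h2 := mem_parabolic_fixedSimple ha (mul_mem (inv_mem hd.2) hd'.2) h1
      have h3 := hd.1.eq_one_of_mul h2 (by rw [mul_inv_cancel_left]; exact hd'.1)
      exact inv_mul_eq_one.1 h3
    · intro b hb
      obtain ⟨u, hu, rfl⟩ := mem_orbitFinset.1 hb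
      obtain ⟨d, w, hd, hw, rfl⟩ := exists_incOn_mul (fixedSimple J a) u
      refine ⟨d, mem_relFinset.2 ⟨hd, ?_⟩, ?_⟩
      · exact (Subgroup.mul_mem_cancel_right _ (parabolic_mono (fixedSimple_subset a) hw)).1 hu
      · rw [permExp_mul, permExp_eq_self (fun j hj => (Finset.mem_filter.1 hj).2) hw]
  rw [horb, ← Finset.sum_add_distrib, map_sum, Finset.sum_mul, relSum, Finset.sum_mul]
  exact Finset.sum_congr rfl fun d hd => he d (mem_relFinset.1 hd)

variable {H} {S : Subalgebra k (CycEnd H.vee)}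

theorem HasSplitsMerges.mem_of_monomials (hq : q ≠ 0) (hS : H.HasSplitsMerges S)
    (hM : ∀ (L : Finset (Fin m)) (a : Fin (m + 1) → ℤ),
      (∀ j ∈ L, a j.castSucc = a j.succ) → Mem S L L (H.lau (mono a) * H.vee L))
    {f : Laurent k m} (hf : ∀ j ∈ J, permLaurent k (simplePerm j) f = f) :
    Mem S J J (H.lau f * H.vee J) := by
  have key : ∀ N : ℕ, ∀ f ∈ lowNorm k m N, (∀ j ∈ J, permLaurent k (simplePerm j) f = f) →
      Mem S J J (H.lau f * H.vee J) := by
    intro N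
    induction N with
    | zero =>
      intro f hf _
      have : f = 0 := by
        apply AddMonoidAlgebra.coeff_injective
        ext a
        by_contra h
        exact absurd (sqNorm_lt_of_mem_lowNorm hf a h) (Nat.not_lt_zero _)
      rw [this, map_zero, zero_mul]
      exact mem_zero
    | succ N ih =>
      intro f hf hinv
      have h1 := mem_span_orbitSum hinv (sqNorm_lt_of_mem_lowNorm hf)
      clear hf hinv
      induction h1 using Submodule.span_induction with
      | mem f hf =>
        obtain ⟨a, ⟨ha, haN⟩, rfl⟩ := hf
        obtain ⟨g, hg, he⟩ := H.exists_relSum_mul_mono hq ha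
        have h1 : Mem S J J (H.lau (orbitSum k J a + g) * H.vee J) := by
          rw [← he]
          refine Mem.comp (K := fixedSimple J a) ?_ (Mem.comp (hM _ a fun j hj =>
            (Finset.mem_filter.1 hj).2) (hS.split (fixedSimple_subset a)))
          rw [H.relSum_mul_vee (fixedSimple_subset a)]
          exact hS.merge (fixedSimple_subset a)
        obtain ⟨y, hy⟩ := mem_cyc.1 h1.mem
        -- The remainder `g` is invariant because the orbit sum is, and because the composite maps
        -- `v_J A` to itself. The induction on the norm therefore applies to `g`.
        have h2 : ∀ j ∈ J, permLaurent k (simplePerm j) g = g := by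
          intro j hj
          have h3 := H.perm_eq_of_T_mul hq hj (f := orbitSum k J a + g) (by
            rw [hy, ← mul_assoc, H.T_mul_vee hj, smul_mul_assoc])
          rw [map_add, permLaurent_orbitSum _ (simplePerm_mem_parabolic hj)] at h3
          exact add_left_cancel h3
        have h4 := h1.sub (ih g (lowNorm_mono (Nat.lt_succ_iff.1 haN) hg) h2)
        rwa [← sub_mul, ← map_sub, add_sub_cancel_right] at h4
      | zero => rw [map_zero, zero_mul]; exact mem_zero
      | add f g _ _ hf hg => rw [map_add, add_mul]; exact hf.add hg
      | smul c f _ hf => rw [map_smul, smul_mul_assoc]; exact hf.smul c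
  obtain ⟨N, hN⟩ : ∃ N, ∀ a, f.coeff a ≠ 0 → sqNorm a < N := by
    refine ⟨(f.coeff.support.sup sqNorm) + 1, fun a ha => Nat.lt_succ_iff.2 ?_⟩
    exact Finset.le_sup (f := sqNorm) (Finsupp.mem_support_iff.2 ha)
  exact key N f (mem_lowNorm_of_coeff hN) hf

theorem HasSplitsMerges.eq_top_of_monomials (hq : q ≠ 0) (hS : H.HasSplitsMerges S)
    (hM : ∀ (L : Finset (Fin m)) (a : Fin (m + 1) → ℤ),
      (∀ j ∈ L, a j.castSucc = a j.succ) → Mem S L L (H.lau (mono a) * H.vee L)) : S = ⊤ :=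
  hS.eq_top hq fun _ _ hf => hS.mem_of_monomials hq hM hf

theorem HasSplitsMerges.eq_top_of_orbitSums (hq : q ≠ 0) (hS : H.HasSplitsMerges S)
    (hO : ∀ (L : Finset (Fin m)) (a : Fin (m + 1) → ℤ), IsDominant L a →
      Mem S L L (H.lau (orbitSum k L a) * H.vee L)) : S = ⊤ := by
  refine hS.eq_top hq fun L f hf => ?_
  have h1 := mem_span_orbitSum (P := fun _ => True) hf fun _ _ => trivial
  clear hf
  induction h1 using Submodule.span_induction with
  | mem f hf =>
    obtain ⟨a, ⟨ha, -⟩, rfl⟩ := hf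
    exact hO L a ha
  | zero => rw [map_zero, zero_mul]; exact mem_zero
  | add f g _ _ hf hg => rw [map_add, add_mul]; exact hf.add hg
  | smul c f _ hf => rw [map_smul, smul_mul_assoc]; exact hf.smul c

end HeckeModel

/-! ### The extended affine Weyl group and the modified length. -/

section AffineWeyl

variable {m : ℕ}

theorem reverse_prod_take_succ {M : Type*} [Monoid M] {m : ℕ} (f : Fin m → M) {t : ℕ}
    (ht : t < m) : ((List.ofFn f).take (t + 1)).reverse.prod =
      f ⟨t, ht⟩ * ((List.ofFn f).take t).reverse.prod := by
  rw [← List.take_append_getElem (by simpa using ht), List.reverse_append, List.reverse_singleton,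
    List.prod_append, List.prod_singleton, List.getElem_ofFn]

theorem reverse_prod_mul_prod {M ι : Type*} [Monoid M] {f g : ι → M} (h : ∀ i, f i * g i = 1)
    (l : List ι) : (l.map f).reverse.prod * (l.map g).prod = 1 := by
  induction l with
  | nil => simp
  | cons i l ih =>
    rw [List.map_cons, List.map_cons, List.reverse_cons, List.prod_append, List.prod_singleton,
      List.prod_cons, mul_assoc, ← mul_assoc (f i), h, one_mul, ih]

theorem prod_mul_reverse_prod {M ι : Type*} [Monoid M] {f g : ι → M} (h : ∀ i, f i * g i = 1)
    (l : List ι) : (l.map f).prod * (l.map g).reverse.prod = 1 := by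
  induction l with
  | nil => simp
  | cons i l ih =>
    rw [List.map_cons, List.map_cons, List.reverse_cons, List.prod_append, List.prod_cons,
      List.prod_singleton, mul_assoc, ← mul_assoc _ _ (g i), ih, one_mul, h]

variable (m) in
/-- The cycle `s_{n-1} ⋯ s_1`. -/
def rot : Equiv.Perm (Fin (m + 1)) := (List.ofFn (simplePerm (m := m))).reverse.prod

theorem take_simplePerm_val {t : ℕ} (ht : t ≤ m) (x : Fin (m + 1)) :
    ((((List.ofFn (simplePerm (m := m))).take t).reverse.prod x : Fin (m + 1)) : ℕ) =
      if (x : ℕ) = 0 then t else if (x : ℕ) ≤ t then (x : ℕ) - 1 else x := by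
  induction t with
  | zero =>
    rw [List.take_zero, List.reverse_nil, List.prod_nil, Equiv.Perm.one_apply]
    split_ifs <;> omega
  | succ t ih =>
    rw [reverse_prod_take_succ _ (Nat.lt_of_succ_le ht), Equiv.Perm.mul_apply, simplePerm_val,
      ih (by omega)]
    simp only
    split_ifs <;> omega

theorem rot_eq_take : rot m = ((List.ofFn (simplePerm (m := m))).take m).reverse.prod := by
  rw [List.take_of_length_le (by simp), rot]

theorem rot_val (x : Fin (m + 1)) : (rot m x : ℕ) = if (x : ℕ) = 0 then m else (x : ℕ) - 1 := by
  have hx := x.isLt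
  rw [rot_eq_take, take_simplePerm_val le_rfl]
  split_ifs <;> omega

theorem rot_lt_iff {x y : Fin (m + 1)} (hx : x ≠ 0) (hy : y ≠ 0) : rot m x < rot m y ↔ x < y := by
  have hx : (x : ℕ) ≠ 0 := fun h => hx (Fin.ext h)
  have hy : (y : ℕ) ≠ 0 := fun h => hy (Fin.ext h)
  rw [Fin.lt_def, Fin.lt_def, rot_val, rot_val, if_neg hx, if_neg hy]
  omega

theorem rot_zero : rot m 0 = Fin.last m := by
  ext; rw [rot_val]; rfl

theorem rot_pow_val {b : ℕ} (hb : b ≤ m + 1) (x : Fin (m + 1)) :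
    ((rot m ^ b) x : ℕ) = if (x : ℕ) < b then (x : ℕ) + (m + 1) - b else (x : ℕ) - b := by
  induction b with
  | zero => simp
  | succ b ih =>
    rw [pow_succ', Equiv.Perm.mul_apply, rot_val, ih (by omega)]
    split_ifs <;> omega

theorem take_simplePerm_lt {t : ℕ} (ht : t < m) :
    ((List.ofFn (simplePerm (m := m))).take t).reverse.prod⁻¹ (⟨t, ht⟩ : Fin m).castSucc <
      ((List.ofFn (simplePerm (m := m))).take t).reverse.prod⁻¹ (⟨t, ht⟩ : Fin m).succ := by
  have e1 : ((List.ofFn (simplePerm (m := m))).take t).reverse.prod⁻¹ (⟨t, ht⟩ : Fin m).castSucc =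
      0 := by
    rw [Equiv.Perm.inv_eq_iff_eq]
    ext
    rw [take_simplePerm_val ht.le]
    simp
  have e2 : ((List.ofFn (simplePerm (m := m))).take t).reverse.prod⁻¹ (⟨t, ht⟩ : Fin m).succ =
      (⟨t, ht⟩ : Fin m).succ := by
    rw [Equiv.Perm.inv_eq_iff_eq]
    ext
    rw [take_simplePerm_val ht.le]
    simp
  rw [e1, e2]
  exact Fin.succ_pos _

theorem invCount_rot : invCount (rot m) = m := by
  have key : ∀ t ≤ m, invCount ((List.ofFn (simplePerm (m := m))).take t).reverse.prod = t := by
    intro t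
    induction t with
    | zero => intro _; rw [List.take_zero, List.reverse_nil, List.prod_nil, invCount_one]
    | succ t ih =>
      intro ht
      rw [reverse_prod_take_succ _ ht, invCount_simple_mul_of_lt (take_simplePerm_lt ht),
        ih (by omega)]
  rw [rot_eq_take, key m le_rfl]

theorem rot_mul_gt {σ : Equiv.Perm (Fin (m + 1))} {i : Fin m} (hi : σ i.castSucc < σ i.succ)
    (h : σ⁻¹ 0 = i.castSucc) : (rot m * σ) i.succ < (rot m * σ) i.castSucc := by
  have h0 : σ i.castSucc = 0 := by rw [← h, perm_apply_inv]
  have h2 : (σ i.succ : ℕ) ≠ 0 := ((Nat.zero_le _).trans_lt hi).ne'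
  have := (σ i.succ).isLt
  rw [Equiv.Perm.mul_apply, Equiv.Perm.mul_apply, h0, rot_zero, Fin.lt_def, rot_val, if_neg h2,
    Fin.val_last]
  omega

theorem rot_mul_lt {σ : Equiv.Perm (Fin (m + 1))} {i : Fin m} (hi : σ i.castSucc < σ i.succ)
    (h : σ⁻¹ 0 ≠ i.castSucc) :
    σ⁻¹ 0 ≠ i.succ ∧ (rot m * σ) i.castSucc < (rot m * σ) i.succ := by
  have hsucc : σ i.succ ≠ 0 := ((Fin.zero_le _).trans_lt hi).ne'
  have hcast : σ i.castSucc ≠ 0 := fun h' => h (by rw [← h', perm_inv_apply])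
  refine ⟨fun h => hsucc (by rw [← h, perm_apply_inv]), ?_⟩
  rw [Equiv.Perm.mul_apply, Equiv.Perm.mul_apply, rot_lt_iff hcast hsucc]
  exact hi

/-- Left multiplication by the cycle makes the smallest value the largest. If that value sits at
position `p`, counted from `0`, then `p` inversions disappear and `m - p` appear. -/
theorem invCount_rot_mul (σ : Equiv.Perm (Fin (m + 1))) :
    (invCount (rot m * σ) : ℤ) + (2 * ((σ⁻¹ 0 : Fin (m + 1)) : ℤ) - m) = invCount σ := by
  induction σ using perm_induction with
  | one =>
    rw [mul_one, inv_one, Equiv.Perm.one_apply, invCount_rot, invCount_one]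
    simp
  | mul σ i hi ih =>
    have hinv : (σ * simplePerm i)⁻¹ 0 = simplePerm i (σ⁻¹ 0) := by
      rw [mul_inv_rev, simplePerm_inv, Equiv.Perm.mul_apply]
    rw [hinv, ← mul_assoc (rot m), invCount_mul_of_lt hi]
    by_cases hj : σ⁻¹ 0 = i.castSucc
    · have hinvc := invCount_mul_of_gt (rot_mul_gt hi hj)
      rw [hj] at ih ⊢
      rw [simplePerm_castSucc]
      simp only [Fin.val_succ, Fin.val_castSucc] at ih ⊢
      push_cast
      omega
    · obtain ⟨hj', hlt⟩ := rot_mul_lt hi hj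
      rw [simplePerm_of_ne i hj hj', invCount_mul_of_lt hlt]
      push_cast
      omega

theorem perm_mul (σ τ : Equiv.Perm (Fin (m + 1))) : (perm (σ * τ) : Weyl m) = perm σ * perm τ :=
  map_mul _ _ _

theorem perm_one : (perm 1 : Weyl m) = 1 := map_one _

theorem perm_inv (σ : Equiv.Perm (Fin (m + 1))) : (perm σ⁻¹ : Weyl m) = (perm σ)⁻¹ := map_inv _ _

theorem perm_list_prod (l : List (Equiv.Perm (Fin (m + 1)))) :
    (perm l.prod : Weyl m) = (l.map perm).prod :=
  map_list_prod (SemidirectProduct.inr : Equiv.Perm (Fin (m + 1)) →* Weyl m) l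

theorem transl_add (a b : Fin (m + 1) → ℤ) : (transl (a + b) : Weyl m) = transl a * transl b :=
  map_mul (SemidirectProduct.inl : MonLattice m →* Weyl m) _ _

theorem transl_zero : (transl 0 : Weyl m) = 1 :=
  map_one (SemidirectProduct.inl : MonLattice m →* Weyl m)

theorem perm_mul_transl (σ : Equiv.Perm (Fin (m + 1))) (a : Fin (m + 1) → ℤ) :
    (perm σ * transl a : Weyl m) = transl (permExp σ a) * perm σ := by
  have h := SemidirectProduct.inl_aut (φ := permAct m) σ (Multiplicative.ofAdd a)
  have h2 : (transl (permExp σ a) : Weyl m) = perm σ * transl a * perm σ⁻¹ := h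
  rw [h2, perm_inv, inv_mul_cancel_right]

theorem perm_transl_injective {σ τ : Equiv.Perm (Fin (m + 1))} {a b : Fin (m + 1) → ℤ}
    (h : (perm σ * transl a : Weyl m) = perm τ * transl b) : σ = τ ∧ a = b := by
  have h1 : σ = τ := by
    have := congrArg SemidirectProduct.right h
    simpa [perm, transl] using this
  subst h1
  have h2 := mul_left_cancel h
  exact ⟨rfl, Multiplicative.ofAdd.injective (SemidirectProduct.inl_injective h2)⟩

theorem tau_eq : tau m = perm (rot m) * transl (Pi.single 0 1) := by
  rw [tau, rot, perm_list_prod, List.map_reverse, List.map_ofFn]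
  rfl

theorem tau_mul (σ : Equiv.Perm (Fin (m + 1))) (a : Fin (m + 1) → ℤ) :
    tau m * (perm σ * transl a) = perm (rot m * σ) * transl (a + Pi.single (σ⁻¹ 0) 1) := by
  have h : (transl (Pi.single 0 1) * perm σ : Weyl m) =
      perm σ * transl (Pi.single (σ⁻¹ 0) 1) := by
    rw [perm_mul_transl, permExp_single, perm_apply_inv]
  rw [tau_eq, mul_assoc, ← mul_assoc (transl _), h, perm_mul, add_comm a, transl_add]
  simp only [mul_assoc]

/-- With `D = s_{n-1} ⋯ s_2`, the cycle is `D s_1` and `s_0` is the cycle times `D⁻¹` times a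
translation. The rest is moving translations past permutations. -/
theorem simpleZero_eq {i : Fin m} (hi : (i : ℕ) = 0) :
    simpleZero m = tau m * perm (simplePerm i) * (tau m)⁻¹ := by
  obtain _ | m := m
  · exact i.elim0
  obtain rfl : i = 0 := Fin.ext hi
  set D : Equiv.Perm (Fin (m + 2)) :=
    (List.ofFn fun i : Fin m => simplePerm (m := m + 1) i.succ).reverse.prod with hD
  have hrot : rot (m + 1) = D * simplePerm 0 := by
    rw [rot, List.ofFn_succ, List.reverse_cons, List.prod_append, List.prod_singleton]
  have hDi : (List.ofFn fun i : Fin m => simplePerm (m := m + 1) i.succ).prod = D⁻¹ := by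
    rw [eq_inv_iff_mul_eq_one, hD, List.ofFn_eq_map]
    exact prod_mul_reverse_prod (fun i => simplePerm_mul_self _) _
  have hD' : D = rot (m + 1) * simplePerm 0 := by rw [hrot, mul_simplePerm_cancel]
  have h0 : D 0 = 0 := by
    rw [hD', Equiv.Perm.mul_apply, show (0 : Fin (m + 2)) = (0 : Fin (m + 1)).castSucc from rfl,
      simplePerm_castSucc]
    ext; rw [rot_val]; rfl
  have h1 : D 1 = Fin.last (m + 1) := by
    rw [hD', Equiv.Perm.mul_apply, show (1 : Fin (m + 2)) = (0 : Fin (m + 1)).succ from rfl,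
      simplePerm_succ]
    exact rot_zero
  have hz : simpleZero (m + 1) = perm (rot (m + 1)) * perm D⁻¹ *
      transl (Pi.single 0 1 - Pi.single (Fin.last (m + 1)) 1) := by
    rw [simpleZero, rot, ← hDi, perm_list_prod, perm_list_prod, List.map_reverse, List.map_ofFn,
      List.map_ofFn, List.ofFn_succ (f := fun i => perm (simplePerm i)), List.tail_cons,
      ← List.ofFn_succ (f := fun i => (perm (simplePerm i) : Weyl (m + 1)))]
    rfl
  rw [eq_mul_inv_iff_mul_eq, hz, tau_eq, mul_assoc (perm _ * perm _), ← mul_assoc (transl _),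
    mul_assoc (perm _) (perm D⁻¹)]
  have e1 : (transl (Pi.single 0 1 - Pi.single (Fin.last (m + 1)) 1) * perm (rot (m + 1)) :
      Weyl (m + 1)) = perm (rot (m + 1)) * transl (Pi.single 1 1 - Pi.single 0 1) := by
    rw [perm_mul_transl, map_sub, permExp_single, permExp_single, rot_zero]
    congr 4
    rw [hrot, Equiv.Perm.mul_apply, show (1 : Fin (m + 2)) = (0 : Fin (m + 1)).succ from rfl,
      simplePerm_succ]
    exact h0.symm
  have e2 : (transl (Pi.single 0 1) * perm (simplePerm 0) : Weyl (m + 1)) =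
      perm (simplePerm 0) * transl (Pi.single 1 1) := by
    rw [perm_mul_transl, permExp_single, show (1 : Fin (m + 2)) = (0 : Fin (m + 1)).succ from rfl,
      simplePerm_succ]
    rfl
  rw [e1, mul_assoc (perm _) (transl _), ← transl_add, sub_add_cancel, mul_assoc, e2,
    ← mul_assoc (perm D⁻¹), ← perm_mul, show D⁻¹ * rot (m + 1) = simplePerm 0 by
      rw [hrot, inv_mul_cancel_left]]

/-- The total degree. -/
def degHom : Weyl m →* Multiplicative ℤ where
  toFun w := Multiplicative.ofAdd (∑ x, Multiplicative.toAdd w.left x)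
  map_one' := by
    rw [SemidirectProduct.one_left]
    exact congrArg Multiplicative.ofAdd Finset.sum_const_zero
  map_mul' u w := by
    rw [SemidirectProduct.mul_left, ← ofAdd_add, ← Equiv.sum_comp u.right⁻¹
      (fun x => Multiplicative.toAdd w.left x), ← Finset.sum_add_distrib]
    rfl

theorem degHom_perm (σ : Equiv.Perm (Fin (m + 1))) : degHom (perm σ : Weyl m) = 1 := by
  simp only [degHom, perm, MonoidHom.coe_mk, OneHom.coe_mk, SemidirectProduct.left_inr]
  exact congrArg Multiplicative.ofAdd Finset.sum_const_zero

theorem degHom_tau : degHom (tau m) = Multiplicative.ofAdd 1 := by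
  rw [tau_eq, map_mul, degHom_perm, one_mul]
  simp only [degHom, transl, MonoidHom.coe_mk, OneHom.coe_mk, SemidirectProduct.left_inl]
  refine congrArg Multiplicative.ofAdd ?_
  change ∑ x : Fin (m + 1), (Pi.single 0 1 : Fin (m + 1) → ℤ) x = 1
  rw [Finset.sum_pi_single']
  simp

theorem affSimple_succ (i : Fin m) : affSimple i.succ = (perm (simplePerm i) : Weyl m) := rfl

theorem affSimple_zero : affSimple 0 = simpleZero m := rfl

theorem degHom_affSimple (hm : 1 ≤ m) (i : Fin (m + 1)) : degHom (affSimple i : Weyl m) = 1 := by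
  refine Fin.cases ?_ (fun i => ?_) i
  · rw [affSimple_zero, simpleZero_eq (i := ⟨0, hm⟩) rfl, map_mul, map_mul, degHom_perm, map_inv,
      mul_one, mul_inv_cancel]
  · rw [affSimple_succ, degHom_perm]

theorem exists_word (σ : Equiv.Perm (Fin (m + 1))) : ∃ l : List (Fin (m + 1)),
    l.length = invCount σ ∧ (l.map affSimple).prod = (perm σ : Weyl m) := by
  induction σ using perm_induction with
  | one => exact ⟨[], by rw [invCount_one]; rfl, by rw [perm_one]; rfl⟩
  | mul σ i hi ih =>
    obtain ⟨l, h1, h2⟩ := ih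
    refine ⟨l ++ [i.succ], ?_, ?_⟩
    · rw [List.length_append, h1, invCount_mul_of_lt hi]; rfl
    · rw [List.map_append, List.prod_append, h2, perm_mul, List.map_singleton, List.prod_singleton,
        affSimple_succ]

/-- The linear part of the modified length function. -/
def linWt (a : Fin (m + 1) → ℤ) : ℤ := ∑ x : Fin (m + 1), (2 * (x : ℤ) - m) * a x

theorem linWt_zero : linWt (0 : Fin (m + 1) → ℤ) = 0 := by simp [linWt]

theorem linWt_add_single (a : Fin (m + 1) → ℤ) (j : Fin (m + 1)) (c : ℤ) :
    linWt (a + Pi.single j c) = linWt a + (2 * (j : ℤ) - m) * c := by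
  simp only [linWt, Pi.add_apply, mul_add, Finset.sum_add_distrib]
  congr 1
  rw [Finset.sum_eq_single j]
  · rw [Pi.single_eq_same]
  · intro x _ hx; rw [Pi.single_eq_of_ne hx, mul_zero]
  · simp

/-- The modified length function. -/
def semiLength (σ : Equiv.Perm (Fin (m + 1))) (a : Fin (m + 1) → ℤ) : ℤ := invCount σ + linWt a

/-- The change of inversion number under the cycle is cancelled by the weight of the variable
gained, so left multiplication by `τ` preserves the modified length. The weights in `linWt` are
chosen for this. -/
theorem semiLength_rot (σ : Equiv.Perm (Fin (m + 1))) (a : Fin (m + 1) → ℤ) :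
    semiLength (rot m * σ) (a + Pi.single (σ⁻¹ 0) 1) = semiLength σ a := by
  have := invCount_rot_mul σ
  rw [semiLength, semiLength, linWt_add_single]
  linarith

end AffineWeyl

/-! ### The elements `T_τ` and `T_{s_0}`. -/

namespace HeckeModel

variable {k : Type*} [Field k] {q : k} {m : ℕ} {A : Type*} [Ring A] [Algebra k A]
  (H : HeckeModel q m A)

/-- `T_{s_0}`. -/
def Tzero : A :=
  q ^ m • ((((H.X 0)⁻¹ * H.X (Fin.last m) : Aˣ) : A)
    * ((List.ofFn H.Tinv).reverse.prod * (List.ofFn H.Tinv).tail.prod))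

/-- `T_{s_0}, …, T_{s_{n-1}}`. -/
def aff : Fin (m + 1) → A := Fin.cons H.Tzero H.T

variable (r : k)

/-- `T_τ`. -/
def tau : A := r⁻¹ ^ m • ((List.ofFn H.T).reverse.prod * (H.X 0 : A))

/-- `T_τ⁻¹`. -/
def tauInv : A := r ^ m • ((((H.X 0)⁻¹ : Aˣ) : A) * (List.ofFn H.Tinv).prod)

/-- The powers of `T_τ`. -/
def tauPow : ℤ → A
  | .ofNat j => H.tau r ^ j
  | .negSucc j => H.tauInv r ^ (j + 1)

/-- The product along a word. -/
def word (e : List (Fin (m + 1)) × ℤ) : A := (e.1.map H.aff).prod * H.tauPow r e.2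

/-- The basis element `T_w`. -/
def Tw (w : Weyl m) : A := H.word r (Classical.epsilon (IsReduced w))

variable {r}

theorem reverse_prod_T : (List.ofFn H.T).reverse.prod = H.TT (rot m) := by
  have key : ∀ t ≤ m, ((List.ofFn H.T).take t).reverse.prod =
      H.TT ((List.ofFn (simplePerm (m := m))).take t).reverse.prod := by
    intro t
    induction t with
    | zero =>
      intro _
      rw [List.take_zero, List.take_zero, List.reverse_nil, List.reverse_nil, List.prod_nil,
        List.prod_nil, H.TT_one]
    | succ t ih =>
      intro ht
      rw [reverse_prod_take_succ _ ht, reverse_prod_take_succ _ ht, ih (by omega),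
        H.T_mul_TT (take_simplePerm_lt ht)]
  have := key m le_rfl
  rwa [← rot_eq_take, List.take_of_length_le (by simp)] at this

theorem tau_eq : H.tau r = r⁻¹ ^ m • (H.TT (rot m) * (H.X 0 : A)) := by
  rw [tau, H.reverse_prod_T]

theorem tauInv_mul_tau (hq : q ≠ 0) (hr : r ≠ 0) : H.tauInv r * H.tau r = 1 := by
  have h : (List.ofFn H.Tinv).prod * (List.ofFn H.T).reverse.prod = 1 := by
    rw [List.ofFn_eq_map, List.ofFn_eq_map]
    exact prod_mul_reverse_prod (H.Tinv_mul hq) _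
  rw [tau, tauInv, smul_mul_smul_comm, ← mul_pow, mul_inv_cancel₀ hr, one_pow, one_smul, mul_assoc,
    ← mul_assoc (List.prod _), h, one_mul, Units.inv_mul]

theorem tau_mul_tauInv (hq : q ≠ 0) (hr : r ≠ 0) : H.tau r * H.tauInv r = 1 := by
  have h : (List.ofFn H.T).reverse.prod * (List.ofFn H.Tinv).prod = 1 := by
    rw [List.ofFn_eq_map, List.ofFn_eq_map]
    exact reverse_prod_mul_prod (H.T_mul_Tinv hq) _
  rw [tau, tauInv, smul_mul_smul_comm, ← mul_pow, inv_mul_cancel₀ hr, one_pow, one_smul, mul_assoc,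
    ← mul_assoc (H.X 0 : A), Units.mul_inv, one_mul, h]

/-- `T_τ` as a unit. -/
def tauUnit (hq : q ≠ 0) (hr : r ≠ 0) : Aˣ :=
  ⟨H.tau r, H.tauInv r, H.tau_mul_tauInv hq hr, H.tauInv_mul_tau hq hr⟩

theorem tauPow_eq (hq : q ≠ 0) (hr : r ≠ 0) (j : ℤ) :
    H.tauPow r j = (H.tauUnit hq hr ^ j : Aˣ) := by
  cases j with
  | ofNat j => rw [tauPow, Int.ofNat_eq_natCast, zpow_natCast, Units.val_pow_eq_pow_val]; rfl
  | negSucc j =>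
    rw [tauPow, zpow_negSucc, ← inv_pow, Units.val_pow_eq_pow_val]; rfl

theorem Tzero_eq (hq : q ≠ 0) (hr : r ≠ 0) {i : Fin m} (hi : (i : ℕ) = 0) :
    H.Tzero = H.tau r * H.T i * H.tauInv r := by
  obtain _ | m := m
  · exact i.elim0
  obtain rfl : i = 0 := Fin.ext hi
  have hTX : ∀ j : Fin (m + 1), H.T j * (H.X j.castSucc : A) = q • ((H.X j.succ : A) * H.Tinv j) := by
    intro j
    rw [← smul_mul_assoc, ← H.T_X_T, mul_assoc _ (H.T j), H.T_mul_Tinv hq, mul_one]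
  have hX0 : ∀ j : Fin m, Commute (H.Tinv j.succ) ((H.X 0)⁻¹ : Aˣ).val := by
    intro j
    have h1 : Commute (H.T j.succ) (H.X 0 : A) :=
      H.T_X _ _ (by rw [← Fin.succ_castSucc]; exact (Fin.succ_ne_zero _).symm)
        (Fin.succ_ne_zero _).symm
    have h2 : Commute (H.T j.succ) ((H.X 0)⁻¹ : Aˣ).val := h1.units_inv_right
    exact (h2.smul_left _).add_left (Algebra.commutes _ _)
  -- Iterating `T_j X_j = q X_{j+1} T_j⁻¹` moves `X_2` through `T_{n-1} ⋯ T_2` and turns it into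
  -- `X_n`, with a power of `q` and the inverses of the `T_j`.
  have key : ∀ t ≤ m, ((List.ofFn fun j : Fin m => H.T j.succ).take t).reverse.prod *
      (H.X 1 : A) = q ^ t • ((H.X (Fin.ofNat (m + 2) (t + 1)) : A) *
        ((List.ofFn fun j : Fin m => H.Tinv j.succ).take t).reverse.prod) := by
    intro t
    induction t with
    | zero =>
      intro _
      simp only [List.take_zero, List.reverse_nil, List.prod_nil, one_mul, mul_one, pow_zero,
        one_smul]
      rfl
    | succ t ih =>
      intro ht
      have e1 : (Fin.ofNat (m + 2) (t + 1)) = (⟨t, ht⟩ : Fin m).succ.castSucc := by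
        ext; simp; omega
      have e2 : (Fin.ofNat (m + 2) (t + 1 + 1)) = (⟨t, ht⟩ : Fin m).succ.succ := by
        ext; simp; omega
      rw [reverse_prod_take_succ _ ht, reverse_prod_take_succ _ ht, mul_assoc, ih (by omega),
        mul_smul_comm, ← mul_assoc, e1, hTX, e2, smul_mul_assoc, smul_smul, pow_succ, mul_assoc]
  have hR := key m le_rfl
  rw [List.take_of_length_le (by simp), List.take_of_length_le (by simp)] at hR
  have hlast : Fin.ofNat (m + 2) (m + 1) = Fin.last (m + 1) := by ext; simp
  rw [hlast] at hR
  set R := (List.ofFn fun j : Fin m => H.T j.succ).reverse.prod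
  set R' := (List.ofFn fun j : Fin m => H.Tinv j.succ).reverse.prod with hR'
  set Ri := (List.ofFn fun j : Fin m => H.Tinv j.succ).prod with hRi
  have hcomm : R' * ((H.X 0)⁻¹ : Aˣ).val = ((H.X 0)⁻¹ : Aˣ).val * R' := by
    refine Commute.list_prod_left _ _ fun x hx => ?_
    rw [List.mem_reverse, List.mem_ofFn] at hx
    obtain ⟨j, rfl⟩ := hx
    exact hX0 j
  have hTXT : H.T 0 * (H.X 0 : A) * H.T 0 = q • (H.X 1 : A) := H.T_X_T 0
  have hXc : (((H.X 0)⁻¹ * H.X (Fin.last (m + 1)) : Aˣ) : A) =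
      (H.X (Fin.last (m + 1)) : A) * ((H.X 0)⁻¹ : Aˣ).val := by
    rw [(H.X_comm 0 (Fin.last (m + 1))).inv_left.eq, Units.val_mul]
  rw [Tzero, tau, tauInv, List.ofFn_succ, List.ofFn_succ (f := H.T), List.tail_cons,
    List.reverse_cons, List.reverse_cons, List.prod_append, List.prod_append, List.prod_singleton,
    List.prod_singleton, List.prod_cons, smul_mul_assoc, smul_mul_smul_comm, ← mul_pow,
    inv_mul_cancel₀ hr, one_pow, one_smul]
  change q ^ (m + 1) • (_ * (R' * H.Tinv 0 * Ri)) = R * H.T 0 * _ * H.T 0 * (_ * (H.Tinv 0 * Ri))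
  rw [mul_assoc R, mul_assoc R, hTXT, mul_smul_comm, hR, smul_smul, ← pow_succ', smul_mul_assoc,
    hXc]
  congr 1
  simp only [mul_assoc]
  rw [← mul_assoc R' ((H.X 0)⁻¹ : Aˣ).val, hcomm]
  simp only [mul_assoc]

/-- Induction on length. If `s_i` moves the position of the smallest value, the last `T_i` of the
rotated element combines with `X_i` and `T_i` to `q X_{i+1}`, and `q = r²` accounts for the change
of the exponent by two. Otherwise `T_i` commutes with the variable. -/
theorem tau_mul_TT (hr : r ^ 2 = q) (hr0 : r ≠ 0) (σ : Equiv.Perm (Fin (m + 1))) :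
    H.tau r * H.TT σ = r ^ (2 * ((σ⁻¹ 0 : Fin (m + 1)) : ℤ) - m) •
      (H.TT (rot m * σ) * (H.X (σ⁻¹ 0) : A)) := by
  induction σ using perm_induction with
  | one =>
    rw [H.TT_one, mul_one, mul_one, inv_one, Equiv.Perm.one_apply, H.tau_eq]
    congr 1
    simp
  | mul σ i hi ih =>
    have hinv : (σ * simplePerm i)⁻¹ 0 = simplePerm i (σ⁻¹ 0) := by
      rw [mul_inv_rev, simplePerm_inv, Equiv.Perm.mul_apply]
    rw [H.TT_mul_simple hi, ← mul_assoc, ih, hinv, ← mul_assoc (rot m)]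
    by_cases hj : σ⁻¹ 0 = i.castSucc
    · have hpow : r ^ (2 * (i.castSucc : ℤ) - m) * q = r ^ (2 * (i.succ : ℤ) - m) := by
        rw [← hr, ← zpow_natCast, ← zpow_add₀ hr0]
        congr 1
        simp only [Fin.val_succ, Fin.val_castSucc]
        push_cast
        ring
      rw [hj, simplePerm_castSucc, H.TT_of_descent (rot_mul_gt hi hj), smul_mul_assoc, mul_assoc,
        mul_assoc, ← mul_assoc (H.T i), H.T_X_T, mul_smul_comm, smul_smul, hpow]
    · obtain ⟨hj', hlt⟩ := rot_mul_lt hi hj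
      rw [simplePerm_of_ne i hj hj', H.TT_mul_simple hlt, smul_mul_assoc, mul_assoc,
        ← H.T_X i _ hj hj', ← mul_assoc]

variable (r) in
/-- The element attached to `σ X^a` that agrees with the basis element up to length. -/
def semiBasis (σ : Equiv.Perm (Fin (m + 1))) (a : Fin (m + 1) → ℤ) : A :=
  r ^ linWt a • (H.TT σ * (H.mon a : A))

theorem semiBasis_zero (σ : Equiv.Perm (Fin (m + 1))) : H.semiBasis r σ 0 = H.TT σ := by
  rw [semiBasis, linWt_zero, zpow_zero, one_smul, H.mon_zero, Units.val_one, mul_one]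

theorem tau_mul_semiBasis (hr : r ^ 2 = q) (hr0 : r ≠ 0) (σ : Equiv.Perm (Fin (m + 1)))
    (a : Fin (m + 1) → ℤ) : H.tau r * H.semiBasis r σ a =
      H.semiBasis r (rot m * σ) (a + Pi.single (σ⁻¹ 0) 1) := by
  rw [semiBasis, mul_smul_comm, ← mul_assoc, H.tau_mul_TT hr hr0 σ, smul_mul_assoc, smul_smul,
    semiBasis, linWt_add_single, zpow_add₀ hr0, mul_one, add_comm a, H.mon_add, H.mon_single,
    zpow_one, Units.val_mul, mul_assoc (H.TT _)]

end HeckeModel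

/-! ### The monomials `X_1 ⋯ X_b` and powers of `τ`. -/

section FirstExp

variable {m : ℕ} {J K : Finset (Fin m)}

/-- The exponent vector of the product of the first `b` variables. -/
def firstExp (b : ℕ) : Fin (m + 1) → ℤ := fun x => if (x : ℕ) < b then 1 else 0

theorem firstExp_succ {b : ℕ} (hb : b ≤ m) :
    firstExp b + Pi.single ((rot m ^ b)⁻¹ 0) 1 = (firstExp (b + 1) : Fin (m + 1) → ℤ) := by
  have h : (rot m ^ b)⁻¹ 0 = (⟨b, Nat.lt_succ_of_le hb⟩ : Fin (m + 1)) := by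
    rw [Equiv.Perm.inv_eq_iff_eq]
    ext
    rw [rot_pow_val (by omega)]
    simp
  rw [h]
  funext x
  rw [Pi.add_apply, firstExp, firstExp]
  by_cases hx : x = (⟨b, Nat.lt_succ_of_le hb⟩ : Fin (m + 1))
  · subst hx; simp
  · have : (x : ℕ) ≠ b := fun h => hx (Fin.ext h)
    rw [Pi.single_eq_of_ne hx, add_zero]
    congr 1
    rw [eq_iff_iff]; omega

theorem tau_pow_eq {b : ℕ} (hb : b ≤ m + 1) :
    tau m ^ b = perm (rot m ^ b) * transl (firstExp b) := by
  induction b with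
  | zero =>
    have : (firstExp 0 : Fin (m + 1) → ℤ) = 0 := rfl
    rw [pow_zero, pow_zero, perm_one, this, transl_zero, one_mul]
  | succ b ih =>
    rw [pow_succ', ih (by omega), tau_mul, ← pow_succ', firstExp_succ (by omega)]

theorem transl_firstExp {b : ℕ} (hb : b ≤ m + 1) :
    transl (firstExp b) = perm (rot m ^ b)⁻¹ * tau m ^ (b : ℤ) := by
  rw [zpow_natCast, tau_pow_eq hb, perm_inv, inv_mul_cancel_left]

theorem transl_neg_firstExp {b : ℕ} (hb : b ≤ m + 1) :
    transl (-permExp (rot m ^ b) (firstExp b)) = perm (rot m ^ b) * tau m ^ (-(b : ℤ)) := by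
  have h : ∀ a : Fin (m + 1) → ℤ, (transl (-a) : Weyl m) = (transl a)⁻¹ := fun a =>
    map_inv (SemidirectProduct.inl : MonLattice m →* Weyl m) _
  rw [zpow_neg, zpow_natCast, tau_pow_eq hb, mul_inv_rev, ← h, ← perm_inv, ← mul_assoc,
    perm_mul_transl, mul_assoc, ← perm_mul, mul_inv_cancel, perm_one, mul_one, map_neg]

/-- Apart from a possible cut between the first `b` indices and the rest, the `b`-th power of the
cycle shifts neighbours to neighbours. -/
theorem passes_rot_pow {b : ℕ} (hb : b ≤ m + 1) {j : Fin m} (hj : (j : ℕ) + 1 ≠ b) :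
    ∃ i, Passes (rot m ^ b) i j := by
  have hjm := j.isLt
  refine ⟨⟨if (j : ℕ) < b then (j : ℕ) + (m + 1) - b else (j : ℕ) - b, ?_⟩, ?_, ?_⟩
  · split_ifs <;> omega
  · ext
    rw [rot_pow_val hb, Fin.val_castSucc]
    rfl
  · ext
    rw [rot_pow_val hb, Fin.val_succ, Fin.val_succ]
    simp only
    split_ifs <;> omega

theorem firstExp_const {b : ℕ} {j : Fin m} (hj : (j : ℕ) + 1 ≠ b) :
    (firstExp b : Fin (m + 1) → ℤ) j.castSucc = firstExp b j.succ := by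
  rw [firstExp, firstExp, Fin.val_succ, Fin.val_castSucc]
  congr 1
  rw [eq_iff_iff]; omega

/-- Telescoping. If `a` is constant on the `J`-blocks, the coefficients at indices `i ∈ J` vanish,
so only products `X_1 ⋯ X_b` ending at a block boundary occur. -/
theorem eq_sum_firstExp (a : Fin (m + 1) → ℤ) :
    a = ∑ i : Fin m, (a i.castSucc - a i.succ) • firstExp ((i : ℕ) + 1) +
      a (Fin.last m) • firstExp (m + 1) := by
  funext x
  rw [Pi.add_apply, Finset.sum_apply]
  simp only [Pi.smul_apply, smul_eq_mul, firstExp, if_pos x.isLt, mul_one]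
  induction x using Fin.reverseInduction with
  | last =>
    rw [Finset.sum_eq_zero, zero_add]
    intro i _
    rw [if_neg, mul_zero]
    rw [Fin.val_last]; omega
  | cast j ih =>
    have h : ∑ i : Fin m, (a i.castSucc - a i.succ) *
        (if (j.castSucc : ℕ) < (i : ℕ) + 1 then (1 : ℤ) else 0) =
        (a j.castSucc - a j.succ) + ∑ i : Fin m, (a i.castSucc - a i.succ) *
          (if (j.succ : ℕ) < (i : ℕ) + 1 then (1 : ℤ) else 0) := by
      rw [← sub_eq_iff_eq_add, ← Finset.sum_sub_distrib, Finset.sum_eq_single j]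
      · rw [if_pos (by simp), if_neg (by simp)]; ring
      · intro i _ hi
        have : (i : ℕ) ≠ j := fun h => hi (Fin.ext h)
        rw [← mul_sub, Fin.val_castSucc, Fin.val_succ]
        split_ifs <;> omega
      · simp
    rw [h]
    linarith

open scoped Classical in
-- A translation by an exponent constant on the blocks commutes with `W_J`, so the double coset is a
-- single coset.
theorem dblCoset_eq {a : Fin (m + 1) → ℤ} (h : ∀ j ∈ J, a j.castSucc = a j.succ) :
    dblCoset J J (transl a) = (parabolicFinset J).image fun w => perm w * transl a := by
  ext u
  simp only [dblCoset, Finset.mem_image, Finset.mem_product, mem_parabolicFinset, Prod.exists]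
  constructor
  · rintro ⟨w, w', ⟨hw, hw'⟩, rfl⟩
    refine ⟨w * w', mul_mem hw hw', ?_⟩
    rw [perm_mul, mul_assoc, perm_mul_transl, permExp_eq_self h hw', mul_assoc]
  · rintro ⟨w, hw, rfl⟩
    exact ⟨w, 1, ⟨hw, one_mem _⟩, by rw [perm_one, mul_one]⟩

open scoped Classical in
theorem dblCoset_one_of_subset (h : J ⊆ K) :
    dblCoset K J (1 : Weyl m) = (parabolicFinset K).image perm ∧
    dblCoset J K (1 : Weyl m) = (parabolicFinset K).image perm := by
  constructor
  all_goals
    ext u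
    simp only [dblCoset, Finset.mem_image, Finset.mem_product, mem_parabolicFinset, Prod.exists]
    constructor
  · rintro ⟨w, w', ⟨hw, hw'⟩, rfl⟩
    exact ⟨w * w', mul_mem hw (parabolic_mono h hw'), by rw [perm_mul, mul_one]⟩
  · rintro ⟨w, hw, rfl⟩
    exact ⟨w, 1, ⟨hw, one_mem _⟩, by rw [perm_one, mul_one, mul_one]⟩
  · rintro ⟨w, w', ⟨hw, hw'⟩, rfl⟩
    exact ⟨w * w', mul_mem (parabolic_mono h hw) hw', by rw [perm_mul, mul_one]⟩
  · rintro ⟨w, hw, rfl⟩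
    exact ⟨1, w, ⟨one_mem _, hw⟩, by rw [perm_one, one_mul, one_mul]⟩

theorem perm_injective : Function.Injective (perm : Equiv.Perm (Fin (m + 1)) → Weyl m) :=
  SemidirectProduct.inr_injective

end FirstExp

/-! ### Iwahori–Matsumoto basis elements, and generation by dominant monomials. -/

namespace HeckeModel

variable {k : Type*} [Field k] {q : k} {m : ℕ} {A : Type*} [Ring A] [Algebra k A]
  (H : HeckeModel q m A) {J K : Finset (Fin m)} {r : k}

theorem T_mul_semiBasis (σ : Equiv.Perm (Fin (m + 1))) (a : Fin (m + 1) → ℤ) (i : Fin m) :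
    (semiLength (simplePerm i * σ) a = semiLength σ a + 1 ∧
      H.T i * H.semiBasis r σ a = H.semiBasis r (simplePerm i * σ) a) ∨
    semiLength (simplePerm i * σ) a = semiLength σ a - 1 := by
  rw [semiLength, semiLength]
  rcases lt_or_gt_simple σ⁻¹ i with h | h
  · left
    rw [invCount_simple_mul_of_lt h]
    refine ⟨by push_cast; ring, ?_⟩
    rw [semiBasis, mul_smul_comm, ← mul_assoc, H.T_mul_TT h]; rfl
  · right
    rw [← invCount_simple_mul_of_gt h]
    push_cast; ring

/-- For `s_1, …, s_{n-1}` this is the left multiplication rule for `T_σ`. The case of `s_0` is its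
conjugate by `τ`, which preserves both the modified length and the family `semiBasis`. -/
theorem aff_mul_semiBasis (hr : r ^ 2 = q) (hr0 : r ≠ 0) (hm : 1 ≤ m)
    (σ : Equiv.Perm (Fin (m + 1))) (a : Fin (m + 1) → ℤ) (i : Fin (m + 1)) : ∃ σ' a',
    affSimple i * (perm σ * transl a) = perm σ' * transl a' ∧
    ((semiLength σ' a' = semiLength σ a + 1 ∧ H.aff i * H.semiBasis r σ a = H.semiBasis r σ' a') ∨
      semiLength σ' a' = semiLength σ a - 1) := by
  have hq : q ≠ 0 := hr ▸ pow_ne_zero 2 hr0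
  refine Fin.cases ?_ (fun i => ?_) i
  · obtain ⟨σ₁, a₁, rfl, rfl⟩ : ∃ σ₁ a₁, σ = rot m * σ₁ ∧ a = a₁ + Pi.single (σ₁⁻¹ 0) 1 :=
      ⟨(rot m)⁻¹ * σ, a - Pi.single (((rot m)⁻¹ * σ)⁻¹ 0) 1, (mul_inv_cancel_left _ _).symm,
        (sub_add_cancel _ _).symm⟩
    refine ⟨rot m * (simplePerm ⟨0, hm⟩ * σ₁),
      a₁ + Pi.single ((simplePerm ⟨0, hm⟩ * σ₁)⁻¹ 0) 1, ?_, ?_⟩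
    · rw [← tau_mul, ← tau_mul, affSimple_zero, simpleZero_eq (i := ⟨0, hm⟩) rfl, mul_assoc,
        inv_mul_cancel_left, mul_assoc, ← mul_assoc (perm _) (perm _), ← perm_mul]
    · rw [semiLength_rot, semiLength_rot]
      refine (H.T_mul_semiBasis (r := r) σ₁ a₁ ⟨0, hm⟩).imp_left fun h => ⟨h.1, ?_⟩
      change H.Tzero * _ = _
      rw [← H.tau_mul_semiBasis hr hr0, ← H.tau_mul_semiBasis hr hr0,
        H.Tzero_eq hq hr0 (i := ⟨0, hm⟩) rfl, mul_assoc, ← mul_assoc (H.tauInv r),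
        H.tauInv_mul_tau hq hr0, one_mul, mul_assoc, h.2]
  · refine ⟨simplePerm i * σ, a, ?_, H.T_mul_semiBasis σ a i⟩
    rw [affSimple_succ, perm_mul, mul_assoc]

/-- Each letter changes the modified length by one, up or down. It is thus bounded by the length of
the word, and equality forces an increase at every letter, in which case the product in the Hecke
algebra is known. -/
theorem exists_word_semiBasis (hr : r ^ 2 = q) (hr0 : r ≠ 0) (hm : 1 ≤ m)
    (l : List (Fin (m + 1))) : ∃ σ a, (l.map affSimple).prod = perm σ * transl a ∧
      semiLength σ a ≤ l.length ∧
      (semiLength σ a = l.length → (l.map H.aff).prod = H.semiBasis r σ a) := by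
  induction l with
  | nil =>
    refine ⟨1, 0, ?_, ?_, fun _ => ?_⟩
    · rw [perm_one, transl_zero, one_mul]; rfl
    · rw [semiLength, linWt_zero, invCount_one]; simp
    · rw [semiBasis_zero, H.TT_one]; rfl
  | cons i l ih =>
    obtain ⟨σ, a, h1, h2, h3⟩ := ih
    obtain ⟨σ', a', e1, e2⟩ := H.aff_mul_semiBasis hr hr0 hm σ a i
    refine ⟨σ', a', ?_, ?_, fun h => ?_⟩
    · rw [List.map_cons, List.prod_cons, h1, e1]
    · rw [List.length_cons]
      push_cast
      rcases e2 with ⟨e2, -⟩ | e2 <;> omega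
    · rw [List.length_cons] at h
      push_cast at h
      rcases e2 with ⟨e2, e3⟩ | e2
      · rw [List.map_cons, List.prod_cons, h3 (by omega), e3]
      · omega

/-- The degree fixes the power of `τ` in any reduced expression. The rest is a word for `σ` with at
most as many letters as `σ` has inversions. That number is the modified length of `σ`, so the bound
is attained and the product is `T_σ`, whichever reduced expression was chosen. -/
theorem Tw_perm_mul_tau (hr : r ^ 2 = q) (hr0 : r ≠ 0) (hm : 1 ≤ m)
    (σ : Equiv.Perm (Fin (m + 1))) (j : ℤ) :
    H.Tw r (perm σ * AffineSchur.tau m ^ j) = H.TT σ * H.tauPow r j := by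
  obtain ⟨l, hl1, hl2⟩ := exists_word σ
  have hex : ∃ e, IsReduced (perm σ * AffineSchur.tau m ^ j) e := by
    obtain ⟨e, h1, h2⟩ := Nat.sInf_mem
      (s := {n | ∃ e, wordW e = perm σ * AffineSchur.tau m ^ j ∧ e.1.length = n})
      ⟨_, (l, j), by rw [wordW, hl2], rfl⟩
    exact ⟨e, h1, h2⟩
  rw [Tw]
  obtain ⟨h1, h2⟩ := Classical.epsilon_spec hex
  set e := Classical.epsilon (IsReduced (perm σ * AffineSchur.tau m ^ j)) with he
  have hdeg : e.2 = j := by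
    have h3 := congrArg degHom h1
    rw [wordW, map_mul, map_mul, map_zpow, map_zpow, degHom_perm, degHom_tau, map_list_prod,
      List.map_map, List.prod_eq_one, one_mul, one_mul, ← ofAdd_zsmul, ← ofAdd_zsmul] at h3
    · simpa using Multiplicative.ofAdd.injective h3
    · intro x hx
      obtain ⟨i, -, rfl⟩ := List.mem_map.1 hx
      exact degHom_affSimple hm i
  have hlen : e.1.length ≤ invCount σ := by
    rw [h2, ← hl1]
    exact Nat.sInf_le ⟨(l, j), by rw [wordW, hl2], rfl⟩
  have hprod : (e.1.map affSimple).prod = perm σ * transl 0 := by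
    rw [wordW, hdeg] at h1
    rw [transl_zero, mul_one]
    exact mul_right_cancel h1
  obtain ⟨σ', a', e1, e2, e3⟩ := H.exists_word_semiBasis hr hr0 hm e.1
  obtain ⟨rfl, rfl⟩ := perm_transl_injective (e1.symm.trans hprod)
  have h0 : semiLength σ' (0 : Fin (m + 1) → ℤ) = invCount σ' := by
    rw [semiLength, linWt_zero, add_zero]
  rw [word, e3 (by omega), semiBasis_zero, hdeg]

theorem Tw_perm (hr : r ^ 2 = q) (hr0 : r ≠ 0) (hm : 1 ≤ m) (σ : Equiv.Perm (Fin (m + 1))) :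
    H.Tw r (perm σ) = H.TT σ := by
  have h := H.Tw_perm_mul_tau hr hr0 hm σ 0
  rwa [zpow_zero, mul_one, show H.tauPow r 0 = 1 from pow_zero _, mul_one] at h

theorem tauPow_natCast (hr : r ^ 2 = q) (hr0 : r ≠ 0) {b : ℕ} (hb : b ≤ m + 1) :
    H.tauPow r b = H.semiBasis r (rot m ^ b) (firstExp b) := by
  change H.tau r ^ b = _
  induction b with
  | zero =>
    have : (firstExp 0 : Fin (m + 1) → ℤ) = 0 := rfl
    rw [pow_zero, pow_zero, this, semiBasis_zero, H.TT_one]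
  | succ b ih =>
    rw [pow_succ', ih (by omega), H.tau_mul_semiBasis hr hr0, ← pow_succ',
      firstExp_succ (by omega)]

theorem tauPow_neg_mul (hq : q ≠ 0) (hr0 : r ≠ 0) (b : ℤ) :
    H.tauPow r (-b) * H.tauPow r b = 1 := by
  rw [H.tauPow_eq hq hr0, H.tauPow_eq hq hr0, zpow_neg, Units.inv_mul]

variable (r) in
open scoped Classical in
/-- The sum of the basis elements over a double coset. -/
def dblSum (K J : Finset (Fin m)) (w : Weyl m) : A := ∑ u ∈ dblCoset K J w, H.Tw r u

open scoped Classical in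
theorem dblSum_transl (hr : r ^ 2 = q) (hr0 : r ≠ 0) (hm : 1 ≤ m) {a : Fin (m + 1) → ℤ}
    (h : ∀ j ∈ J, a j.castSucc = a j.succ) {g : Equiv.Perm (Fin (m + 1))} {b : ℤ}
    (ha : transl a = perm g * AffineSchur.tau m ^ b) (hg : IncOn J g⁻¹) :
    H.dblSum r J J (transl a) = H.vee J * (H.TT g * H.tauPow r b) := by
  rw [dblSum, dblCoset_eq h, Finset.sum_image, vee, Finset.sum_mul]
  · refine Finset.sum_congr rfl fun w hw => ?_
    rw [ha, ← mul_assoc, ← perm_mul, H.Tw_perm_mul_tau hr hr0 hm,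
      H.TT_mul_of_incOn_inv hg (mem_parabolicFinset.1 hw), mul_assoc]
  · exact fun w _ w' _ h => perm_injective (mul_right_cancel h)

open scoped Classical in
theorem dblSum_one (hr : r ^ 2 = q) (hr0 : r ≠ 0) (hm : 1 ≤ m) (h : J ⊆ K) :
    H.dblSum r K J 1 = H.vee K ∧ H.dblSum r J K 1 = H.vee K := by
  rw [dblSum, dblSum, (dblCoset_one_of_subset h).1, (dblCoset_one_of_subset h).2,
    Finset.sum_image perm_injective.injOn, vee]
  simp only [H.Tw_perm hr hr0 hm, and_self]

/-- The subalgebra generated by the `T_i`. -/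
def finiteHecke : Subalgebra k A := Algebra.adjoin k (Set.range H.T)

theorem mem_span_TT {h : A} (hh : h ∈ H.finiteHecke) : h ∈ Submodule.span k (Set.range H.TT) := by
  have key : ∀ x ∈ Submonoid.closure (Set.range H.T), x ∈ Submodule.span k (Set.range H.TT) := by
    intro x hx
    induction hx using Submonoid.closure_induction_left with
    | one => exact Submodule.subset_span ⟨1, H.TT_one⟩
    | mul_left x hx y hy' ih =>
      obtain ⟨i, rfl⟩ := hx
      clear hy'
      induction ih using Submodule.span_induction with
      | mem y hy =>
        obtain ⟨σ, rfl⟩ := hy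
        classical
        rw [H.T_mul_TT_ite]
        exact add_mem (Submodule.smul_mem _ _ (Submodule.subset_span ⟨_, rfl⟩))
          (Submodule.smul_mem _ _ (Submodule.subset_span ⟨_, rfl⟩))
      | zero => rw [mul_zero]; exact zero_mem _
      | add y z _ _ hy hz => rw [mul_add]; exact add_mem hy hz
      | smul c y _ hy => rw [mul_smul_comm]; exact Submodule.smul_mem _ _ hy
  have h1 : h ∈ Subalgebra.toSubmodule (Algebra.adjoin k (Set.range H.T)) := hh
  rw [Algebra.adjoin_eq_span] at h1
  exact Submodule.span_le.2 key h1

theorem TT_mul_vee {w : Equiv.Perm (Fin (m + 1))} (hw : w ∈ parabolic J) :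
    H.TT w * H.vee J = q ^ invCount w • H.vee J := by
  refine parabolic_induction (motive := fun w => H.TT w * H.vee J = q ^ invCount w • H.vee J)
    ?_ (fun w _ i hi hlt ih => ?_) w hw
  · rw [H.TT_one, one_mul, invCount_one, pow_zero, one_smul]
  · rw [H.TT_mul_simple hlt, mul_assoc, H.T_mul_vee hi, mul_smul_comm, ih, smul_smul,
      invCount_mul_of_lt hlt, pow_succ']

theorem homSum_add (f g : Equiv.Perm (Fin (m + 1)) → Laurent k m) :
    H.homSum J (f + g) = H.homSum J f + H.homSum J g := by
  rw [homSum, homSum, homSum, ← Finset.sum_add_distrib]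
  exact Finset.sum_congr rfl fun d _ => by rw [Pi.add_apply, map_add, add_mul, mul_add]

/-- Write `u = d w` with `w ∈ W_J`; then `T_w v_J` is the multiple `q^{ℓ(w)} v_J`, and only
constants appear as coefficients. -/
theorem exists_homSum_const {h : A} (hh : h ∈ H.finiteHecke) :
    ∃ c : Equiv.Perm (Fin (m + 1)) → k,
      h * H.vee J = H.homSum J fun d => algebraMap k (Laurent k m) (c d) := by
  have hs := H.mem_span_TT hh
  clear hh
  induction hs using Submodule.span_induction with
  | mem h hh =>
    classical
    obtain ⟨u, rfl⟩ := hh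
    obtain ⟨d, w, hd, hw, rfl⟩ := exists_incOn_mul J u
    refine ⟨fun d' => if d' = d then q ^ invCount w else 0, ?_⟩
    rw [homSum, Finset.sum_eq_single d]
    · simp only
      rw [if_pos trivial, AlgHom.commutes, H.TT_mul_of_incOn hd hw, mul_assoc, H.TT_mul_vee hw,
        ← Algebra.smul_def]
    · intro d' _ hne
      simp only
      rw [if_neg hne, map_zero, map_zero, zero_mul, mul_zero]
    · intro hd'
      exact absurd (mem_incFinset.2 hd) hd'
  | zero =>
    refine ⟨0, ?_⟩
    rw [zero_mul, homSum, Finset.sum_eq_zero]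
    intro d _
    rw [Pi.zero_apply, map_zero, map_zero, zero_mul, mul_zero]
  | add h g _ _ hh hg =>
    obtain ⟨c, hc⟩ := hh
    obtain ⟨e, he⟩ := hg
    refine ⟨c + e, ?_⟩
    rw [add_mul, hc, he, ← homSum_add]
    congr 1
    funext d
    rw [Pi.add_apply, Pi.add_apply, map_add]
  | smul a h _ hh =>
    obtain ⟨c, hc⟩ := hh
    refine ⟨a • c, ?_⟩
    rw [smul_mul_assoc, hc, homSum, homSum, Finset.smul_sum]
    refine Finset.sum_congr rfl fun d _ => ?_
    rw [AlgHom.commutes, AlgHom.commutes, Pi.smul_apply, smul_eq_mul, map_mul, mul_assoc,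
      ← Algebra.smul_def a, mul_smul_comm]

theorem exists_TT_inv (hq : q ≠ 0) (σ : Equiv.Perm (Fin (m + 1))) :
    ∃ D ∈ H.finiteHecke, D * H.TT σ = 1 ∧ H.TT σ * D = 1 := by
  induction σ using perm_induction with
  | one => exact ⟨1, one_mem _, by rw [H.TT_one, one_mul], by rw [H.TT_one, one_mul]⟩
  | mul σ i hi ih =>
    obtain ⟨D, hD, h1, h2⟩ := ih
    refine ⟨H.Tinv i * D, mul_mem ?_ hD, ?_, ?_⟩
    · exact add_mem (Subalgebra.smul_mem _ (Algebra.subset_adjoin (Set.mem_range_self i)) _)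
        (Subalgebra.algebraMap_mem _ _)
    · rw [H.TT_mul_simple hi, mul_assoc, ← mul_assoc D, h1, one_mul, H.Tinv_mul hq]
    · rw [H.TT_mul_simple hi, mul_assoc, ← mul_assoc (H.T i), H.T_mul_Tinv hq, one_mul, h2]

theorem commute_vee {y : A} (h : ∀ j ∈ J, H.T j * y = y * H.T j) : H.vee J * y = y * H.vee J := by
  refine Commute.sum_left _ _ _ fun w hw => ?_
  rw [mem_parabolicFinset] at hw
  refine parabolic_induction (motive := fun w => Commute (H.TT w) y) ?_
    (fun w _ i hi hlt ih => ?_) w hw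
  · rw [H.TT_one]; exact Commute.one_left y
  · rw [H.TT_mul_simple hlt]; exact ih.mul_left (h i hi)

variable {H} {S : Subalgebra k (CycEnd H.vee)}

/-- The coefficients of a homomorphism coming from the finite Hecke algebra are constants, and
multiplication by a constant needs no further generators. -/
theorem HasSplitsMerges.mem_finite (hq : q ≠ 0) (hS : H.HasSplitsMerges S) {h : A}
    (hh : h ∈ H.finiteHecke) (hK : ∀ i ∈ K, H.T i * (h * H.vee J) = q • (h * H.vee J)) :
    Mem S K J (h * H.vee J) := by
  classical
  obtain ⟨c, hc⟩ := H.exists_homSum_const (J := J) hh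
  rw [hc] at hK ⊢
  refine hS.mem_homSum hq hK fun σ _ _ _ => ⟨hS.mem_TT hq matches_levi, ?_⟩
  rw [AlgHom.commutes, ← Algebra.smul_def]
  exact (hS.merge subset_rfl).smul _

theorem T_mul_mon (hq : q ≠ 0) {a : Fin (m + 1) → ℤ} {j : Fin m}
    (h : a j.castSucc = a j.succ) : H.T j * (H.mon a : A) = H.mon a * H.T j := by
  have := H.T_comm_lau hq (i := j) (f := mono a) (by
    rw [permLaurent_mono, permExp_simplePerm_eq h])
  rwa [lau_mono] at this

theorem mul_inv_intertwine {M : Type*} [Monoid M] {x y t D : M} (h1 : D * t = 1) (h2 : t * D = 1)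
    (h : x * t = t * y) : y * D = D * x := by
  calc y * D = D * t * y * D := by rw [h1, one_mul]
    _ = D * (x * t) * D := by rw [h, mul_assoc D t]
    _ = D * x := by rw [← mul_assoc, mul_assoc _ t, h2, mul_one]

theorem mem_of_commute {y : A} (hy : ∀ j ∈ J, H.T j * y = y * H.T j)
    (h : ∀ φ, IsHom H.vee J J (H.vee J * y) φ → φ ∈ S) : Mem S J J (y * H.vee J) := by
  have hc := H.commute_vee hy
  obtain ⟨φ, hφ⟩ := exists_isHom (v := H.vee) (K := J) (J := J) (mem_cyc.2 ⟨y, hc.symm⟩)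
  exact ⟨φ, h φ (hc ▸ hφ), hφ⟩

/-- For `p = X_1 ⋯ X_b` and `d` the `b`-th power of the cycle, `T_τ^b` is a scalar times `T_d X^p`.
Thus `b^p_{J,J}` is a scalar times multiplication by `T_{d⁻¹} T_d X^p`, and the first two factors
are inverted inside the finite Hecke algebra. For the inverse monomial, `T_τ^{-b}` is used on the
Levi type obtained by transporting `J` through `d`. -/
theorem HasSplitsMerges.mem_firstExp (hr : r ^ 2 = q) (hr0 : r ≠ 0) (hm : 1 ≤ m)
    (hS : H.HasSplitsMerges S)
    (hD : ∀ (J : Finset (Fin m)) (a : Fin (m + 1) → ℤ), (∀ j ∈ J, a j.castSucc = a j.succ) →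
      ∀ φ, IsHom H.vee J J (H.dblSum r J J (transl a)) φ → φ ∈ S)
    {b : ℕ} (hb : b ≤ m + 1) (hJ : ∀ j ∈ J, (j : ℕ) + 1 ≠ b) :
    Mem S J J ((H.mon (firstExp b) : A) * H.vee J) ∧
      Mem S J J ((H.mon (-firstExp b) : A) * H.vee J) := by
  classical
  have hq : q ≠ 0 := hr ▸ pow_ne_zero 2 hr0
  set d := rot m ^ b with hd
  set p : Fin (m + 1) → ℤ := firstExp b with hp
  have hpc : ∀ j ∈ J, p j.castSucc = p j.succ := fun j hj => firstExp_const (hJ j hj)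
  have hpass : ∀ j ∈ J, ∃ i, Passes d i j := fun j hj => passes_rot_pow hb (hJ j hj)
  have hinc : IncOn J d := by
    intro j hj
    obtain ⟨i, hi⟩ := hpass j hj
    rw [hi.1, hi.2]
    exact Fin.castSucc_lt_succ
  obtain ⟨D, hDf, hD1, hD2⟩ := H.exists_TT_inv hq d
  have htau : H.tauPow r b = r ^ linWt p • (H.TT d * (H.mon p : A)) := H.tauPow_natCast hr hr0 hb
  have hrl : r ^ linWt p ≠ 0 := zpow_ne_zero _ hr0
  constructor
  · obtain ⟨D', hDf', hD1', hD2'⟩ := H.exists_TT_inv hq d⁻¹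
    have h1 := hD J p hpc
    rw [H.dblSum_transl hr hr0 hm hpc (transl_firstExp hb) (by rw [inv_inv]; exact hinc), htau,
      mul_smul_comm, ← hd, ← mul_assoc (H.TT d⁻¹)] at h1
    have hc : ∀ j ∈ J, H.T j * (H.TT d⁻¹ * H.TT d) = H.TT d⁻¹ * H.TT d * H.T j := by
      intro j hj
      obtain ⟨i, hi⟩ := hpass j hj
      rw [← mul_assoc, H.T_mul_TT_of_passes hi.inv, mul_assoc, H.T_mul_TT_of_passes hi, mul_assoc]
    -- `T_{d⁻¹} T_d` commutes with the `T_j`, `j ∈ J`, since these pass through `d` and back. Hence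
    -- its inverse `D D'` commutes too, and defines an endomorphism of `v_J A`.
    have e1 : (D * D') * (H.TT d⁻¹ * H.TT d) = 1 := by
      rw [mul_assoc, ← mul_assoc D', hD1', one_mul, hD1]
    have e2 : (H.TT d⁻¹ * H.TT d) * (D * D') = 1 := by
      rw [mul_assoc, ← mul_assoc (H.TT d), hD2, one_mul, hD2']
    have h2 : Mem S J J (D * D' * H.vee J) := by
      refine hS.mem_finite hq (mul_mem hDf hDf') fun j hj => ?_
      rw [← mul_assoc, mul_inv_intertwine e1 e2 (hc j hj), mul_assoc, H.T_mul_vee hj,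
        mul_smul_comm]
    have h1 := mem_of_commute (fun j hj => by
      rw [mul_smul_comm, smul_mul_assoc, ← mul_assoc, hc j hj, mul_assoc, T_mul_mon hq (hpc j hj)]
      simp only [mul_assoc]) h1
    have h3 := (h2.comp h1).smul (r ^ linWt p)⁻¹
    rwa [smul_mul_assoc, mul_smul_comm, smul_smul, inv_mul_cancel₀ hrl, one_smul, ← mul_assoc,
      ← mul_assoc (D * D'), e1, one_mul] at h3
  · have hmat : Matches d (leftLevi d Finset.univ J) J := by
      refine ⟨fun j hj => ?_, fun i hi => (Finset.mem_filter.1 hi).2⟩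
      obtain ⟨i, hi⟩ := hpass j hj
      exact ⟨i, Finset.mem_filter.2 ⟨Finset.mem_univ _, j, hj, hi⟩, hi⟩
    set L := leftLevi d Finset.univ J with hL
    have hconst : ∀ i ∈ L, (-permExp d p) i.castSucc = (-permExp d p) i.succ := by
      intro i hi
      obtain ⟨j, hj, hi⟩ := hmat.2 i hi
      rw [Pi.neg_apply, Pi.neg_apply, permExp_apply, permExp_apply, hi.inv.1, hi.inv.2, hpc j hj]
    have hLinc : IncOn L d⁻¹ := by
      intro i hi
      obtain ⟨j, hj, hi⟩ := hmat.2 i hi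
      rw [hi.inv.1, hi.inv.2]
      exact Fin.castSucc_lt_succ
    have h1 := hD L _ hconst
    rw [H.dblSum_transl hr hr0 hm hconst (transl_neg_firstExp hb) hLinc, ← hd] at h1
    have hneg : H.tauPow r (-(b : ℤ)) = (r ^ linWt p)⁻¹ • ((H.mon (-p) : A) * D) := by
      have h2 := H.tauPow_neg_mul hq hr0 (b : ℤ)
      have h3 : H.tauPow r b * ((r ^ linWt p)⁻¹ • ((H.mon (-p) : A) * D)) = 1 := by
        rw [htau, smul_mul_smul_comm, mul_inv_cancel₀ hrl, one_smul, mul_assoc,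
          ← mul_assoc (H.mon p : A), ← Units.val_mul, ← H.mon_add, add_neg_cancel, H.mon_zero,
          Units.val_one, one_mul, hD2]
      exact left_inv_eq_right_inv h2 h3
    have hTD : ∀ i ∈ L, ∃ j ∈ J, H.T i * H.TT d = H.TT d * H.T j ∧ H.T j * D = D * H.T i := by
      intro i hi
      obtain ⟨j, hj, hi⟩ := hmat.2 i hi
      exact ⟨j, hj, H.T_mul_TT_of_passes hi,
        mul_inv_intertwine hD1 hD2 (H.T_mul_TT_of_passes hi)⟩
    have hTD' : ∀ j ∈ J, ∃ i ∈ L, H.T j * D = D * H.T i := by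
      intro j hj
      obtain ⟨i, hi, hp⟩ := hmat.1 j hj
      exact ⟨i, hi, mul_inv_intertwine hD1 hD2 (H.T_mul_TT_of_passes hp)⟩
    have h2 : Mem S J L (D * H.vee L) := by
      refine hS.mem_finite hq hDf fun j hj => ?_
      obtain ⟨i, hi, h⟩ := hTD' j hj
      rw [← mul_assoc, h, mul_assoc, H.T_mul_vee hi, mul_smul_comm]
    have h1 := mem_of_commute (fun i hi => by
      obtain ⟨j, hj, h3, h4⟩ := hTD i hi
      rw [hneg, mul_smul_comm, mul_smul_comm, smul_mul_assoc, ← mul_assoc, h3, mul_assoc,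
        ← mul_assoc (H.T j), T_mul_mon hq (a := -p)
          (by rw [Pi.neg_apply, Pi.neg_apply, hpc j hj]), mul_assoc, h4]
      simp only [mul_assoc]) h1
    have h3 := (h2.comp (h1.comp (hS.mem_TT hq hmat))).smul (r ^ linWt p)
    rw [hneg, mul_smul_comm, smul_mul_assoc, mul_smul_comm, smul_smul, mul_inv_cancel₀ hrl,
      one_smul] at h3
    -- From `J` to `L` by `T_d`, then the endomorphism `T_d X^{-p} T_d⁻¹` of `v_L A`, then back by
    -- `T_d⁻¹`: the outer factors cancel.
    have h4 : D * (H.TT d * ((H.mon (-p) : A) * D) * (H.TT d * H.vee J)) =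
        (H.mon (-p) : A) * H.vee J := by
      calc D * (H.TT d * ((H.mon (-p) : A) * D) * (H.TT d * H.vee J))
          = (D * H.TT d) * (H.mon (-p) : A) * (D * H.TT d) * H.vee J := by
            simp only [mul_assoc]
        _ = (H.mon (-p) : A) * H.vee J := by rw [hD1, one_mul, mul_one]
    rwa [h4] at h3

/-- The exponents `a` for which both `X^a` and `X^{-a}` act within `S` form a group, and it contains
the exponents of `X_1 ⋯ X_b` for `b` at the end of a block. These span the exponents constant on
blocks. -/
theorem HasSplitsMerges.eq_top_of_dominant (hr : r ^ 2 = q) (hr0 : r ≠ 0) (hm : 1 ≤ m)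
    (hS : H.HasSplitsMerges S)
    (hD : ∀ (J : Finset (Fin m)) (a : Fin (m + 1) → ℤ), (∀ j ∈ J, a j.castSucc = a j.succ) →
      ∀ φ, IsHom H.vee J J (H.dblSum r J J (transl a)) φ → φ ∈ S) : S = ⊤ := by
  have hq : q ≠ 0 := hr ▸ pow_ne_zero 2 hr0
  refine hS.eq_top_of_monomials hq fun J a ha => ?_
  have hadd : ∀ a b, Mem S J J ((H.mon a : A) * H.vee J) → Mem S J J ((H.mon b : A) * H.vee J) →
      Mem S J J ((H.mon (a + b) : A) * H.vee J) := by
    intro a b h1 h2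
    have := h1.comp h2
    rwa [← mul_assoc, ← Units.val_mul, ← H.mon_add] at this
  have hzero : Mem S J J ((H.mon 0 : A) * H.vee J) := by
    rw [H.mon_zero, Units.val_one, one_mul]
    exact hS.merge subset_rfl
  let G : AddSubgroup (Fin (m + 1) → ℤ) :=
    { carrier := {a | Mem S J J ((H.mon a : A) * H.vee J) ∧ Mem S J J ((H.mon (-a) : A) * H.vee J)}
      add_mem' := fun {a b} ha hb => ⟨hadd a b ha.1 hb.1, by
        rw [neg_add]; exact hadd _ _ ha.2 hb.2⟩
      zero_mem' := ⟨hzero, by rw [neg_zero]; exact hzero⟩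
      neg_mem' := fun {a} ha => ⟨ha.2, by rw [neg_neg]; exact ha.1⟩ }
  have hG : a ∈ G := by
    rw [eq_sum_firstExp a]
    refine add_mem (sum_mem fun i _ => ?_) (zsmul_mem ?_ _)
    · by_cases hi : i ∈ J
      · rw [ha i hi, sub_self, zero_smul]; exact zero_mem _
      · exact zsmul_mem (hS.mem_firstExp hr hr0 hm hD (by omega) fun j hj h => hi (by
          rwa [← Fin.ext (Nat.succ_injective h)])) _
    · exact hS.mem_firstExp hr hr0 hm hD le_rfl fun j _ h => by omega
  rw [H.lau_mono]
  exact hG.1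

end HeckeModel

/-! ### The commutative algebra of invariants, and assembly of both statements. -/

namespace HeckeModel

variable {k : Type*} [Field k] {q : k} {m : ℕ} {A : Type*} [Ring A] [Algebra k A]
  (H : HeckeModel q m A) {J K : Finset (Fin m)} {r : k}

theorem isHom_merge (h : J ⊆ K) : ∃ φ, IsHom H.vee K J (H.vee K) φ := by
  classical
  have h1 := exists_isHom (v := H.vee) (K := K) (J := J) (y := H.relSum J K)
  rw [H.relSum_mul_vee h] at h1
  exact h1 (mem_cyc.2 ⟨1, (mul_one _).symm⟩)

theorem isHom_split (h : K ⊆ J) : ∃ φ, IsHom H.vee K J (H.vee J) φ := by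
  have h1 := exists_isHom (v := H.vee) (K := K) (J := J) (y := 1)
  rw [one_mul] at h1
  exact h1 (H.vee_mem_cyc h)

/-- Only nested pairs of subsets are needed; for those the double coset of `1` is the larger
parabolic subgroup. -/
theorem hasSplitsMerges (hr : r ^ 2 = q) (hr0 : r ≠ 0) (hm : 1 ≤ m)
    {S : Subalgebra k (CycEnd H.vee)}
    (hS : ∀ K J φ, IsHom H.vee K J (H.dblSum r K J 1) φ → φ ∈ S) : H.HasSplitsMerges S where
  merge {J K} h := by
    obtain ⟨φ, hφ⟩ := H.isHom_merge h
    exact ⟨φ, hS K J φ ((H.dblSum_one hr hr0 hm h).1.symm ▸ hφ), hφ⟩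
  split {J K} h := by
    obtain ⟨φ, hφ⟩ := H.isHom_split h
    exact ⟨φ, hS K J φ ((H.dblSum_one hr hr0 hm h).2.symm ▸ hφ), hφ⟩

/-- An invariant `f` commutes with the `T_j`, `j ∈ J`, so `f v_J = v_J f` lies in `v_J A`. -/
theorem isHom_invariant (hq : q ≠ 0) {f : Laurent k m}
    (hf : ∀ j ∈ J, permLaurent k (simplePerm j) f = f) :
    ∃ φ, IsHom H.vee J J (H.lau f * H.vee J) φ :=
  exists_isHom (mem_cyc.2 ⟨H.lau f, (H.commute_vee fun j hj => H.T_comm_lau hq (hf j hj)).symm⟩)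

/-- The multiplications by orbit sums. -/
def orbitEnds : Set (CycEnd H.vee) :=
  {φ | ∃ (J : Finset (Fin m)) (a : Fin (m + 1) → ℤ), IsDominant J a ∧
    IsHom H.vee J J ((∑ b ∈ orbitFinset J a, (H.mon b : A)) * H.vee J) φ}

theorem lau_orbitSum (a : Fin (m + 1) → ℤ) :
    H.lau (orbitSum k J a) = ∑ b ∈ orbitFinset J a, (H.mon b : A) := by
  rw [orbitSum, map_sum]
  simp only [H.lau_mono]

theorem orbitSum_invariant (a : Fin (m + 1) → ℤ) :
    ∀ j ∈ J, permLaurent k (simplePerm j) (orbitSum k J a) = orbitSum k J a :=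
  fun _ hj => permLaurent_orbitSum a (simplePerm_mem_parabolic hj)

theorem mem_span_orbitEnds (hq : q ≠ 0) {f : Laurent k m}
    (hf : ∀ j ∈ J, permLaurent k (simplePerm j) f = f) {φ : CycEnd H.vee}
    (hφ : IsHom H.vee J J (H.lau f * H.vee J) φ) : φ ∈ Submodule.span k H.orbitEnds := by
  have h1 := mem_span_orbitSum (P := fun _ => True) hf fun _ _ => trivial
  have h2 : ∃ φ ∈ Submodule.span k H.orbitEnds, IsHom H.vee J J (H.lau f * H.vee J) φ := by
    clear hf hφ
    induction h1 using Submodule.span_induction with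
    | mem f hf =>
      obtain ⟨a, ⟨ha, -⟩, rfl⟩ := hf
      obtain ⟨φ, hφ⟩ := H.isHom_invariant hq (orbitSum_invariant (k := k) (J := J) a)
      exact ⟨φ, Submodule.subset_span ⟨J, a, ha, H.lau_orbitSum (J := J) a ▸ hφ⟩, hφ⟩
    | zero => exact ⟨0, zero_mem _, by rw [map_zero, zero_mul]; exact isHom_zero⟩
    | add f g _ _ hf hg =>
      obtain ⟨φ, h1, h2⟩ := hf
      obtain ⟨ψ, h3, h4⟩ := hg
      exact ⟨φ + ψ, add_mem h1 h3, by rw [map_add, add_mul]; exact h2.add h4⟩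
    | smul c f _ hf =>
      obtain ⟨φ, h1, h2⟩ := hf
      exact ⟨c • φ, Submodule.smul_mem _ _ h1, by
        rw [map_smul, smul_mul_assoc]; exact h2.smul c⟩
  obtain ⟨ψ, h3, h4⟩ := h2
  rwa [hφ.unique h4]

theorem orbitEnds_mul (hq : q ≠ 0) {φ ψ : CycEnd H.vee} (hφ : φ ∈ H.orbitEnds)
    (hψ : ψ ∈ H.orbitEnds) : φ * ψ ∈ Submodule.span k H.orbitEnds ∧ φ * ψ = ψ * φ := by
  obtain ⟨J, a, -, h₁⟩ := hφ
  obtain ⟨K, b, -, h₂⟩ := hψ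
  by_cases hJK : K = J
  · subst hJK
    rw [← H.lau_orbitSum] at h₁ h₂
    have h3 := h₁.comp h₂
    have h4 := h₂.comp h₁
    rw [← mul_assoc, ← map_mul] at h3 h4
    refine ⟨H.mem_span_orbitEnds hq (fun j hj => ?_) h3, h3.unique ?_⟩
    · rw [map_mul, orbitSum_invariant a j hj, orbitSum_invariant b j hj]
    · rwa [mul_comm]
  · rw [h₁.mul_eq_zero hJK h₂, h₂.mul_eq_zero (Ne.symm hJK) h₁]
    exact ⟨zero_mem _, rfl⟩

/-- The algebra of multiplications by invariant Laurent polynomials. -/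
def invariantEnds (hq : q ≠ 0) : Subalgebra k (CycEnd H.vee) :=
  (Submodule.span k H.orbitEnds).toSubalgebra
    (by
      -- The identity is the sum over `J` of the multiplications by the invariant polynomial `1`.
      rw [← sum_incl_proj]
      refine sum_mem fun J _ => H.mem_span_orbitEnds hq (J := J) (f := 1) (fun j _ => map_one _) ?_
      rw [map_one, one_mul]
      exact isHom_one)
    (fun x y hx hy => by
      have h1 := Submodule.mul_mem_mul hx hy
      rw [Submodule.span_mul_span] at h1
      refine Submodule.span_le.2 ?_ h1
      rintro _ ⟨φ, hφ, ψ, hψ, rfl⟩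
      exact (H.orbitEnds_mul hq hφ hψ).1)

theorem invariantEnds_comm (hq : q ≠ 0) {x y : CycEnd H.vee} (hx : x ∈ H.invariantEnds hq)
    (hy : y ∈ H.invariantEnds hq) : x * y = y * x := by
  have h1 : ∀ φ ∈ H.orbitEnds, y * φ = φ * y := by
    intro φ hφ
    refine Submodule.span_induction (p := fun y _ => y * φ = φ * y) ?_ ?_ ?_ ?_ hy
    · exact fun ψ hψ => (H.orbitEnds_mul hq hψ hφ).2
    · rw [zero_mul, mul_zero]
    · intro a b _ _ ha hb; rw [add_mul, mul_add, ha, hb]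
    · intro c a _ ha; rw [smul_mul_assoc, mul_smul_comm, ha]
  refine Submodule.span_induction (p := fun x _ => x * y = y * x) ?_ ?_ ?_ ?_ hx
  · exact fun φ hφ => (h1 φ hφ).symm
  · rw [zero_mul, mul_zero]
  · intro a b _ _ ha hb; rw [add_mul, mul_add, ha, hb]
  · intro c a _ ha; rw [smul_mul_assoc, mul_smul_comm, ha]

theorem generation (hr : r ^ 2 = q) (hr0 : r ≠ 0) (hm : 1 ≤ m) {v : Finset (Fin m) → A}
    (hv : v = H.vee) :
    Algebra.adjoin k ({φ : CycEnd v | ∃ K J, IsHom v K J (H.dblSum r K J 1) φ} ∪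
      {φ | ∃ (J : Finset (Fin m)) (a : Fin (m + 1) → ℤ), IsDominant J a ∧
        IsHom v J J (H.dblSum r J J (transl a)) φ}) = ⊤ ∧
    ∃ Q : Subalgebra k (CycEnd v),
      Subalgebra.toSubmodule Q = Submodule.span k {φ | ∃ (J : Finset (Fin m))
        (a : Fin (m + 1) → ℤ), IsDominant J a ∧
          IsHom v J J ((∑ b ∈ orbitFinset J a, (H.mon b : A)) * v J) φ} ∧
      (∀ x ∈ Q, ∀ y ∈ Q, x * y = y * x) ∧
      Algebra.adjoin k ((Q : Set (CycEnd v)) ∪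
        {φ : CycEnd v | ∃ K J, IsHom v K J (H.dblSum r K J 1) φ}) = ⊤ := by
  have hq : q ≠ 0 := hr ▸ pow_ne_zero 2 hr0
  subst hv
  refine ⟨?_, H.invariantEnds hq, rfl, fun x hx y hy => H.invariantEnds_comm hq hx hy, ?_⟩
  · refine (H.hasSplitsMerges hr hr0 hm fun K J φ hφ => Algebra.subset_adjoin
      (Or.inl ⟨K, J, hφ⟩)).eq_top_of_dominant hr hr0 hm fun J a ha φ hφ =>
        Algebra.subset_adjoin (Or.inr ⟨J, a, ?_, hφ⟩)
    exact isDominant_iff.2 fun j hj => (ha j hj).ge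
  · refine (H.hasSplitsMerges hr hr0 hm fun K J φ hφ => Algebra.subset_adjoin
      (Or.inr ⟨K, J, hφ⟩)).eq_top_of_orbitSums hq fun L a ha => ?_
    obtain ⟨φ, hφ⟩ := H.isHom_invariant hq (orbitSum_invariant (k := k) (J := L) a)
    exact ⟨φ, Algebra.subset_adjoin (Or.inl
      (H.mem_span_orbitEnds hq (orbitSum_invariant a) hφ)), hφ⟩

end HeckeModel

/-! ### The presented Hecke algebra acts on rational functions. -/

section Instance

variable {k : Type*} [Field k] {m : ℕ}

/-- The Demazure–Lusztig operator of `s_i` as a linear map. -/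
def demLusLin (q : k) (i : Fin m) : Module.End k (RatFun k m) where
  toFun := demLus (cst k q) (varRat k i.castSucc) (varRat k i.succ) (permRat k (simplePerm i))
  map_add' f g := by simp only [demLus, map_add]; ring
  map_smul' c f := by
    rw [smul_eq_cst_mul, demLus_mul_fixed _ (permRat_cst _ c), ← smul_eq_cst_mul]; rfl

open Gen in
/-- The polynomial representation on generators. -/
def polyGen (q : k) : Gen m → Module.End k (RatFun k m)
  | T i => demLusLin q i
  | X i => LinearMap.mulLeft k (varRat k i)
  | Xinv i => LinearMap.mulLeft k (varRat k i)⁻¹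

theorem varRat_ne_zero (i : Fin (m + 1)) : varRat k i ≠ 0 := by
  rw [varRat, Ne, map_eq_zero_iff _ algebraMap_laurent_injective]
  exact mono_ne_zero _

theorem permRat_simple_simple (i : Fin m) (f : RatFun k m) :
    permRat k (simplePerm i) (permRat k (simplePerm i) f) = f := by
  rw [← permRat_mul, simplePerm_mul_self, permRat_one]

/-- Each defining relation holds for the Demazure–Lusztig operators and the multiplications by
variables, so the polynomial representation descends to the quotient. -/
theorem polyGen_rel (q : k) {a b : FreeAlgebra k (Gen m)} (h : Rel q m a b) :
    FreeAlgebra.lift k (polyGen q) a = FreeAlgebra.lift k (polyGen q) b := by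
  have hne : ∀ i : Fin m, varRat k i.castSucc ≠ varRat k i.succ := fun i =>
    varRat_injective.ne (Fin.castSucc_lt_succ).ne
  have hs1 : ∀ i : Fin m, permRat k (simplePerm i) (varRat k i.castSucc) = varRat k i.succ :=
    fun i => by rw [permRat_varRat, simplePerm_castSucc]
  have hs2 : ∀ i : Fin m, permRat k (simplePerm i) (varRat k i.succ) = varRat k i.castSucc :=
    fun i => by rw [permRat_varRat, simplePerm_succ]
  have hs3 : ∀ (i : Fin m) (j : Fin (m + 1)), j ≠ i.castSucc → j ≠ i.succ →
      permRat k (simplePerm i) (varRat k j) = varRat k j :=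
    fun i j h₁ h₂ => by rw [permRat_varRat, simplePerm_of_ne i h₁ h₂]
  cases h with
  | quadratic i =>
    ext f
    simp only [gen, map_mul, map_sub, map_add, FreeAlgebra.lift_ι_apply, AlgHom.commutes, map_one,
      map_zero, polyGen, Module.End.mul_apply, LinearMap.sub_apply, LinearMap.add_apply,
      Module.End.one_apply, LinearMap.zero_apply, Module.algebraMap_end_apply, smul_eq_cst_mul]
    have h1 := demLus_quadratic (hne i) (permRat_cst (simplePerm i) q) (hs1 i) (hs2 i)
      (permRat_simple_simple i) f
    change demLusLin q i (demLusLin q i f) = _ * demLusLin q i f + _ at h1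
    rw [h1]
    ring
  | far i j h =>
    ext f
    simp only [gen, map_mul, FreeAlgebra.lift_ι_apply, polyGen, Module.End.mul_apply]
    refine demLus_far (permRat_cst _ q) (permRat_cst _ q) ?_ ?_ ?_ ?_ (fun f => ?_) f
    · refine hs3 _ _ ?_ ?_ <;> rw [Ne, Fin.ext_iff] <;> simp <;> omega
    · refine hs3 _ _ ?_ ?_ <;> rw [Ne, Fin.ext_iff] <;> simp <;> omega
    · refine hs3 _ _ ?_ ?_ <;> rw [Ne, Fin.ext_iff] <;> simp <;> omega
    · refine hs3 _ _ ?_ ?_ <;> rw [Ne, Fin.ext_iff] <;> simp <;> omega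
    · rw [← permRat_mul, ← permRat_mul, simplePerm_far h]
  | braid i j h =>
    ext f
    simp only [gen, map_mul, FreeAlgebra.lift_ι_apply, polyGen, Module.End.mul_apply]
    have hij : j.castSucc = i.succ := Fin.ext (by simp [← h])
    have h1 : i.castSucc ≠ j.succ := by rw [Ne, Fin.ext_iff]; simp; omega
    have h2 : i.castSucc ≠ j.castSucc := by rw [Ne, Fin.ext_iff]; simp; omega
    have h3 : j.succ ≠ i.succ := by rw [Ne, Fin.ext_iff]; simp; omega
    have key := demLus_braid (q := cst k q) (x := varRat k i.castSucc) (y := varRat k i.succ)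
      (z := varRat k j.succ) (s := permRat k (simplePerm i)) (t := permRat k (simplePerm j))
      (hne i) (by rw [← hij]; exact hne j) (varRat_injective.ne h1) (permRat_cst _ q)
      (permRat_cst _ q) (hs1 i) (hs2 i) (hs3 i _ h1.symm h3) (hs3 j _ h2 h1)
      (by rw [← hij]; exact hs1 j) (by rw [← hij]; exact hs2 j) (permRat_simple_simple i)
      (permRat_simple_simple j) (fun f => by
        rw [← permRat_mul, ← permRat_mul, ← permRat_mul, ← permRat_mul, simplePerm_braid h]) f
    have hj : ∀ f, demLusLin q j f = demLus (cst k q) (varRat k i.succ) (varRat k j.succ)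
        (permRat k (simplePerm j)) f := fun f => by rw [← hij]; rfl
    simp only [hj]
    exact key
  | mul_inv i =>
    ext f
    simp only [gen, map_mul, FreeAlgebra.lift_ι_apply, polyGen, Module.End.mul_apply, map_one,
      LinearMap.mulLeft_apply, Module.End.one_apply]
    rw [mul_inv_cancel_left₀ (varRat_ne_zero i)]
  | inv_mul i =>
    ext f
    simp only [gen, map_mul, FreeAlgebra.lift_ι_apply, polyGen, Module.End.mul_apply, map_one,
      LinearMap.mulLeft_apply, Module.End.one_apply]
    rw [inv_mul_cancel_left₀ (varRat_ne_zero i)]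
  | comm i j =>
    ext f
    simp only [gen, map_mul, FreeAlgebra.lift_ι_apply, polyGen, Module.End.mul_apply,
      LinearMap.mulLeft_apply]
    ring
  | commTX i j h₁ h₂ =>
    ext f
    simp only [gen, map_mul, FreeAlgebra.lift_ι_apply, polyGen, Module.End.mul_apply,
      LinearMap.mulLeft_apply]
    exact demLus_mul_fixed _ (hs3 i j h₁ h₂) f
  | bernstein i =>
    ext f
    simp only [gen, map_mul, map_smul, FreeAlgebra.lift_ι_apply, polyGen, Module.End.mul_apply,
      LinearMap.mulLeft_apply, LinearMap.smul_apply, smul_eq_cst_mul]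
    exact demLus_bernstein (hne i) (permRat_cst _ q) (hs1 i) (hs2 i) (permRat_simple_simple i) f

open Gen in
/-- A quotient of the free algebra by the relations is a model of the Hecke algebra. -/
def HeckeModel.ofHom {q : k} {A : Type*} [Ring A] [Algebra k A]
    (φ : FreeAlgebra k (Gen m) →ₐ[k] A) (hφ : Function.Surjective φ)
    (hrel : ∀ a b, Rel q m a b → φ a = φ b) (X : Fin (m + 1) → Aˣ)
    (hX : ∀ i, (X i : A) = φ (gen k (.X i))) (hXinv : ∀ i, ((X i)⁻¹ : Aˣ).val = φ (gen k (.Xinv i)))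
    (rep : A →ₐ[k] Module.End k (RatFun k m))
    (hrep : ∀ a, rep (φ a) = FreeAlgebra.lift k (polyGen q) a) : HeckeModel q m A where
  T i := φ (gen k (.T i))
  X := X
  T_mul_self i := by
    have h := hrel _ _ (.quadratic i)
    rw [map_mul, map_sub, map_add, map_one, map_zero, AlgHom.commutes] at h
    rw [← sub_eq_zero, ← h, Algebra.algebraMap_eq_smul_one, mul_add, sub_mul, mul_one,
      smul_mul_assoc, one_mul, sub_smul, one_smul]
    abel
  T_far i j h := by
    have h := hrel _ _ (.far i j h)
    rwa [map_mul, map_mul] at h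
  T_braid i j h := by
    have h := hrel _ _ (.braid i j h)
    rwa [map_mul, map_mul, map_mul, map_mul] at h
  X_comm i j := by
    have h := hrel _ _ (.comm i j)
    rw [map_mul, map_mul, ← hX, ← hX] at h
    exact Units.ext h
  T_X i j h₁ h₂ := by
    have h := hrel _ _ (.commTX i j h₁ h₂)
    rwa [map_mul, map_mul, ← hX] at h
  T_X_T i := by
    have h := hrel _ _ (.bernstein i)
    rwa [map_mul, map_mul, map_smul, ← hX, ← hX] at h
  adjoin_eq_top := by
    have h1 : (Algebra.adjoin k (Set.range (FreeAlgebra.ι k (X := Gen m)))).map φ = ⊤ := by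
      rw [FreeAlgebra.adjoin_range_ι, Algebra.map_top, AlgHom.range_eq_top]
      exact hφ
    rw [AlgHom.map_adjoin] at h1
    rw [eq_top_iff, ← h1]
    refine Algebra.adjoin_mono ?_
    rintro _ ⟨_, ⟨g, rfl⟩, rfl⟩
    cases g with
    | T i => exact Or.inl (Or.inl ⟨i, rfl⟩)
    | X i => exact Or.inl (Or.inr ⟨i, hX i⟩)
    | Xinv i => exact Or.inr ⟨i, hXinv i⟩
  rep := rep
  rep_T i f := by
    rw [hrep, gen, FreeAlgebra.lift_ι_apply]; rfl
  rep_X i f := by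
    rw [hX, hrep, gen, FreeAlgebra.lift_ι_apply]; rfl

/-- The Hecke algebra of the Bernstein presentation is a model. -/
def heckeModel (q : k) (m : ℕ) : HeckeModel q m (Hecke q m) :=
  HeckeModel.ofHom (RingQuot.mkAlgHom k (Rel q m)) (RingQuot.mkAlgHom_surjective k (Rel q m))
    (fun _ _ h => RingQuot.mkAlgHom_rel k h) (hX q) (fun _ => rfl) (fun _ => rfl)
    (RingQuot.liftAlgHom k ⟨FreeAlgebra.lift k (polyGen q), fun _ _ h => polyGen_rel q h⟩)
    (fun a => RingQuot.liftAlgHom_mkAlgHom_apply k _ _ a)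

end Instance

/-! ### The residue cardinality is invertible in the coefficient field. -/

section LocalField

theorem natCast_card_residueField_ne_zero {k : Type*} [Field k] (ℓ p : ℕ) [CharP k ℓ]
    [Fact p.Prime] {F : Type*} [Field F] [Finite F] [CharP F p] (hℓ : ℓ ≠ p) :
    (Nat.card F : k) ≠ 0 := by
  have := Fintype.ofFinite F
  obtain ⟨n, hp, hn⟩ := FiniteField.card F p
  rw [Nat.card_eq_fintype_card, hn, Nat.cast_pow]
  refine pow_ne_zero _ fun h => ?_
  have h1 := (CharP.cast_eq_zero_iff k ℓ p).1 h
  rcases (Nat.dvd_prime hp).1 h1 with h2 | h2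
  · exact CharP.char_ne_one k ℓ h2
  · exact hℓ h2

end LocalField

end AffineSchur

end

theorem mainTheorem5 {k : Type*} [Field k] [IsAlgClosed k] (ℓ p : ℕ) [CharP k ℓ] [Fact p.Prime]
    {E : Type*} [Field E] [CharZero E] [ValuativeRel E] [TopologicalSpace E]
    [IsNonarchimedeanLocalField E] [CharP (IsLocalRing.ResidueField 𝒪[E]) p] (hℓ : ℓ ≠ p)
    (q : ℕ) (hq : q = Nat.card (IsLocalRing.ResidueField 𝒪[E])) (hq1 : (q : k) ≠ 1)
    (r : k) (hr : r ^ 2 = (q : k)) (m : ℕ) (hm : 1 ≤ m) :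
    Algebra.adjoin k (AffineSchur.splitsMerges (q : k) m r ∪ AffineSchur.dominantB (q : k) m r)
        = ⊤ ∧
      ∃ Q : Subalgebra k (AffineSchur.Schur (q : k) m r),
        Subalgebra.toSubmodule Q = Submodule.span k (AffineSchur.orbitMuls (q : k) m r) ∧
        (∀ x ∈ Q, ∀ y ∈ Q, x * y = y * x) ∧
        Algebra.adjoin k ((Q : Set (AffineSchur.Schur (q : k) m r)) ∪
          AffineSchur.splitsMerges (q : k) m r) = ⊤ := by
  have hq0 : (q : k) ≠ 0 := by
    rw [hq]
    exact AffineSchur.natCast_card_residueField_ne_zero ℓ p hℓ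
  have hr0 : r ≠ 0 := by
    rintro rfl
    exact hq0 (by rw [← hr, zero_pow two_ne_zero])
  -- On finite permutations the basis elements defined by reduced expressions are the `T_σ` of the
  -- model, so both versions of `v_J` coincide.
  have hv : AffineSchur.v (q : k) r = (AffineSchur.heckeModel (q : k) m).vee := by
    funext J
    exact Finset.sum_congr rfl fun σ _ =>
      (AffineSchur.heckeModel (q : k) m).Tw_perm hr hr0 hm σ
  exact (AffineSchur.heckeModel (q : k) m).generation hr hr0 hm hv
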